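/- **Notion of weak solution.** Let $m>0$, $t_0\in[-\infty,\infty)$, and let $I=[t_0,\infty)$ (with $I=\mathbb R$ if $t_0=-\infty$). A function $h\ge 0$ in $C^0(\mathbb R\times I)$ that belongs to $L^\infty(I\cap(-\infty,T];H^1(-R,R))$ for all $T,R$ is a weak solution of $$h_t+(h^m h_{xxx})_x=0 \tag{TFE}$$ if for a.e. $t\in I$ the product $q(\cdot,t)=h^{m/2}h_{xxx}$ exists as a distribution in $x$ and lies in $L^2(\mathbb R)$, the flux $h^m h_{xxx}:=h^{m/2}q$ is locally integrable on $\mathbb R\times I$, and for all $\psi\in C_c^\infty(\mathbb R\times I)$ $$\int_I\int_{\mathbb R}h\psi_t\,dx\,dt+\int_I\int_{\{h>0\}}h^m h_{xxx}\psi_x\,dx\,dt+\int_{\mathbb R}h(x,t_0)\psi(x,t_0)\,dx=0,$$ where the last term is absent if $t_0=-\infty$. Here the product $gS$ of a function $g$ with a distribution $S$ exists if, for some $k$, $g\in C^k$ and $S$ has order at most $k$, and it is then $\varphi\mapsto S(g\varphi)$. The solution has initial data $h_{\rm in}$ if $h(x,t)\to h_{\rm in}(x)$ as $t\to t_0$ for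 every $x$. **Statement.** (i) Let $m\in(0,4)$. For every $a>0$ there is a weak solution $h$ of (TFE) on $[0,\infty)$ with initial data $a|x|$ and a function $f:[0,\infty)\to(0,\infty)$ such that $$h(x,t)=t^{\frac1{4-m}}f\big(|x|/t^{\frac1{4-m}}\big)\qquad\text{for all }x\in\mathbb R,\ t>0.$$ In particular $h(\cdot,t)>0$ for every $t>0$: the touch-down point at $x=0$ is lifted. (ii) Let $m=4$. For every $a>0$ there are $b>0$, a function $f:[0,\infty)\to(0,\infty)$ and constants $K,z_0\in\mathbb C$ such that $h(x,t)=e^{bt}f(|x|/e^{bt})$ is a weak solution of (TFE) for all $t\in\mathbb R$. Here $z_0$ is the root of $(1-z^2)(2+z)+b/a^4$ with the largest negative real part and $\operatorname{Im}z_0\ge0$, it satisfies $\operatorname{Re}z_0<-1$, and $$f(y)=ay+\operatorname{Re}[Ky^{1+z_0}]+o(y^{1+\operatorname{Re}z_0})\qquad(y\to\infty).$$ Consequently, with $y=|x|/e^{bt}$, $$h(x,t)=a|x|+e^{bt}\operatorname{Re}\big[Ky^{1+z_0}\big]+e^{bt}\,o\big(y^{1+\operatorname{Re}z_0}\big)$$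 uniformly in $(x,t)$ as $y\to\infty$. Moreover, for every $R>0$, as $t\to-\infty$, the remainder $h(x,t)-a|x|-e^{bt}\operatorname{Re}[Ky^{1+z_0}]$ is $o(y^{1+\operatorname{Re}z_0})$ uniformly for $0<|x|\le R$, and $h(x,t)\to a|x|$ uniformly for $|x|\le R$. (iii) Let $m\in(2,4)$. For every $a>0$ the stationary function $a|x|$ is a weak solution of (TFE) on $[0,\infty)$ with initial data $a|x|$, and there is a second weak solution $h$ with the same initial data, of the self-similar form in (i), with $h(0,t)\neq0$ for all $t>0$. Hence weak solutions are not unique. -/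

import Mathlib

open Set Filter Topology MeasureTheory Asymptotics
open scoped ContDiff Distributions

namespace ThinFilm

noncomputable section

/-- The time interval `I = [t₀, ∞)`; for `t₀ = -∞` (written `⊥`) it is all of `ℝ`. -/
def timeInterval (t₀ : WithBot ℝ) : Set ℝ := {t : ℝ | t₀ ≤ (t : WithBot ℝ)}

/-- The filter `t → t₀`: from the right at a finite `t₀`, and `t → -∞` for `t₀ = -∞`. -/
def initialFilter (t₀ : WithBot ℝ) : Filter ℝ :=
  WithBot.recBotCoe (C := fun _ => Filter ℝ) atBot (fun s => 𝓝[>] s) t₀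

/-- `w` is the weak derivative of `u` on the real line. -/
def HasWeakDeriv (u w : ℝ → ℝ) : Prop :=
  LocallyIntegrable w ∧
    ∀ φ : ℝ → ℝ, ContDiff ℝ ∞ φ → HasCompactSupport φ →
      ∫ x, u x * deriv φ x = - ∫ x, w x * φ x

/-- The product of a `C^k` function and a compactly supported `C^k` test function. -/
def mulTest {k : ℕ} (g : ℝ → ℝ) (hg : ContDiff ℝ k g)
    (φ : 𝓓^{(k : ℕ∞)}((⊤ : TopologicalSpace.Opens ℝ), ℝ)) :
    𝓓^{(k : ℕ∞)}((⊤ : TopologicalSpace.Opens ℝ), ℝ) where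
  toFun := fun x => g x * φ x
  contDiff' := hg.mul φ.contDiff
  hasCompactSupport' := φ.hasCompactSupport.mul_left
  tsupport_subset' := fun _ _ => trivial

/-- The distribution `T` (of order at most `k`) is the third distributional derivative of `u`. -/
def IsThirdDeriv {k : ℕ} (u : ℝ → ℝ)
    (T : 𝓓'^{(k : ℕ∞)}((⊤ : TopologicalSpace.Opens ℝ), ℝ)) : Prop :=
  ∀ φ : 𝓓^{(k : ℕ∞)}((⊤ : TopologicalSpace.Opens ℝ), ℝ), ContDiff ℝ ∞ φ →
    T φ = - ∫ x, u x * iteratedDeriv 3 φ x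

/-- The product `u^{m/2} u_xxx` exists in the sense of distributions and is the function `q`.
A distribution can be multiplied by a `C^k` function if it has order at most `k`, that is, if it
extends (then uniquely) to a continuous functional `T` on the compactly supported `C^k` functions;
the product `g T` is `φ ↦ T (g φ)`. -/
def IsWeightedThirdDeriv (m : ℝ) (u q : ℝ → ℝ) : Prop :=
  ∃ (k : ℕ) (hg : ContDiff ℝ k (fun x => u x ^ (m / 2)))
    (T : 𝓓'^{(k : ℕ∞)}((⊤ : TopologicalSpace.Opens ℝ), ℝ)),
    IsThirdDeriv u T ∧
      ∀ φ : 𝓓^{(k : ℕ∞)}((⊤ : TopologicalSpace.Opens ℝ), ℝ), ContDiff ℝ ∞ φ →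
        T (mulTest (fun x => u x ^ (m / 2)) hg φ) = ∫ x, q x * φ x

/-- Weak solutions `h = h(x, t)` of `h_t + (h^m h_xxx)_x = 0` on `ℝ × [t₀, ∞)`. -/
structure IsWeakSolution (m : ℝ) (t₀ : WithBot ℝ) (h : ℝ → ℝ → ℝ) : Prop where
  continuousOn : ContinuousOn (fun p : ℝ × ℝ => h p.1 p.2) (univ ×ˢ timeInterval t₀)
  nonneg : ∀ x : ℝ, ∀ t ∈ timeInterval t₀, 0 ≤ h x t
  /-- `h ∈ L^∞(I ∩ (-∞, T]; H^1(-R, R))` for all `T` and `R`. -/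
  boundedH1 : ∀ T R : ℝ, ∃ C : ℝ, ∀ᵐ t : ℝ, t ∈ timeInterval t₀ → t ≤ T →
    ∃ w : ℝ → ℝ, HasWeakDeriv (fun x => h x t) w ∧
      MemLp w 2 (volume.restrict (Icc (-R) R)) ∧
      ∫ x in Icc (-R) R, (h x t ^ 2 + w x ^ 2) ≤ C
  /-- `q = h^{m/2} h_xxx` is in `L^2(ℝ)` for almost every time, the flux `h^m h_xxx = h^{m/2} q` is
  locally integrable, and the equation holds against all test functions in `C_c^∞(ℝ × I)`. The last
  integral is the contribution of the test function at a finite initial time. -/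
  weak : ∃ q : ℝ → ℝ → ℝ,
    (∀ᵐ t : ℝ, t ∈ timeInterval t₀ →
      MemLp (fun x => q x t) 2 volume ∧
        IsWeightedThirdDeriv m (fun x => h x t) (fun x => q x t)) ∧
    LocallyIntegrableOn (fun p : ℝ × ℝ => h p.1 p.2 ^ (m / 2) * q p.1 p.2)
      (univ ×ˢ timeInterval t₀) ∧
    ∀ ψ : ℝ × ℝ → ℝ, ContDiff ℝ ∞ ψ → HasCompactSupport ψ →
      (∫ t in timeInterval t₀, ∫ x, h x t * deriv (fun s => ψ (x, s)) t)
        + (∫ t in timeInterval t₀, ∫ x in {x | 0 < h x t},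
            h x t ^ (m / 2) * q x t * deriv (fun z => ψ (z, t)) x)
        + WithBot.recBotCoe (C := fun _ => ℝ) 0 (fun s => ∫ x, h x s * ψ (x, s)) t₀ = 0

/-- `h(x, t) → h_in(x)` as `t → t₀`. -/
def HasInitialData (t₀ : WithBot ℝ) (h : ℝ → ℝ → ℝ) (hin : ℝ → ℝ) : Prop :=
  ∀ x : ℝ, Tendsto (fun t => h x t) (initialFilter t₀) (𝓝 (hin x))

/-- `z₀` is the root of `(1 - z²)(2 + z) + β` with the largest negative real part, normalized by
`Im z₀ ≥ 0`. -/
def IsLeadingRoot (β : ℝ) (z₀ : ℂ) : Prop :=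
  (1 - z₀ ^ 2) * (2 + z₀) + (β : ℂ) = 0 ∧ z₀.re < 0 ∧ 0 ≤ z₀.im ∧
    ∀ z : ℂ, (1 - z ^ 2) * (2 + z) + (β : ℂ) = 0 → z.re < 0 → z.re ≤ z₀.re

end

end ThinFilm

/-! Substituting h(x,t) = λ(t) f(x/λ(t)) with λ' = b λ^(m-3) turns the equation into (f^m f_yyy)_y =
b (y f_y - f). The scale λ = t^(1/(4-m)) serves m < 4 and λ = e^(bt) serves m = 4, so everything
rests on one even positive profile f asymptotic to a|y|, together with bounds on its flux.

The profile comes from shooting with b = 1, f(0) = 1, f_yy(0) = p. In terms of w = f_yy, F = f^m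
f_yyy and G = y f_y - f the equation is a cyclic system with positive coefficients: w' = f^(-m) F,
F' = G, G' = y w. Hence the octants where w, F, G are all positive or all negative are forward
invariant. Data p ≤ 0 enter the negative octant and p = 13 the positive one. Both sets of parameters
are open and disjoint, so by connectedness some p > 0 enters neither (`exists_nonEscaping`). The
mobility is cut off below f = 1 to have global solutions; the cutoff is later shown to be inactive.

Along such a trajectory Λ = w F - G²/(2y) is nondecreasing, with Λ' = f^(-m) F² + G²/(2y²), and it
is never positive, since a positive value forces escape (`lyap_nonpos`). Thus both dissipation terms
are integrable at infinity. As (f/y)' = G/y², the chord slope f/y converges with rate y^(-1/2), and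
the bounds on flux, energy and dissipation follow in the same way. Positivity, f ≥ 1 with linear
growth, uses the first convex phase: if the curvature first vanishes at t, then Λ(t) = -G(t)²/(2t),
so f/y moves afterwards by at most G(t)/t and stays above 2/t (`one_le_and_linear_bound`). Scaling
then gives every slope a and, for m < 4, every rate b.

The ansatz solves the equation classically after the initial time. The flux bound |F| ≤ C (1 +
|y|^(3/2)) makes the flux of h integrable down to t = 0, and this gives the weak form
(`weak_identity`, `IsProfile.isWeakSolution`).

For m = 4 the quantity b/a⁴ is scale invariant, and the expansion depends on it. A monotonicity
estimate in the convex phase gives a⁴ ≤ 47/30 when b = 1 (`quot_limit_pow_four_le`). This is just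
enough for the two roots of (z² - 1)(z + 2) = a^(-4) other than the positive one z₁ to be a
conjugate pair -μ ± iν with μ = (2 + z₁)/2 > 3/2. In the variable log y the profile equation is
autonomous. Its deviation from the linearization at slope a is quadratic, so the a priori decay
e^(-s/2) bootstraps up to the rate of the pair. The unstable and neutral modes are integrated from
infinity and are of higher order, and the conjugate pair produces the term K y^(1+z₀)
(`IsLogProfile.exists_expansion`).

For m > 2 the cone is itself a stationary solution: its third derivative 2aδ' has order one, while
(a|x|)^(m/2) is C¹ and vanishes to first order at 0, so the product is zero. Together with the
lifted solution this gives non-uniqueness for 2 < m < 4. -/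

namespace ThinFilm

noncomputable section

/-! ### Global solutions of ordinary differential equations -/

section GlobalODE

variable {E : Type*} [NormedAddCommGroup E] [NormedSpace ℝ E] [CompleteSpace E]

/-- Global existence and continuous dependence for fields that are Lipschitz in the state with a
constant that depends continuously on time. -/
theorem exists_global_integral_solution (v : ℝ → E → E)
    (hv : Continuous (fun q : ℝ × E => v q.1 q.2)) (K : ℝ → ℝ) (hK : Continuous K)
    (hK0 : ∀ s, 0 ≤ K s) (hLip : ∀ s, 0 ≤ s → ∀ x y, ‖v s x - v s y‖ ≤ K s * ‖x - y‖)
    (hv0 : ∀ s, v s 0 = 0) :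
    ∃ X : E → ℝ → E, (∀ x₀, Continuous (X x₀)) ∧
      (∀ x₀ y, 0 ≤ y → X x₀ y = x₀ + ∫ s in (0 : ℝ)..y, v s (X x₀ s)) ∧
      ∀ y, 0 ≤ y → Continuous fun x₀ => X x₀ y := by
  -- Exponential weight: in the unknown Z = exp(-θ) X the Picard map contracts the sup norm by 1/2,
  -- because exp(-θ) ∫ K exp(θ) ≤ 1/2. One fixed point therefore covers the whole half line.
  set θ : ℝ → ℝ := fun y => ∫ s in (0 : ℝ)..y, 2 * K s with hθ
  have hKc : Continuous fun s => 2 * K s := by fun_prop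
  have hθd : ∀ y, HasDerivAt θ (2 * K y) y := fun y =>
    intervalIntegral.integral_hasDerivAt_right (hKc.intervalIntegrable _ _)
      (hKc.stronglyMeasurableAtFilter _ _) hKc.continuousAt
  have hθc : Continuous θ := continuous_iff_continuousAt.2 fun y => (hθd y).continuousAt
  have hθ0 : θ 0 = 0 := by simp [hθ]
  have hexp : ∀ y, ∫ s in (0 : ℝ)..y, K s * Real.exp (θ s) = (Real.exp (θ y) - 1) / 2 := by
    intro y
    have hd : ∀ s ∈ uIcc 0 y,
        HasDerivAt (fun s => Real.exp (θ s) / 2) (K s * Real.exp (θ s)) s := by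
      intro s _
      exact (((hθd s).exp).div_const 2).congr_deriv (by ring)
    rw [intervalIntegral.integral_eq_sub_of_hasDerivAt hd
      (Continuous.intervalIntegrable (by fun_prop) _ _), hθ0, Real.exp_zero]
    ring
  have hint : ∀ Z : ℝ → E, Continuous Z →
      Continuous (fun s => v s (Real.exp (θ s) • Z s)) := by
    intro Z hZ
    exact hv.comp (continuous_id.prodMk ((Real.continuous_exp.comp hθc).smul hZ))
  have hIest : ∀ (Z₁ Z₂ : ℝ → E) (C : ℝ), Continuous Z₁ → Continuous Z₂ → 0 ≤ C →
      (∀ s, ‖Z₁ s - Z₂ s‖ ≤ C) → ∀ y, 0 ≤ y →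
      Real.exp (-θ y) * ‖(∫ s in (0 : ℝ)..y, v s (Real.exp (θ s) • Z₁ s))
        - ∫ s in (0 : ℝ)..y, v s (Real.exp (θ s) • Z₂ s)‖ ≤ C / 2 := by
    intro Z₁ Z₂ C h₁ h₂ hC hd y hy
    rw [← intervalIntegral.integral_sub ((hint _ h₁).intervalIntegrable _ _)
      ((hint _ h₂).intervalIntegrable _ _)]
    have hle : ‖∫ s in (0 : ℝ)..y, (v s (Real.exp (θ s) • Z₁ s) - v s (Real.exp (θ s) • Z₂ s))‖
        ≤ ∫ s in (0 : ℝ)..y, C * (K s * Real.exp (θ s)) := by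
      refine intervalIntegral.norm_integral_le_of_norm_le hy ?_
        (Continuous.intervalIntegrable (by fun_prop) _ _)
      refine Eventually.of_forall fun s hs => ?_
      refine (hLip s hs.1.le _ _).trans ?_
      rw [← smul_sub, norm_smul, Real.norm_eq_abs, Real.abs_exp]
      have h3 : 0 ≤ K s * Real.exp (θ s) := mul_nonneg (hK0 s) (Real.exp_pos _).le
      nlinarith [mul_le_mul_of_nonneg_left (hd s) h3]
    rw [intervalIntegral.integral_const_mul, hexp] at hle
    calc _ ≤ Real.exp (-θ y) * (C * ((Real.exp (θ y) - 1) / 2)) := by gcongr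
      _ = C / 2 - C / 2 * Real.exp (-θ y) := by
        have : Real.exp (-θ y) * Real.exp (θ y) = 1 := by rw [← Real.exp_add]; simp
        linear_combination C / 2 * this
      _ ≤ C / 2 := by
        have := Real.exp_pos (-θ y)
        nlinarith [mul_nonneg hC this.le]
  have hθnn : ∀ y, 0 ≤ y → Real.exp (-θ y) ≤ 1 := by
    intro y hy
    rw [Real.exp_le_one_iff, neg_nonpos]
    exact intervalIntegral.integral_nonneg hy fun s _ => by have := hK0 s; positivity
  -- The absolute value extends the map evenly to negative times, so that the complete space of
  -- bounded continuous functions on ℝ can be used.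
  let U : E → (ℝ → E) → ℝ → E := fun x₀ Z y =>
    Real.exp (-θ |y|) • (x₀ + ∫ s in (0 : ℝ)..|y|, v s (Real.exp (θ s) • Z s))
  have hUc : ∀ x₀ Z, Continuous Z → Continuous (U x₀ Z) := by
    intro x₀ Z hZ
    have h1 : Continuous fun y => ∫ s in (0 : ℝ)..y, v s (Real.exp (θ s) • Z s) :=
      intervalIntegral.continuous_primitive (fun a b => (hint Z hZ).intervalIntegrable a b) 0
    have h2 : Continuous fun y : ℝ => ∫ s in (0 : ℝ)..|y|, v s (Real.exp (θ s) • Z s) :=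
      h1.comp continuous_abs
    have h3 : Continuous fun y : ℝ => Real.exp (-θ |y|) :=
      Real.continuous_exp.comp (hθc.comp continuous_abs).neg
    exact h3.smul (continuous_const.add h2)
  have hUdiff : ∀ x₀ x₁ (Z₁ Z₂ : ℝ → E) (C : ℝ), Continuous Z₁ → Continuous Z₂ → 0 ≤ C →
      (∀ s, ‖Z₁ s - Z₂ s‖ ≤ C) → ∀ y, ‖U x₀ Z₁ y - U x₁ Z₂ y‖ ≤ ‖x₀ - x₁‖ + C / 2 := by
    intro x₀ x₁ Z₁ Z₂ C h₁ h₂ hC hd y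
    have := hIest Z₁ Z₂ C h₁ h₂ hC hd |y| (abs_nonneg y)
    simp only [U]
    rw [← smul_sub, norm_smul, Real.norm_eq_abs, Real.abs_exp, add_sub_add_comm]
    calc _ ≤ Real.exp (-θ |y|) * (‖x₀ - x₁‖ + ‖(∫ s in (0 : ℝ)..|y|, v s (Real.exp (θ s) • Z₁ s))
        - ∫ s in (0 : ℝ)..|y|, v s (Real.exp (θ s) • Z₂ s)‖) := by
          gcongr; exact norm_add_le _ _
      _ ≤ _ := by
        rw [mul_add]
        have h4 := mul_le_mul_of_nonneg_right (hθnn |y| (abs_nonneg y)) (norm_nonneg (x₀ - x₁))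
        linarith
  have hUb : ∀ x₀ (Z : BoundedContinuousFunction ℝ E) y, ‖U x₀ Z y‖ ≤ ‖x₀‖ + ‖Z‖ / 2 := by
    intro x₀ Z y
    have h0 : U 0 (fun _ => 0) y = 0 := by simp [U, hv0]
    have := hUdiff x₀ 0 Z (fun _ => 0) ‖Z‖ Z.continuous continuous_const (norm_nonneg _)
      (fun s => by simpa using Z.norm_coe_le_norm s) y
    rwa [h0, sub_zero, sub_zero] at this
  let T : E → BoundedContinuousFunction ℝ E → BoundedContinuousFunction ℝ E := fun x₀ Z =>
    BoundedContinuousFunction.ofNormedAddCommGroup (U x₀ Z) (hUc x₀ Z Z.continuous)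
      (‖x₀‖ + ‖Z‖ / 2) (hUb x₀ Z)
  have hTdiff : ∀ x₀ x₁ Z₁ Z₂, dist (T x₀ Z₁) (T x₁ Z₂) ≤ ‖x₀ - x₁‖ + dist Z₁ Z₂ / 2 := by
    intro x₀ x₁ Z₁ Z₂
    refine (BoundedContinuousFunction.dist_le (by positivity)).2 fun y => ?_
    rw [dist_eq_norm]
    exact hUdiff x₀ x₁ Z₁ Z₂ (dist Z₁ Z₂) Z₁.continuous Z₂.continuous dist_nonneg
      (fun s => by rw [← dist_eq_norm]; exact BoundedContinuousFunction.dist_coe_le_dist s) y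
  have hTc : ∀ x₀, ContractingWith (1 / 2) (T x₀) := by
    intro x₀
    refine ⟨by rw [← NNReal.coe_lt_coe]; norm_num, LipschitzWith.of_dist_le_mul fun Z₁ Z₂ => ?_⟩
    have := hTdiff x₀ x₀ Z₁ Z₂
    rw [sub_self, norm_zero, zero_add] at this
    refine this.trans (le_of_eq ?_)
    push_cast
    ring
  let Z : E → BoundedContinuousFunction ℝ E := fun x₀ => ContractingWith.fixedPoint (T x₀) (hTc x₀)
  have hZ : ∀ x₀, T x₀ (Z x₀) = Z x₀ := fun x₀ => ContractingWith.fixedPoint_isFixedPt (hTc x₀)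
  refine ⟨fun x₀ y => Real.exp (θ y) • Z x₀ y, fun x₀ => ?_, fun x₀ y hy => ?_, fun y hy => ?_⟩
  · exact (Real.continuous_exp.comp hθc).smul (Z x₀).continuous
  · have h1 : Z x₀ y = U x₀ (Z x₀) y := by
      conv_lhs => rw [← hZ x₀]
      rfl
    simp only
    rw [h1]
    simp only [U, abs_of_nonneg hy]
    rw [smul_smul, ← Real.exp_add, add_neg_cancel, Real.exp_zero, one_smul]
  · have hL : ∀ x₀ x₁, dist (Z x₀) (Z x₁) ≤ 2 * dist x₀ x₁ := by
      intro x₀ x₁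
      have := hTdiff x₀ x₁ (Z x₀) (Z x₁)
      rw [hZ, hZ, ← dist_eq_norm] at this
      linarith
    have hZc : Continuous Z :=
      (LipschitzWith.of_dist_le_mul (K := 2) fun x₀ x₁ => by exact_mod_cast hL x₀ x₁).continuous
    have hev : Continuous fun x₀ => Z x₀ y := (continuous_eval_const y).comp hZc
    exact continuous_const.smul hev

end GlobalODE

/-! ### The regularised shooting problem -/

/-- The mobility factor `f ^ (-m)`, cut off below the height `1`. -/
def cutMobility (m f : ℝ) : ℝ := max f 1 ^ (-m)

theorem cutMobility_pos (m f : ℝ) : 0 < cutMobility m f :=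
  Real.rpow_pos_of_pos (by positivity) _

theorem cutMobility_le_one {m : ℝ} (hm : 0 < m) (f : ℝ) : cutMobility m f ≤ 1 :=
  Real.rpow_le_one_of_one_le_of_nonpos (le_max_right _ _) (by linarith)

theorem cutMobility_of_one_le {m f : ℝ} (hf : 1 ≤ f) : cutMobility m f = f ^ (-m) := by
  rw [cutMobility, max_eq_left hf]

theorem continuous_cutMobility (m : ℝ) : Continuous (cutMobility m) := by
  unfold cutMobility
  exact (continuous_id.max continuous_const).rpow_const fun x =>
    Or.inl (by have : (1 : ℝ) ≤ max x 1 := le_max_right _ _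
               simp only [id]; linarith)

theorem cutMobility_lipschitz {m : ℝ} (hm : 0 < m) (f g : ℝ) :
    |cutMobility m f - cutMobility m g| ≤ m * |f - g| := by
  have h1 : ‖(max f 1) ^ (-m) - (max g 1) ^ (-m)‖ ≤ m * ‖max f 1 - max g 1‖ := by
    refine Convex.norm_image_sub_le_of_norm_hasDerivWithin_le (s := Ici (1 : ℝ))
      (f := fun x : ℝ => x ^ (-m)) (f' := fun x : ℝ => -m * x ^ (-m - 1))
      (fun x hx => ?_) (fun x hx => ?_) (convex_Ici 1) (le_max_right g 1) (le_max_right f 1)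
    · have hx : (1 : ℝ) ≤ x := hx
      exact (Real.hasDerivAt_rpow_const (Or.inl (by linarith))).hasDerivWithinAt
    · have hx : (1 : ℝ) ≤ x := hx
      rw [norm_mul, norm_neg, Real.norm_eq_abs, Real.norm_eq_abs, abs_of_pos hm,
        abs_of_nonneg (Real.rpow_nonneg (by linarith) _)]
      have := Real.rpow_le_one_of_one_le_of_nonpos hx (show -m - 1 ≤ 0 by linarith)
      nlinarith
  refine h1.trans ?_
  gcongr
  exact abs_max_sub_max_le_abs f g 1

/-- Truncation of a real number to `[-N, N]`. -/
def clamp (N x : ℝ) : ℝ := max (-N) (min N x)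

theorem clamp_lipschitz (N x y : ℝ) : |clamp N x - clamp N y| ≤ |x - y| := by
  unfold clamp
  rw [max_comm (-N), max_comm (-N)]
  refine (abs_max_sub_max_le_abs _ _ _).trans ?_
  rw [min_comm N, min_comm N]
  simpa using abs_inf_sub_inf_le_abs x y N

theorem abs_clamp_le {N : ℝ} (hN : 0 ≤ N) (x : ℝ) : |clamp N x| ≤ N := by
  unfold clamp
  exact abs_le.2 ⟨le_max_left _ _, max_le (by linarith) (min_le_left _ _)⟩

theorem clamp_zero {N : ℝ} (hN : 0 ≤ N) : clamp N 0 = 0 := by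
  unfold clamp
  rw [min_eq_right hN, max_eq_right (by linarith)]

theorem abs_clamp_le_abs {N : ℝ} (hN : 0 ≤ N) (x : ℝ) : |clamp N x| ≤ |x| := by
  simpa [clamp_zero hN] using clamp_lipschitz N x 0

theorem clamp_of_abs_le {N x : ℝ} (h : |x| ≤ N) : clamp N x = x := by
  unfold clamp
  rw [min_eq_right (abs_le.1 h).2, max_eq_right (abs_le.1 h).1]

/-- Even solutions of `(f_yyy / ρ(f))_y = y f_y - f` with `f = 1` and `f_yy = p` at `y = 0`, written
as a first order system for `f`, `f₁ = f_y`, `w = f_yy`, `F = f_yyy / ρ(f)`. -/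
structure IsTrajectory (m p : ℝ) (f f₁ w F : ℝ → ℝ) : Prop where
  f_zero : f 0 = 1
  f₁_zero : f₁ 0 = 0
  w_zero : w 0 = p
  F_zero : F 0 = 0
  hf : ∀ y, HasDerivAt f (f₁ y) y
  hf₁ : ∀ y, HasDerivAt f₁ (w y) y
  hw : ∀ y, HasDerivAt w (cutMobility m (f y) * F y) y
  hF : ∀ y, HasDerivAt F (y * f₁ y - f y) y
  f_even : ∀ y, f (-y) = f y
  f₁_odd : ∀ y, f₁ (-y) = -f₁ y
  w_even : ∀ y, w (-y) = w y
  F_odd : ∀ y, F (-y) = -F y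

theorem integral_zero_neg_of_even {u : ℝ → ℝ} (hu : ∀ y, u (-y) = u y) (y : ℝ) :
    ∫ s in (0 : ℝ)..(-y), u s = -∫ s in (0 : ℝ)..y, u s := by
  have := intervalIntegral.integral_comp_neg (a := 0) (b := y) u
  simp only [hu, neg_zero] at this
  rw [this, intervalIntegral.integral_symm]

theorem integral_zero_neg_of_odd {u : ℝ → ℝ} (hu : ∀ y, u (-y) = -u y) (y : ℝ) :
    ∫ s in (0 : ℝ)..(-y), u s = ∫ s in (0 : ℝ)..y, u s := by
  have := intervalIntegral.integral_comp_neg (a := 0) (b := y) u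
  simp only [hu, neg_zero, intervalIntegral.integral_neg] at this
  rw [intervalIntegral.integral_symm, ← this, neg_neg]

theorem hasDerivAt_primitive {u : ℝ → ℝ} (hu : Continuous u) (y : ℝ) :
    HasDerivAt (fun y => ∫ s in (0 : ℝ)..y, u s) (u y) y :=
  intervalIntegral.integral_hasDerivAt_right (hu.intervalIntegrable _ _)
    (hu.stronglyMeasurableAtFilter _ _) hu.continuousAt

/-- The reflection of a solution on `[0, ∞)` is an even trajectory. -/
theorem exists_trajectory_of_integral_eq {m p : ℝ} {a₁ a₂ a₃ a₄ : ℝ → ℝ}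
    (h₃ : Continuous a₃)
    (e₁ : ∀ y, 0 ≤ y → a₁ y = 1 + ∫ s in (0 : ℝ)..y, a₂ s)
    (e₂ : ∀ y, 0 ≤ y → a₂ y = ∫ s in (0 : ℝ)..y, a₃ s)
    (e₃ : ∀ y, 0 ≤ y → a₃ y = p + ∫ s in (0 : ℝ)..y, cutMobility m (a₁ s) * a₄ s)
    (e₄ : ∀ y, 0 ≤ y → a₄ y = ∫ s in (0 : ℝ)..y, (s * a₂ s - a₁ s)) :
    ∃ f f₁ w F, IsTrajectory m p f f₁ w F ∧
      ∀ y, 0 ≤ y → f y = a₁ y ∧ f₁ y = a₂ y ∧ w y = a₃ y ∧ F y = a₄ y := by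
  set w : ℝ → ℝ := fun y => a₃ |y| with hw
  have wc : Continuous w := h₃.comp continuous_abs
  set f₁ : ℝ → ℝ := fun y => ∫ s in (0 : ℝ)..y, w s with hf₁
  have d₁ : ∀ y, HasDerivAt f₁ (w y) y := hasDerivAt_primitive wc
  have f₁c : Continuous f₁ := continuous_iff_continuousAt.2 fun y => (d₁ y).continuousAt
  set f : ℝ → ℝ := fun y => 1 + ∫ s in (0 : ℝ)..y, f₁ s with hf
  have d : ∀ y, HasDerivAt f (f₁ y) y := fun y => (hasDerivAt_primitive f₁c y).const_add 1
  have fc : Continuous f := continuous_iff_continuousAt.2 fun y => (d y).continuousAt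
  set F : ℝ → ℝ := fun y => ∫ s in (0 : ℝ)..y, (s * f₁ s - f s) with hF
  have dF : ∀ y, HasDerivAt F (y * f₁ y - f y) y := fun y =>
    hasDerivAt_primitive (u := fun s => s * f₁ s - f s) (by fun_prop) y
  have Fc : Continuous F := continuous_iff_continuousAt.2 fun y => (dF y).continuousAt
  have weven : ∀ y, w (-y) = w y := fun y => by simp [hw]
  have f₁odd : ∀ y, f₁ (-y) = -f₁ y := fun y => integral_zero_neg_of_even weven y
  have feven : ∀ y, f (-y) = f y := fun y => by
    simp only [hf, integral_zero_neg_of_odd f₁odd y]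
  have Fodd : ∀ y, F (-y) = -F y := fun y =>
    integral_zero_neg_of_even (u := fun s => s * f₁ s - f s)
      (fun s => by simp only [f₁odd, feven]; ring) y
  have q₃ : ∀ y, 0 ≤ y → w y = a₃ y := fun y hy => by simp [hw, abs_of_nonneg hy]
  have q₂ : ∀ y, 0 ≤ y → f₁ y = a₂ y := by
    intro y hy
    rw [e₂ y hy]
    refine intervalIntegral.integral_congr fun s hs => ?_
    rw [uIcc_of_le hy] at hs
    exact q₃ s hs.1
  have q₁ : ∀ y, 0 ≤ y → f y = a₁ y := by
    intro y hy
    rw [e₁ y hy]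
    simp only [hf]
    congr 1
    refine intervalIntegral.integral_congr fun s hs => ?_
    rw [uIcc_of_le hy] at hs
    exact q₂ s hs.1
  have q₄ : ∀ y, 0 ≤ y → F y = a₄ y := by
    intro y hy
    rw [e₄ y hy]
    refine intervalIntegral.integral_congr fun s hs => ?_
    rw [uIcc_of_le hy] at hs
    simp only [q₂ s hs.1, q₁ s hs.1]
  have mc : Continuous fun s => cutMobility m (f s) * F s :=
    ((continuous_cutMobility m).comp fc).mul Fc
  have weq' : ∀ y, 0 ≤ y → w y = p + ∫ s in (0 : ℝ)..y, cutMobility m (f s) * F s := by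
    intro y hy
    rw [q₃ y hy, e₃ y hy]
    congr 1
    refine intervalIntegral.integral_congr fun s hs => ?_
    rw [uIcc_of_le hy] at hs
    simp only [q₄ s hs.1, q₁ s hs.1]
  have weq : w = fun y => p + ∫ s in (0 : ℝ)..y, cutMobility m (f s) * F s := by
    funext y
    rcases le_total 0 y with hy | hy
    · exact weq' y hy
    · have h1 := weq' (-y) (by linarith)
      rw [weven] at h1
      rw [h1, integral_zero_neg_of_odd (u := fun s => cutMobility m (f s) * F s)
        (fun s => by rw [feven, Fodd]; ring)]
  refine ⟨f, f₁, w, F, ⟨by simp [hf], by simp [hf₁], ?_, by simp [hF], d, d₁, ?_, dF, feven, f₁odd,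
    weven, Fodd⟩, fun y hy => ⟨q₁ y hy, q₂ y hy, q₃ y hy, q₄ y hy⟩⟩
  · rw [weq' 0 le_rfl]; simp
  · intro y
    have := (hasDerivAt_primitive mc y).const_add p
    rw [← weq] at this
    exact this

/-- The truncated right-hand side of the first order system. -/
def truncField (m : ℝ) (N : ℝ → ℝ) (s : ℝ) (x : ℝ × ℝ × ℝ × ℝ) : ℝ × ℝ × ℝ × ℝ :=
  (x.2.1, x.2.2.1, cutMobility m x.1 * clamp (N s) x.2.2.2, s * x.2.1 - x.1)

/-- The only nonlinearity is the product of the cut-off mobility, bounded and Lipschitz in `f`, with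
`F`. Clamping `F` at `N s` makes this product globally Lipschitz. -/
theorem norm_truncField_sub_le {m : ℝ} (hm : 0 < m) {N : ℝ → ℝ} (hN : ∀ s, 0 ≤ N s) {s : ℝ}
    (hs : 0 ≤ s) (x y : ℝ × ℝ × ℝ × ℝ) :
    ‖truncField m N s x - truncField m N s y‖ ≤ (1 + s + m * N s) * ‖x - y‖ := by
  have n1 : |x.1 - y.1| ≤ ‖x - y‖ := norm_fst_le (x - y)
  have nr : ‖(x - y).2‖ ≤ ‖x - y‖ := norm_snd_le (x - y)
  have n2 : |x.2.1 - y.2.1| ≤ ‖x - y‖ := (norm_fst_le (x - y).2).trans nr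
  have nr' : ‖(x - y).2.2‖ ≤ ‖x - y‖ := (norm_snd_le (x - y).2).trans nr
  have n3 : |x.2.2.1 - y.2.2.1| ≤ ‖x - y‖ := (norm_fst_le (x - y).2.2).trans nr'
  have n4 : |x.2.2.2 - y.2.2.2| ≤ ‖x - y‖ := (norm_snd_le (x - y).2.2).trans nr'
  have hN' := mul_nonneg hm.le (hN s)
  have hD := norm_nonneg (x - y)
  have hC : ∀ t, t ≤ ‖x - y‖ → t ≤ (1 + s + m * N s) * ‖x - y‖ := by
    intro t ht
    nlinarith [mul_nonneg hs hD, mul_nonneg hN' hD]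
  refine (norm_prod_le_iff).2 ⟨hC _ n2, (norm_prod_le_iff).2 ⟨hC _ n3, (norm_prod_le_iff).2
    ⟨?_, ?_⟩⟩⟩
  · change |cutMobility m x.1 * clamp (N s) x.2.2.2 - cutMobility m y.1 * clamp (N s) y.2.2.2| ≤ _
    have e : cutMobility m x.1 * clamp (N s) x.2.2.2 - cutMobility m y.1 * clamp (N s) y.2.2.2
        = cutMobility m x.1 * (clamp (N s) x.2.2.2 - clamp (N s) y.2.2.2)
          + (cutMobility m x.1 - cutMobility m y.1) * clamp (N s) y.2.2.2 := by ring
    rw [e]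
    refine (abs_add_le _ _).trans ?_
    rw [abs_mul, abs_mul, abs_of_pos (cutMobility_pos m x.1)]
    have t1 := (clamp_lipschitz (N s) x.2.2.2 y.2.2.2).trans n4
    have t2 := cutMobility_lipschitz hm x.1 y.1
    have t3 : cutMobility m x.1 * |clamp (N s) x.2.2.2 - clamp (N s) y.2.2.2| ≤ 1 * ‖x - y‖ :=
      mul_le_mul (cutMobility_le_one hm _) t1 (abs_nonneg _) zero_le_one
    have t4 : |cutMobility m x.1 - cutMobility m y.1| * |clamp (N s) y.2.2.2|
        ≤ (m * ‖x - y‖) * N s :=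
      mul_le_mul (t2.trans (by gcongr)) (abs_clamp_le (hN s) _) (abs_nonneg _) (by positivity)
    nlinarith [mul_nonneg hs hD]
  · change |(s * x.2.1 - x.1) - (s * y.2.1 - y.1)| ≤ _
    have e : (s * x.2.1 - x.1) - (s * y.2.1 - y.1) = s * (x.2.1 - y.2.1) - (x.1 - y.1) := by ring
    rw [e]
    refine (abs_sub _ _).trans ?_
    rw [abs_mul, abs_of_nonneg hs]
    nlinarith [mul_le_mul_of_nonneg_left n2 hs, mul_nonneg hN' hD]

/-- The growth rate does not involve `N`. Grönwall therefore gives an a priori bound first, and `N`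
can be chosen above it afterwards. -/
theorem norm_truncField_le {m : ℝ} (hm : 0 < m) {N : ℝ → ℝ} (hN : ∀ s, 0 ≤ N s) {s : ℝ}
    (hs : 0 ≤ s) (x : ℝ × ℝ × ℝ × ℝ) : ‖truncField m N s x‖ ≤ (1 + s) * ‖x‖ := by
  have n1 : |x.1| ≤ ‖x‖ := norm_fst_le x
  have nr : ‖x.2‖ ≤ ‖x‖ := norm_snd_le x
  have n2 : |x.2.1| ≤ ‖x‖ := (norm_fst_le x.2).trans nr
  have nr' : ‖x.2.2‖ ≤ ‖x‖ := (norm_snd_le x.2).trans nr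
  have n3 : |x.2.2.1| ≤ ‖x‖ := (norm_fst_le x.2.2).trans nr'
  have n4 : |x.2.2.2| ≤ ‖x‖ := (norm_snd_le x.2.2).trans nr'
  have hD := norm_nonneg x
  have hC : ∀ t, t ≤ ‖x‖ → t ≤ (1 + s) * ‖x‖ := by
    intro t ht
    nlinarith [mul_nonneg hs hD]
  refine (norm_prod_le_iff).2 ⟨hC _ n2, (norm_prod_le_iff).2 ⟨hC _ n3, (norm_prod_le_iff).2
    ⟨hC _ ?_, ?_⟩⟩⟩
  · change |cutMobility m x.1 * clamp (N s) x.2.2.2| ≤ _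
    rw [abs_mul, abs_of_pos (cutMobility_pos m x.1)]
    have := mul_le_mul (cutMobility_le_one hm x.1) ((abs_clamp_le_abs (hN s) x.2.2.2).trans n4)
      (abs_nonneg _) zero_le_one
    linarith
  · change |s * x.2.1 - x.1| ≤ _
    refine (abs_sub _ _).trans ?_
    rw [abs_mul, abs_of_nonneg hs]
    nlinarith [mul_le_mul_of_nonneg_left n2 hs]

theorem continuous_truncField (m : ℝ) {N : ℝ → ℝ} (hN : Continuous N) :
    Continuous fun q : ℝ × (ℝ × ℝ × ℝ × ℝ) => truncField m N q.1 q.2 := by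
  have h1 : Continuous fun q : ℝ × (ℝ × ℝ × ℝ × ℝ) => cutMobility m q.2.1 :=
    (continuous_cutMobility m).comp (by fun_prop)
  have h2 : Continuous fun q : ℝ × (ℝ × ℝ × ℝ × ℝ) => clamp (N q.1) q.2.2.2.2 := by
    unfold clamp
    fun_prop
  unfold truncField
  fun_prop

/-- The truncated field has global solutions depending continuously on the initial state, and the
truncation level is never reached for |p| ≤ P, so these solve the untruncated system. -/
theorem exists_trajectories {m : ℝ} (hm : 0 < m) (P : ℝ) :
    ∃ f f₁ w F : ℝ → ℝ → ℝ,
      (∀ p, |p| ≤ P → IsTrajectory m p (f p) (f₁ p) (w p) (F p)) ∧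
      ∀ y, 0 ≤ y → ContinuousOn (fun p => f p y) (Icc (-P) P) ∧
        ContinuousOn (fun p => f₁ p y) (Icc (-P) P) ∧
        ContinuousOn (fun p => w p y) (Icc (-P) P) ∧
        ContinuousOn (fun p => F p y) (Icc (-P) P) := by
  -- This is the Grönwall bound at time `s` for growth rate `1 + s` and initial state (1, 0, p, 0)
  -- with |p| ≤ P.
  set N : ℝ → ℝ := fun s => max 1 |P| * Real.exp ((1 + s) * s) with hNdef
  have hNc : Continuous N := by fun_prop
  have hN0 : ∀ s, 0 ≤ N s := fun s => by positivity
  obtain ⟨X, hXc, hXe, hXp⟩ := exists_global_integral_solution (truncField m N)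
    (continuous_truncField m hNc) (fun s => 1 + |s| + m * N s) (by fun_prop)
    (fun s => by have := hN0 s; positivity)
    (fun s hs x y => by
      have := norm_truncField_sub_le hm hN0 hs x y
      rwa [abs_of_nonneg hs])
    (fun s => by simp [truncField, clamp_zero (hN0 s)])
  have hvc : ∀ x₀, Continuous fun s => truncField m N s (X x₀ s) := fun x₀ =>
    (continuous_truncField m hNc).comp (continuous_id.prodMk (hXc x₀))
  have hb : ∀ p, |p| ≤ P → ∀ y, 0 ≤ y → |(X (1, 0, p, 0) y).2.2.2| ≤ N y := by
    intro p hp y hy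
    set x₀ : ℝ × ℝ × ℝ × ℝ := (1, 0, p, 0) with hx₀
    have hx₀n : ‖x₀‖ ≤ max 1 |P| := by
      have : |p| ≤ |P| := hp.trans (le_abs_self P)
      have h0 : (0 : ℝ) ≤ max 1 |P| := by positivity
      simp only [hx₀, Prod.norm_def, norm_one, norm_zero, Real.norm_eq_abs]
      exact max_le (le_max_left _ _) (max_le h0 (max_le (this.trans (le_max_right _ _)) h0))
    have hd : ∀ s ∈ Ico 0 y, HasDerivWithinAt (X x₀) (truncField m N s (X x₀ s)) (Ici s) s := by
      intro s hs
      have h1 : HasDerivAt (fun y => x₀ + ∫ s in (0 : ℝ)..y, truncField m N s (X x₀ s))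
          (truncField m N s (X x₀ s)) s :=
        (intervalIntegral.integral_hasDerivAt_right ((hvc x₀).intervalIntegrable _ _)
          ((hvc x₀).stronglyMeasurableAtFilter _ _) (hvc x₀).continuousAt).const_add x₀
      exact h1.hasDerivWithinAt.congr (fun z hz => hXe x₀ z (hs.1.trans hz)) (hXe x₀ s hs.1)
    have h0 : X x₀ 0 = x₀ := by rw [hXe x₀ 0 le_rfl]; simp
    have := norm_le_gronwallBound_of_norm_deriv_right_le (K := 1 + y) (ε := 0) (δ := max 1 |P|)
      (hXc x₀).continuousOn hd (by rw [h0]; exact hx₀n) (fun s hs => by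
        have h2 := norm_truncField_le hm hN0 hs.1 (X x₀ s)
        have h3 : (1 + s) * ‖X x₀ s‖ ≤ (1 + y) * ‖X x₀ s‖ := by
          gcongr
          exact hs.2.le
        linarith) y ⟨hy, le_rfl⟩
    rw [gronwallBound_ε0, sub_zero] at this
    refine le_trans ?_ this
    exact (norm_snd_le (X x₀ y).2.2).trans ((norm_snd_le (X x₀ y).2).trans (norm_snd_le (X x₀ y)))
  have key : ∀ p, |p| ≤ P → ∃ f f₁ w F, IsTrajectory m p f f₁ w F ∧
      ∀ y, 0 ≤ y → f y = (X (1, 0, p, 0) y).1 ∧ f₁ y = (X (1, 0, p, 0) y).2.1 ∧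
        w y = (X (1, 0, p, 0) y).2.2.1 ∧ F y = (X (1, 0, p, 0) y).2.2.2 := by
    intro p hp
    set x₀ : ℝ × ℝ × ℝ × ℝ := (1, 0, p, 0) with hx₀
    have hi : ∀ y, IntervalIntegrable (fun s => truncField m N s (X x₀ s)) volume 0 y := fun y =>
      (hvc x₀).intervalIntegrable _ _
    have E : ∀ (L : (ℝ × ℝ × ℝ × ℝ) →L[ℝ] ℝ) y, 0 ≤ y →
        L (X x₀ y) = L x₀ + ∫ s in (0 : ℝ)..y, L (truncField m N s (X x₀ s)) := by
      intro L y hy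
      rw [ContinuousLinearMap.intervalIntegral_comp_comm L (hi y), ← map_add, ← hXe x₀ y hy]
    refine exists_trajectory_of_integral_eq (p := p) (by have := hXc x₀; fun_prop) ?_ ?_ ?_ ?_
    · intro y hy
      exact E (ContinuousLinearMap.fst ℝ ℝ (ℝ × ℝ × ℝ)) y hy
    · intro y hy
      have := E ((ContinuousLinearMap.fst ℝ ℝ (ℝ × ℝ)).comp
        (ContinuousLinearMap.snd ℝ ℝ (ℝ × ℝ × ℝ))) y hy
      simpa [hx₀, truncField] using this
    · intro y hy
      have := E ((ContinuousLinearMap.fst ℝ ℝ ℝ).comp ((ContinuousLinearMap.snd ℝ ℝ (ℝ × ℝ)).comp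
        (ContinuousLinearMap.snd ℝ ℝ (ℝ × ℝ × ℝ)))) y hy
      simp only [ContinuousLinearMap.coe_comp, ContinuousLinearMap.coe_fst',
        ContinuousLinearMap.coe_snd', Function.comp, truncField] at this
      rw [this]
      congr 1
      refine intervalIntegral.integral_congr fun s hs => ?_
      rw [uIcc_of_le hy] at hs
      rw [clamp_of_abs_le (hb p hp s hs.1)]
    · intro y hy
      have := E ((ContinuousLinearMap.snd ℝ ℝ ℝ).comp ((ContinuousLinearMap.snd ℝ ℝ (ℝ × ℝ)).comp
        (ContinuousLinearMap.snd ℝ ℝ (ℝ × ℝ × ℝ)))) y hy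
      simpa [hx₀, truncField] using this
  choose! f f₁ w F hT hE using key
  refine ⟨f, f₁, w, F, hT, fun y hy => ?_⟩
  have hc : Continuous fun p : ℝ => X (1, 0, p, 0) y :=
    (hXp y hy).comp (by fun_prop)
  have hI : ∀ p ∈ Icc (-P) P, |p| ≤ P := fun p hp => abs_le.2 hp
  refine ⟨?_, ?_, ?_, ?_⟩
  · exact (hc.fst.continuousOn).congr fun p hp => (hE p (hI p hp) y hy).1
  · exact (hc.snd.fst.continuousOn).congr fun p hp => (hE p (hI p hp) y hy).2.1
  · exact (hc.snd.snd.fst.continuousOn).congr fun p hp => (hE p (hI p hp) y hy).2.2.1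
  · exact (hc.snd.snd.snd.continuousOn).congr fun p hp => (hE p (hI p hp) y hy).2.2.2

end

end ThinFilm

namespace ThinFilm

noncomputable section

/-! ### Elementary calculus -/

theorem le_of_hasDerivAt_nonneg {u u' : ℝ → ℝ} {a b : ℝ} (hab : a ≤ b)
    (hu : ∀ y ∈ Icc a b, HasDerivAt u (u' y) y) (h : ∀ y ∈ Ioo a b, 0 ≤ u' y) : u a ≤ u b := by
  have hm : MonotoneOn u (Icc a b) := by
    refine monotoneOn_of_deriv_nonneg (convex_Icc a b)
      (fun y hy => (hu y hy).continuousAt.continuousWithinAt) (fun y hy => ?_) fun y hy => ?_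
    · rw [interior_Icc] at hy
      exact (hu y (Ioo_subset_Icc_self hy)).differentiableAt.differentiableWithinAt
    · rw [interior_Icc] at hy
      rw [(hu y (Ioo_subset_Icc_self hy)).deriv]
      exact h y hy
  exact hm (left_mem_Icc.2 hab) (right_mem_Icc.2 hab) hab

theorem lt_of_hasDerivAt_pos {u u' : ℝ → ℝ} {a b : ℝ} (hab : a < b)
    (hu : ∀ y ∈ Icc a b, HasDerivAt u (u' y) y) (h : ∀ y ∈ Ioo a b, 0 < u' y) : u a < u b := by
  have hm : StrictMonoOn u (Icc a b) := by
    refine strictMonoOn_of_deriv_pos (convex_Icc a b)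
      (fun y hy => (hu y hy).continuousAt.continuousWithinAt) fun y hy => ?_
    rw [interior_Icc] at hy
    rw [(hu y (Ioo_subset_Icc_self hy)).deriv]
    exact h y hy
  exact hm (left_mem_Icc.2 hab.le) (right_mem_Icc.2 hab.le) hab

theorem sub_le_sub_of_hasDerivAt_le {u u' v v' : ℝ → ℝ} {a b : ℝ} (hab : a ≤ b)
    (hu : ∀ y ∈ Icc a b, HasDerivAt u (u' y) y) (hv : ∀ y ∈ Icc a b, HasDerivAt v (v' y) y)
    (h : ∀ y ∈ Ioo a b, u' y ≤ v' y) : u b - u a ≤ v b - v a := by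
  have := le_of_hasDerivAt_nonneg (u := fun y => v y - u y) (u' := fun y => v' y - u' y) hab
    (fun y hy => (hv y hy).sub (hu y hy)) (fun y hy => sub_nonneg.2 (h y hy))
  linarith

theorem eventually_right_gt_of_hasDerivAt {u : ℝ → ℝ} {c x : ℝ} (hu : HasDerivAt u c x)
    (hc : 0 < c) : ∀ᶠ z in 𝓝[>] x, u x < u z := by
  have h1 := (hasDerivAt_iff_tendsto_slope.1 hu).eventually (lt_mem_nhds hc)
  have h2 : ∀ᶠ z in 𝓝[>] x, 0 < slope u x z :=
    h1.filter_mono (nhdsWithin_mono x fun z (hz : x < z) => ne_of_gt hz)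
  filter_upwards [h2, self_mem_nhdsWithin] with z hz hxz
  have hxz : x < z := hxz
  rw [slope_def_field, lt_div_iff₀ (by linarith)] at hz
  linarith

theorem eventually_left_lt_of_hasDerivAt {u : ℝ → ℝ} {c x : ℝ} (hu : HasDerivAt u c x)
    (hc : 0 < c) : ∀ᶠ z in 𝓝[<] x, u z < u x := by
  have h1 := (hasDerivAt_iff_tendsto_slope.1 hu).eventually (lt_mem_nhds hc)
  have h2 : ∀ᶠ z in 𝓝[<] x, 0 < slope u x z :=
    h1.filter_mono (nhdsWithin_mono x fun z (hz : z < x) => ne_of_lt hz)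
  filter_upwards [h2, self_mem_nhdsWithin] with z hz hxz
  have hxz : z < x := hxz
  rw [slope_comm, slope_def_field, lt_div_iff₀ (by linarith)] at hz
  linarith

/-- Continuous induction: it turns strict inequalities between derivatives into barriers for a
system. -/
theorem forall_mem_Icc_of_eventually_right {s : Set ℝ} (hs : IsClosed s) {a b : ℝ} (ha : a ∈ s)
    (h : ∀ x ∈ s, x ∈ Ico a b → ∀ᶠ z in 𝓝[>] x, z ∈ s) : ∀ x ∈ Icc a b, x ∈ s := by
  refine IsClosed.Icc_subset_of_forall_exists_gt (hs.inter isClosed_Icc) ha ?_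
  rintro x ⟨hx, hxI⟩ y hy
  obtain ⟨z, hz, hz'⟩ := ((h x hx hxI).and (Ioc_mem_nhdsGT hy)).exists
  exact ⟨z, hz, hz'⟩

/-! ### Invariant octants and the shooting argument -/

/-- Solutions of a cooperative cyclic system never leave the positive octant. -/
theorem cyclic_pos_of_pos {r w F G : ℝ → ℝ} (hr : ∀ y, 0 < r y)
    (hw : ∀ y, HasDerivAt w (r y * F y) y) (hF : ∀ y, HasDerivAt F (G y) y)
    (hG : ∀ y, HasDerivAt G (y * w y) y) {y₀ : ℝ} (hy₀ : 0 < y₀)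
    (h : 0 < w y₀ ∧ 0 < F y₀ ∧ 0 < G y₀) {y : ℝ} (hy : y₀ ≤ y) :
    0 < w y ∧ 0 < F y ∧ 0 < G y := by
  have wc : Continuous w := continuous_iff_continuousAt.2 fun y => (hw y).continuousAt
  have Fc : Continuous F := continuous_iff_continuousAt.2 fun y => (hF y).continuousAt
  have Gc : Continuous G := continuous_iff_continuousAt.2 fun y => (hG y).continuousAt
  have := forall_mem_Icc_of_eventually_right (a := y₀) (b := y)
    (s := {z | w y₀ ≤ w z ∧ F y₀ ≤ F z ∧ G y₀ ≤ G z})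
    ((isClosed_le continuous_const wc).inter ((isClosed_le continuous_const Fc).inter
      (isClosed_le continuous_const Gc))) ⟨le_rfl, le_rfl, le_rfl⟩ ?_ y ⟨hy, le_rfl⟩
  · exact ⟨h.1.trans_le this.1, h.2.1.trans_le this.2.1, h.2.2.trans_le this.2.2⟩
  · rintro x ⟨h1, h2, h3⟩ hx
    filter_upwards [eventually_right_gt_of_hasDerivAt (hw x)
      (mul_pos (hr x) (h.2.1.trans_le h2)),
      eventually_right_gt_of_hasDerivAt (hF x) (h.2.2.trans_le h3),
      eventually_right_gt_of_hasDerivAt (hG x)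
        (mul_pos (hy₀.trans_le hx.1) (h.1.trans_le h1))] with z e1 e2 e3
    exact ⟨h1.trans e1.le, h2.trans e2.le, h3.trans e3.le⟩

/-- Solutions of a cooperative cyclic system never leave the negative octant. -/
theorem cyclic_neg_of_neg {r w F G : ℝ → ℝ} (hr : ∀ y, 0 < r y)
    (hw : ∀ y, HasDerivAt w (r y * F y) y) (hF : ∀ y, HasDerivAt F (G y) y)
    (hG : ∀ y, HasDerivAt G (y * w y) y) {y₀ : ℝ} (hy₀ : 0 < y₀)
    (h : w y₀ < 0 ∧ F y₀ < 0 ∧ G y₀ < 0) {y : ℝ} (hy : y₀ ≤ y) :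
    w y < 0 ∧ F y < 0 ∧ G y < 0 := by
  have := cyclic_pos_of_pos (w := fun y => -w y) (F := fun y => -F y) (G := fun y => -G y) hr
    (fun y => (hw y).neg.congr_deriv (by ring)) (fun y => (hF y).neg)
    (fun y => (hG y).neg.congr_deriv (by ring)) hy₀ (by simpa using h) hy
  simpa using this

namespace IsTrajectory

variable {m p : ℝ} {f f₁ w F : ℝ → ℝ}

theorem hG (T : IsTrajectory m p f f₁ w F) (y : ℝ) :
    HasDerivAt (fun y => y * f₁ y - f y) (y * w y) y :=
  (((hasDerivAt_id y).mul (T.hf₁ y)).sub (T.hf y)).congr_deriv (by simp)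

theorem continuous_f (T : IsTrajectory m p f f₁ w F) : Continuous f :=
  continuous_iff_continuousAt.2 fun y => (T.hf y).continuousAt

theorem continuous_f₁ (T : IsTrajectory m p f f₁ w F) : Continuous f₁ :=
  continuous_iff_continuousAt.2 fun y => (T.hf₁ y).continuousAt

theorem continuous_w (T : IsTrajectory m p f f₁ w F) : Continuous w :=
  continuous_iff_continuousAt.2 fun y => (T.hw y).continuousAt

theorem continuous_F (T : IsTrajectory m p f f₁ w F) : Continuous F :=
  continuous_iff_continuousAt.2 fun y => (T.hF y).continuousAt

theorem continuous_G (T : IsTrajectory m p f f₁ w F) : Continuous fun y => y * f₁ y - f y :=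
  continuous_iff_continuousAt.2 fun y => (T.hG y).continuousAt

/-- Near the origin `F` is negative to the right. -/
theorem exists_neg_near_zero (T : IsTrajectory m p f f₁ w F) :
    ∃ ε > 0, ∀ y ∈ Ioc 0 ε, F y < 0 ∧ y * f₁ y - f y < 0 := by
  have hev : ∀ᶠ y in 𝓝 (0 : ℝ), y * f₁ y - f y < 0 :=
    T.continuous_G.continuousAt.eventually_lt continuousAt_const
      (by simp [T.f_zero])
  obtain ⟨ε, hε, hb⟩ := Metric.eventually_nhds_iff.1 hev
  have hneg : ∀ y ∈ Icc (0 : ℝ) (ε / 2), y * f₁ y - f y < 0 := fun y hy =>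
    hb (by rw [Real.dist_eq, sub_zero, abs_of_nonneg hy.1]; linarith [hy.2])
  refine ⟨ε / 2, by positivity, fun y hy => ⟨?_, hneg y ⟨hy.1.le, hy.2⟩⟩⟩
  have := lt_of_hasDerivAt_pos (u := fun y => -F y) hy.1 (fun z _ => (T.hF z).neg)
    (fun z hz => by have := hneg z ⟨hz.1.le, hz.2.le.trans hy.2⟩; linarith)
  simp only [T.F_zero] at this
  linarith

/-- F is negative just after the origin, so w decreases strictly from a value that is already
nonpositive. -/
theorem exists_neg_of_nonpos (T : IsTrajectory m p f f₁ w F) (hp : p ≤ 0) :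
    ∃ y > 0, w y < 0 ∧ F y < 0 ∧ y * f₁ y - f y < 0 := by
  obtain ⟨ε, hε, h⟩ := T.exists_neg_near_zero
  refine ⟨ε, hε, ?_, h ε ⟨hε, le_rfl⟩⟩
  have := lt_of_hasDerivAt_pos (u := fun y => -w y) hε (fun z _ => (T.hw z).neg)
    (fun z hz => by
      have := mul_neg_of_pos_of_neg (cutMobility_pos m (f z)) (h z ⟨hz.1, hz.2.le⟩).1
      linarith)
  simp only [T.w_zero] at this
  linarith

/-- The crude barriers w ≥ 13 - 2y, F ≥ -2y, G ≥ -1 - y sustain each other on [0,1], since the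
mobility is at most 1. They give w ≥ 11 there; two integrations then yield G ≥ -1 + 11y²/2 and F ≥
-y + 11y³/6, both positive at y = 1. -/
theorem pos_of_large (hm : 0 < m) (T : IsTrajectory m 13 f f₁ w F) :
    0 < w 1 ∧ 0 < F 1 ∧ 0 < 1 * f₁ 1 - f 1 := by
  have hw : ∀ y ∈ Icc (0 : ℝ) 1, 0 ≤ w y + 2 * y - 13 ∧ 0 ≤ F y + 2 * y ∧
      0 ≤ y * f₁ y - f y + 1 + y := by
    have wc := T.continuous_w
    have Fc := T.continuous_F
    have Gc := T.continuous_G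
    have c1 : Continuous fun y => w y + 2 * y - 13 := by fun_prop
    have c2 : Continuous fun y => F y + 2 * y := by fun_prop
    have c3 : Continuous fun y => y * f₁ y - f y + 1 + y := by fun_prop
    refine forall_mem_Icc_of_eventually_right
      (s := {y | 0 ≤ w y + 2 * y - 13 ∧ 0 ≤ F y + 2 * y ∧ 0 ≤ y * f₁ y - f y + 1 + y})
      ((isClosed_le continuous_const c1).inter
        ((isClosed_le continuous_const c2).inter (isClosed_le continuous_const c3))) ?_ ?_
    · refine ⟨?_, ?_, ?_⟩ <;> simp [T.w_zero, T.F_zero, T.f_zero]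
    · rintro x ⟨h1, h2, h3⟩ hx
      have d1 : HasDerivAt (fun y => w y + 2 * y - 13) (cutMobility m (f x) * F x + 2) x :=
        (((T.hw x).add ((hasDerivAt_id x).const_mul 2)).sub_const 13).congr_deriv (by simp)
      have d2 : HasDerivAt (fun y => F y + 2 * y) (x * f₁ x - f x + 2) x :=
        ((T.hF x).add ((hasDerivAt_id x).const_mul 2)).congr_deriv (by simp)
      have d3 : HasDerivAt (fun y => y * f₁ y - f y + 1 + y) (x * w x + 1) x :=
        (((T.hG x).add_const 1).add (hasDerivAt_id x)).congr_deriv (by simp)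
      have hx0 := hx.1
      have hx1 := hx.2
      have p1 : 0 < cutMobility m (f x) * F x + 2 := by
        have := cutMobility_pos m (f x)
        have := cutMobility_le_one hm (f x)
        nlinarith
      have p3 : 0 < x * w x + 1 := by nlinarith
      filter_upwards [eventually_right_gt_of_hasDerivAt d1 p1,
        eventually_right_gt_of_hasDerivAt d2 (by linarith),
        eventually_right_gt_of_hasDerivAt d3 p3] with z e1 e2 e3
      exact ⟨h1.trans e1.le, h2.trans e2.le, h3.trans e3.le⟩
  have hw11 : ∀ y ∈ Icc (0 : ℝ) 1, 11 ≤ w y := fun y hy => by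
    have := (hw y hy).1
    linarith [hy.2]
  have hGl : ∀ y ∈ Icc (0 : ℝ) 1, -1 + 11 / 2 * y ^ 2 ≤ y * f₁ y - f y := by
    intro y hy
    have := sub_le_sub_of_hasDerivAt_le (u := fun y => 11 / 2 * y ^ 2) (u' := fun y => 11 * y)
      hy.1 (fun z _ => ((hasDerivAt_pow 2 z).const_mul (11 / 2 : ℝ)).congr_deriv
        (by norm_num; ring)) (fun z _ => T.hG z)
      (fun z hz => by nlinarith [hw11 z ⟨hz.1.le, hz.2.le.trans hy.2⟩, hz.1])
    simp only [T.f_zero, T.f₁_zero] at this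
    linarith
  have hFl := sub_le_sub_of_hasDerivAt_le (u := fun y => -y + 11 / 6 * y ^ 3)
    (u' := fun y => -1 + 11 / 2 * y ^ 2)
    (zero_le_one : (0 : ℝ) ≤ 1) (fun z _ => ((hasDerivAt_id z).neg.add
      ((hasDerivAt_pow 3 z).const_mul (11 / 6 : ℝ))).congr_deriv (by norm_num; ring))
      (fun z _ => T.hF z) (fun z hz => hGl z ⟨hz.1.le, hz.2.le⟩)
  have h1 := hw11 1 (by simp)
  have h2 := hGl 1 (by simp)
  simp only [T.F_zero] at hFl
  refine ⟨by linarith, by norm_num at hFl; linarith, by linarith⟩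

end IsTrajectory

/-- The trajectory enters neither the positive nor the negative octant. -/
def NonEscaping (f f₁ w F : ℝ → ℝ) : Prop :=
  ∀ y, 0 < y → ¬(0 < w y ∧ 0 < F y ∧ 0 < y * f₁ y - f y) ∧
    ¬(w y < 0 ∧ F y < 0 ∧ y * f₁ y - f y < 0)

/-- Otherwise the real line would be the union of two nonempty open sets of parameters, those
escaping into either octant, and a common point contradicts the invariance of the octants. -/
theorem exists_nonEscaping {m : ℝ} (hm : 0 < m) :
    ∃ p f f₁ w F, 0 < p ∧ IsTrajectory m p f f₁ w F ∧ NonEscaping f f₁ w F := by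
  obtain ⟨f, f₁, w, F, hT, hc⟩ := exists_trajectories hm 13
  -- Composing with the clamp extends the parameter interval [-13, 13] to all of ℝ, so that
  -- connectedness of ℝ applies directly.
  have hcl : Continuous (clamp 13) := by unfold clamp; fun_prop
  have hmem : ∀ p, clamp 13 p ∈ Icc (-13 : ℝ) 13 := fun p => abs_le.1 (abs_clamp_le (by norm_num) p)
  have hT' : ∀ p, IsTrajectory m (clamp 13 p) (f (clamp 13 p)) (f₁ (clamp 13 p)) (w (clamp 13 p))
      (F (clamp 13 p)) := fun p => hT _ (abs_clamp_le (by norm_num) p)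
  by_contra! hno
  set A : Set ℝ := {p | ∃ y > 0, w (clamp 13 p) y < 0 ∧ F (clamp 13 p) y < 0 ∧
    y * f₁ (clamp 13 p) y - f (clamp 13 p) y < 0} with hA
  set B : Set ℝ := {p | ∃ y > 0, 0 < w (clamp 13 p) y ∧ 0 < F (clamp 13 p) y ∧
    0 < y * f₁ (clamp 13 p) y - f (clamp 13 p) y} with hB
  have cw : ∀ y, 0 ≤ y → Continuous fun p => w (clamp 13 p) y := fun y hy =>
    (hc y hy).2.2.1.comp_continuous hcl hmem
  have cF : ∀ y, 0 ≤ y → Continuous fun p => F (clamp 13 p) y := fun y hy =>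
    (hc y hy).2.2.2.comp_continuous hcl hmem
  have cf : ∀ y, 0 ≤ y → Continuous fun p => f (clamp 13 p) y := fun y hy =>
    (hc y hy).1.comp_continuous hcl hmem
  have cf₁ : ∀ y, 0 ≤ y → Continuous fun p => f₁ (clamp 13 p) y := fun y hy =>
    (hc y hy).2.1.comp_continuous hcl hmem
  have cG : ∀ y, 0 ≤ y → Continuous fun p => y * f₁ (clamp 13 p) y - f (clamp 13 p) y :=
    fun y hy => (continuous_const.mul (cf₁ y hy)).sub (cf y hy)
  have hAo : IsOpen A := by
    refine isOpen_iff_mem_nhds.2 fun p ⟨y, hy, h1, h2, h3⟩ => ?_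
    filter_upwards [(cw y hy.le).continuousAt.eventually_lt continuousAt_const h1,
      (cF y hy.le).continuousAt.eventually_lt continuousAt_const h2,
      (cG y hy.le).continuousAt.eventually_lt continuousAt_const h3] with q e1 e2 e3
    exact ⟨y, hy, e1, e2, e3⟩
  have hBo : IsOpen B := by
    refine isOpen_iff_mem_nhds.2 fun p ⟨y, hy, h1, h2, h3⟩ => ?_
    filter_upwards [continuousAt_const.eventually_lt (cw y hy.le).continuousAt h1,
      continuousAt_const.eventually_lt (cF y hy.le).continuousAt h2,
      continuousAt_const.eventually_lt (cG y hy.le).continuousAt h3] with q e1 e2 e3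
    exact ⟨y, hy, e1, e2, e3⟩
  have hAn : ∀ p, clamp 13 p ≤ 0 → p ∈ A := fun p hp => (hT' p).exists_neg_of_nonpos hp
  have hcov : (univ : Set ℝ) ⊆ A ∪ B := by
    intro p _
    by_contra hp
    have hp' : 0 < clamp 13 p := by
      by_contra h
      exact hp (Or.inl (hAn p (not_lt.1 h)))
    refine hno _ _ _ _ _ hp' (hT' p) fun y hy => ⟨fun h => hp (Or.inr ⟨y, hy, h⟩),
      fun h => hp (Or.inl ⟨y, hy, h⟩)⟩
  have h0 : (0 : ℝ) ∈ A := hAn 0 (clamp_zero (by norm_num)).le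
  have h13 : (13 : ℝ) ∈ B := by
    have hc13 : clamp 13 13 = (13 : ℝ) := clamp_of_abs_le (by norm_num)
    refine ⟨1, one_pos, ?_⟩
    have h := hT' 13
    rw [hc13] at h ⊢
    exact h.pos_of_large hm
  obtain ⟨p, _, ⟨y₁, hy₁, h₁⟩, ⟨y₂, hy₂, h₂⟩⟩ := isPreconnected_univ A B hAo hBo hcov
    ⟨0, trivial, h0⟩ ⟨13, trivial, h13⟩
  have hr : ∀ y, 0 < cutMobility m (f (clamp 13 p) y) := fun y => cutMobility_pos _ _
  have Tp := hT' p
  have a1 := cyclic_neg_of_neg hr Tp.hw Tp.hF Tp.hG hy₁ h₁ (le_max_left y₁ y₂)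
  have a2 := cyclic_pos_of_pos hr Tp.hw Tp.hF Tp.hG hy₂ h₂ (le_max_right y₁ y₂)
  exact lt_asymm a1.1 a2.1

end

end ThinFilm

namespace ThinFilm

noncomputable section

/-! ### The Lyapunov function -/

/-- A quantity that increases along trajectories. -/
def lyap (f f₁ w F : ℝ → ℝ) (y : ℝ) : ℝ := w y * F y - (y * f₁ y - f y) ^ 2 / (2 * y)

theorem ne_zero_pos_of_pos {u : ℝ → ℝ} (hu : Continuous u) {a b : ℝ} (hab : a ≤ b)
    (h : ∀ y ∈ Icc a b, u y ≠ 0) (ha : 0 < u a) : 0 < u b := by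
  by_contra hb
  obtain ⟨c, hc, hc0⟩ := intermediate_value_Icc' hab hu.continuousOn
    (show (0 : ℝ) ∈ Icc (u b) (u a) from ⟨not_lt.1 hb, ha.le⟩)
  exact h c hc hc0

/-- Since w F never vanishes, w and F stay positive. Then w increases, so G' = y w is bounded below
by a positive constant and G becomes positive in finite time. -/
theorem cyclic_exists_pos {r w F G : ℝ → ℝ} (hr : ∀ y, 0 < r y)
    (hw : ∀ y, HasDerivAt w (r y * F y) y) (hG : ∀ y, HasDerivAt G (y * w y) y) {y₀ : ℝ}
    (hy₀ : 0 < y₀) (h : ∀ y, y₀ ≤ y → 0 < w y * F y) (h0 : 0 < w y₀) :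
    ∃ y > 0, 0 < w y ∧ 0 < F y ∧ 0 < G y := by
  have wc : Continuous w := continuous_iff_continuousAt.2 fun y => (hw y).continuousAt
  have hwpos : ∀ y, y₀ ≤ y → 0 < w y := fun y hy =>
    ne_zero_pos_of_pos wc hy (fun z hz => left_ne_zero_of_mul (h z hz.1).ne') h0
  have hFpos : ∀ y, y₀ ≤ y → 0 < F y := fun y hy => pos_of_mul_pos_right (h y hy) (hwpos y hy).le
  have hwmono : ∀ y, y₀ ≤ y → w y₀ ≤ w y := fun y hy =>
    le_of_hasDerivAt_nonneg hy (fun z _ => hw z)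
      (fun z hz => (mul_pos (hr z) (hFpos z hz.1.le)).le)
  have hGl : ∀ y, y₀ ≤ y → y₀ * w y₀ * y - y₀ * w y₀ * y₀ ≤ G y - G y₀ := fun y hy =>
    sub_le_sub_of_hasDerivAt_le (u := fun y => y₀ * w y₀ * y) (u' := fun _ => y₀ * w y₀) hy
      (fun z _ => by simpa using (hasDerivAt_id z).const_mul (y₀ * w y₀)) (fun z _ => hG z)
      (fun z hz => mul_le_mul hz.1.le (hwmono z hz.1.le) h0.le (hy₀.trans hz.1).le)
  -- A positive lower bound for G' from y₀ on; the point chosen next is where the resulting linear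
  -- growth has added |G(y₀)| + 1.
  have hc : 0 < y₀ * w y₀ := mul_pos hy₀ h0
  set y := y₀ + (|G y₀| + 1) / (y₀ * w y₀) with hy
  have hyy : y₀ ≤ y := by rw [hy]; linarith [show 0 ≤ (|G y₀| + 1) / (y₀ * w y₀) by positivity]
  refine ⟨y, hy₀.trans_le hyy, hwpos y hyy, hFpos y hyy, ?_⟩
  have h1 := hGl y hyy
  have h2 : y₀ * w y₀ * y - y₀ * w y₀ * y₀ = |G y₀| + 1 := by
    rw [hy]
    field_simp
    ring
  rw [h2] at h1
  linarith [neg_abs_le (G y₀)]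

namespace IsTrajectory

variable {m p : ℝ} {f f₁ w F : ℝ → ℝ}

/-- With G = y f₁ - f, the term w G from (w F)' cancels against the one from (G²/(2y))', because G'
= y w. Only squares remain. -/
theorem hasDerivAt_lyap (T : IsTrajectory m p f f₁ w F) {y : ℝ} (hy : 0 < y) :
    HasDerivAt (lyap f f₁ w F)
      (cutMobility m (f y) * F y ^ 2 + (y * f₁ y - f y) ^ 2 / (2 * y ^ 2)) y := by
  have h1 := (T.hw y).mul (T.hF y)
  have h2 := ((T.hG y).pow 2).div ((hasDerivAt_id y).const_mul 2)
    (by simpa using hy.ne')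
  refine (h1.sub h2).congr_deriv ?_
  simp only [id, Nat.cast_ofNat, Pi.pow_apply]
  field_simp
  ring

theorem lyap_mono (T : IsTrajectory m p f f₁ w F) {a b : ℝ} (ha : 0 < a) (hab : a ≤ b) :
    lyap f f₁ w F a ≤ lyap f f₁ w F b := by
  refine le_of_hasDerivAt_nonneg hab (fun y hy => T.hasDerivAt_lyap (ha.trans_le hy.1))
    fun y hy => ?_
  have := cutMobility_pos m (f y)
  positivity

/-- A positive value persists by monotonicity and forces w F > 0 from then on. Then w and F share a
sign, and G is driven to the same sign: the trajectory would escape. -/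
theorem lyap_nonpos (T : IsTrajectory m p f f₁ w F) (hN : NonEscaping f f₁ w F) {y : ℝ}
    (hy : 0 < y) : lyap f f₁ w F y ≤ 0 := by
  by_contra hpos
  have hpos := not_le.1 hpos
  have hwF : ∀ z, y ≤ z → 0 < w z * F z := by
    intro z hz
    have h1 := hpos.trans_le (T.lyap_mono hy hz)
    have hz0 := hy.trans_le hz
    have h2 : 0 ≤ (z * f₁ z - f z) ^ 2 / (2 * z) := by positivity
    unfold lyap at h1
    linarith
  have hr : ∀ z, 0 < cutMobility m (f z) := fun z => cutMobility_pos _ _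
  rcases lt_or_gt_of_ne (left_ne_zero_of_mul (hwF y le_rfl).ne') with h0 | h0
  · obtain ⟨z, hz, h1, h2, h3⟩ := cyclic_exists_pos (w := fun y => -w y) (F := fun y => -F y)
      (G := fun y => -(y * f₁ y - f y)) hr
      (fun y => (T.hw y).neg.congr_deriv (by ring))
      (fun y => (T.hG y).neg.congr_deriv (by ring)) hy
      (fun z hz => by have := hwF z hz; linarith) (by linarith)
    exact (hN z hz).2 ⟨by linarith, by linarith, by linarith⟩
  · obtain ⟨z, hz, h⟩ := cyclic_exists_pos hr T.hw T.hG hy hwF h0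
    exact (hN z hz).1 h

theorem hasDerivAt_quot (T : IsTrajectory m p f f₁ w F) {y : ℝ} (hy : 0 < y) :
    HasDerivAt (fun y => f y / y) ((y * f₁ y - f y) / y ^ 2) y := by
  refine ((T.hf y).div (hasDerivAt_id y) hy.ne').congr_deriv ?_
  simp only [id]
  ring

/-- Young's inequality |G|/y² ≤ l G²/(2y²) + 1/(2 l y²) with a free weight `l`. The first term is
dominated by the derivative of `l` times the Lyapunov function, whose final value is at most 0. -/
theorem abs_quot_sub_le (T : IsTrajectory m p f f₁ w F) (hN : NonEscaping f f₁ w F) {X Y l : ℝ}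
    (hX : 0 < X) (hXY : X ≤ Y) (hl : 0 < l) :
    |f Y / Y - f X / X| ≤ l * -lyap f f₁ w F X + (1 / X - 1 / Y) / (2 * l) := by
  have hd : ∀ y ∈ Icc X Y, HasDerivAt (fun y => l * lyap f f₁ w F y - 1 / (2 * l) * y⁻¹)
      (l * (cutMobility m (f y) * F y ^ 2 + (y * f₁ y - f y) ^ 2 / (2 * y ^ 2))
        + 1 / (2 * l) * (y ^ 2)⁻¹) y := by
    intro y hy
    have hy0 := hX.trans_le hy.1
    refine (((T.hasDerivAt_lyap hy0).const_mul l).sub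
      ((hasDerivAt_inv hy0.ne').const_mul (1 / (2 * l)))).congr_deriv ?_
    ring
  have key : ∀ y ∈ Ioo X Y, |(y * f₁ y - f y) / y ^ 2| ≤
      l * (cutMobility m (f y) * F y ^ 2 + (y * f₁ y - f y) ^ 2 / (2 * y ^ 2))
        + 1 / (2 * l) * (y ^ 2)⁻¹ := by
    intro y hy
    have hy0 := hX.trans hy.1
    have h1 := cutMobility_pos m (f y)
    have h2 : 0 ≤ l * (cutMobility m (f y) * F y ^ 2) := by positivity
    set g := y * f₁ y - f y
    rw [abs_div, abs_of_pos (show 0 < y ^ 2 by positivity)]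
    have h3 : l * (g ^ 2 / (2 * y ^ 2)) + 1 / (2 * l) * (y ^ 2)⁻¹ - |g| / y ^ 2
        = (l * |g| - 1) ^ 2 / (2 * l * y ^ 2) := by
      rw [← sq_abs g]
      field_simp
      ring
    have h4 : 0 ≤ (l * |g| - 1) ^ 2 / (2 * l * y ^ 2) := by positivity
    linarith
  have hq : ∀ y ∈ Icc X Y, HasDerivAt (fun y => f y / y) ((y * f₁ y - f y) / y ^ 2) y :=
    fun y hy => T.hasDerivAt_quot (hX.trans_le hy.1)
  have u1 := sub_le_sub_of_hasDerivAt_le hXY hq hd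
    (fun y hy => (le_abs_self _).trans (key y hy))
  have u2 := sub_le_sub_of_hasDerivAt_le hXY (fun y hy => (hq y hy).neg) hd
    (fun y hy => (neg_le_abs _).trans (key y hy))
  have h0 := mul_nonpos_of_nonneg_of_nonpos hl.le (T.lyap_nonpos hN (hX.trans_le hXY))
  have e : 1 / (2 * l) * X⁻¹ - 1 / (2 * l) * Y⁻¹ = (1 / X - 1 / Y) / (2 * l) := by
    have := hX.trans_le hXY
    field_simp
  simp only [Pi.neg_apply] at u2
  rw [abs_le]
  constructor <;> linarith

/-! ### The first convex phase -/

/-- While w ≥ 0 ≥ F each quantity is nondecreasing. The chain is: f₁ - y w has derivative -y w' ≥ 0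
and is itself the derivative of 2f - y f₁; likewise 2 + 2G - y² w has derivative -y² w' ≥ 0 and is
the derivative of 3F + y (2 - G). -/
theorem phase_estimates (T : IsTrajectory m p f f₁ w F) {t : ℝ}
    (h : ∀ y ∈ Icc 0 t, 0 ≤ w y ∧ F y ≤ 0) {y : ℝ} (hy : y ∈ Icc 0 t) :
    0 ≤ f₁ y ∧ 1 ≤ f y ∧ 2 ≤ 2 * f y - y * f₁ y ∧ -1 ≤ y * f₁ y - f y ∧
      0 ≤ 3 * F y + y * (2 - (y * f₁ y - f y)) := by
  have sub : ∀ y ∈ Icc 0 t, ∀ z ∈ Ioo 0 y, z ∈ Icc 0 t := fun y hy z hz =>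
    ⟨hz.1.le, hz.2.le.trans hy.2⟩
  have a1 : ∀ y ∈ Icc 0 t, 0 ≤ f₁ y := fun y hy => by
    have := le_of_hasDerivAt_nonneg hy.1 (fun z _ => T.hf₁ z) (fun z hz => (h z (sub y hy z hz)).1)
    rwa [T.f₁_zero] at this
  have a2 : 1 ≤ f y := by
    have := le_of_hasDerivAt_nonneg hy.1 (fun z _ => T.hf z) (fun z hz => a1 z (sub y hy z hz))
    rwa [T.f_zero] at this
  have a3 : ∀ y ∈ Icc 0 t, 0 ≤ f₁ y - y * w y := fun y hy => by
    have := le_of_hasDerivAt_nonneg (u := fun y => f₁ y - y * w y)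
      (u' := fun y => -(y * (cutMobility m (f y) * F y))) hy.1
      (fun z _ => ((T.hf₁ z).sub ((hasDerivAt_id z).mul (T.hw z))).congr_deriv
        (by simp only [id]; ring))
      (fun z hz => neg_nonneg.2 (mul_nonpos_of_nonneg_of_nonpos hz.1.le
        (mul_nonpos_of_nonneg_of_nonpos (cutMobility_pos m _).le (h z (sub y hy z hz)).2)))
    simpa [T.f₁_zero] using this
  have a4 : 2 ≤ 2 * f y - y * f₁ y := by
    have := le_of_hasDerivAt_nonneg (u := fun y => 2 * f y - y * f₁ y)
      (u' := fun y => f₁ y - y * w y) hy.1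
      (fun z _ => (((T.hf z).const_mul 2).sub ((hasDerivAt_id z).mul (T.hf₁ z))).congr_deriv
        (by simp only [id]; ring)) (fun z hz => a3 z (sub y hy z hz))
    simpa [T.f_zero] using this
  have a5 : -1 ≤ y * f₁ y - f y := by
    have := le_of_hasDerivAt_nonneg hy.1 (fun z _ => T.hG z)
      (fun z hz => mul_nonneg hz.1.le (h z (sub y hy z hz)).1)
    simpa [T.f_zero] using this
  have a6 : ∀ y ∈ Icc 0 t, 0 ≤ 2 + 2 * (y * f₁ y - f y) - y ^ 2 * w y := fun y hy => by
    have := le_of_hasDerivAt_nonneg (u := fun y => 2 + 2 * (y * f₁ y - f y) - y ^ 2 * w y)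
      (u' := fun y => -(y ^ 2 * (cutMobility m (f y) * F y))) hy.1
      (fun z _ => ((((T.hG z).const_mul 2).const_add 2).sub
        ((hasDerivAt_pow 2 z).mul (T.hw z))).congr_deriv (by norm_num; ring))
      (fun z hz => neg_nonneg.2 (mul_nonpos_of_nonneg_of_nonpos (sq_nonneg z)
        (mul_nonpos_of_nonneg_of_nonpos (cutMobility_pos m _).le (h z (sub y hy z hz)).2)))
    simpa [T.f_zero] using this
  have a7 : 0 ≤ 3 * F y + y * (2 - (y * f₁ y - f y)) := by
    have := le_of_hasDerivAt_nonneg (u := fun y => 3 * F y + y * (2 - (y * f₁ y - f y)))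
      (u' := fun y => 2 + 2 * (y * f₁ y - f y) - y ^ 2 * w y) hy.1
      (fun z _ => (((T.hF z).const_mul 3).add
        ((hasDerivAt_id z).mul ((T.hG z).const_sub 2))).congr_deriv (by simp only [id]; ring))
      (fun z hz => a6 z (sub y hy z hz))
    simpa [T.F_zero] using this
  exact ⟨a1 y hy, a2, a4, a5, a7⟩

theorem phase_signs (T : IsTrajectory m p f f₁ w F) (hp : 0 < p) {t : ℝ}
    (h : ∀ y ∈ Ioo 0 t, w y * F y < 0) {y : ℝ} (hy : y ∈ Ioo 0 t) : 0 < w y ∧ F y < 0 := by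
  have hw : 0 < w y := by
    refine ne_zero_pos_of_pos T.continuous_w hy.1.le (fun z hz => ?_) (by rw [T.w_zero]; exact hp)
    rcases eq_or_lt_of_le hz.1 with h0 | h0
    · rw [← h0, T.w_zero]; exact hp.ne'
    · exact left_ne_zero_of_mul (h z ⟨h0, hz.2.trans_lt hy.2⟩).ne
  exact ⟨hw, by nlinarith [h y hy]⟩

/-- Either the solution stays convex with decreasing curvature, or the curvature vanishes at a first
time `t`, where the tangent passes below the origin. -/
theorem phase_dichotomy (T : IsTrajectory m p f f₁ w F) (hN : NonEscaping f f₁ w F) (hp : 0 < p) :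
    (∀ y, 0 < y → 0 < w y ∧ F y < 0) ∨
      ∃ t > 0, w t = 0 ∧ 0 ≤ t * f₁ t - f t ∧ ∀ y ∈ Icc 0 t, 0 ≤ w y ∧ F y ≤ 0 := by
  by_cases hS : ∀ y, 0 < y → w y * F y < 0
  · left
    intro y hy
    exact T.phase_signs hp (t := y + 1) (fun z hz => hS z hz.1) ⟨hy, by linarith⟩
  right
  push Not at hS
  obtain ⟨y₁, hy₁, hy₁'⟩ := hS
  obtain ⟨ε, hε, hεF⟩ := T.exists_neg_near_zero
  have hev : ∀ᶠ y in 𝓝 (0 : ℝ), 0 < w y :=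
    continuousAt_const.eventually_lt T.continuous_w.continuousAt (by rw [T.w_zero]; exact hp)
  obtain ⟨δ, hδ, hδw⟩ := Metric.eventually_nhds_iff.1 hev
  set η := min ε (δ / 2) with hη
  have hη0 : 0 < η := by positivity
  have hneg : ∀ y ∈ Ioc 0 η, w y * F y < 0 := fun y hy =>
    mul_neg_of_pos_of_neg (hδw (by
      rw [Real.dist_eq, sub_zero, abs_of_pos hy.1]
      linarith [hy.2.trans (min_le_right ε (δ / 2))]))
      (hεF y ⟨hy.1, hy.2.trans (min_le_left _ _)⟩).1
  -- Excluding (0, η), where w F < 0, keeps the infimum away from the zero of F at the origin. This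
  -- infimum is the end of the convex phase.
  set S : Set ℝ := {y | η ≤ y ∧ 0 ≤ w y * F y} with hSdef
  have hSc : IsClosed S := (isClosed_le continuous_const continuous_id).inter
    (isClosed_le continuous_const (T.continuous_w.mul T.continuous_F))
  have hSne : S.Nonempty := ⟨y₁, by
    by_contra h
    exact absurd (hneg y₁ ⟨hy₁, (not_le.1 h).le⟩) (not_lt.2 hy₁'), hy₁'⟩
  have hSb : BddBelow S := ⟨η, fun y hy => hy.1⟩
  set t := sInf S with ht
  have htS : t ∈ S := hSc.csInf_mem hSne hSb
  have ht0 : 0 < t := hη0.trans_le htS.1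
  have hlt : ∀ y ∈ Ioo 0 t, w y * F y < 0 := by
    intro y hy
    by_contra h
    have hyη : η ≤ y := by
      by_contra h'
      exact h (hneg y ⟨hy.1, (not_le.1 h').le⟩)
    exact absurd (csInf_le hSb (show y ∈ S from ⟨hyη, not_lt.1 h⟩)) (not_le.2 hy.2)
  have hsg : ∀ y ∈ Ioo 0 t, 0 < w y ∧ F y < 0 := fun y hy => T.phase_signs hp hlt hy
  have hmem : Ioo 0 t ∈ 𝓝[<] t := Ioo_mem_nhdsLT ht0
  have hwt : 0 ≤ w t := ge_of_tendsto (T.continuous_w.continuousAt.continuousWithinAt (s := Iio t))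
    (by filter_upwards [hmem] with y hy using (hsg y hy).1.le)
  have hFt : F t ≤ 0 := le_of_tendsto (T.continuous_F.continuousAt.continuousWithinAt (s := Iio t))
    (by filter_upwards [hmem] with y hy using (hsg y hy).2.le)
  have hwF : w t = 0 ∨ F t = 0 := mul_eq_zero.1
    (le_antisymm (mul_nonpos_of_nonneg_of_nonpos hwt hFt) htS.2)
  have hall : ∀ y ∈ Icc 0 t, 0 ≤ w y ∧ F y ≤ 0 := by
    intro y hy
    rcases eq_or_lt_of_le hy.1 with h0 | h0
    · rw [← h0, T.w_zero, T.F_zero]; exact ⟨hp.le, le_rfl⟩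
    rcases eq_or_lt_of_le hy.2 with h1 | h1
    · rw [h1]; exact ⟨hwt, hFt⟩
    · exact ⟨(hsg y ⟨h0, h1⟩).1.le, (hsg y ⟨h0, h1⟩).2.le⟩
  -- With G(t) < 0 the function F would decrease to 0 and be positive just before t.
  have hF0 : F t = 0 → 0 ≤ t * f₁ t - f t := by
    intro h0
    by_contra hneg
    have hd := eventually_left_lt_of_hasDerivAt (T.hF t).neg (neg_pos.2 (not_le.1 hneg))
    obtain ⟨z, hz1, hz2⟩ := (hd.and hmem).exists
    simp only [Pi.neg_apply] at hz1
    linarith [(hsg z hz2).2]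
  -- If G(t) < 0, then F(t) < 0 and w(t) = 0, so w' < 0 there and the negative octant is entered
  -- just after t.
  have hGt : 0 ≤ t * f₁ t - f t := by
    by_contra hneg
    have hFne : F t < 0 := lt_of_le_of_ne hFt fun h0 => hneg (hF0 h0)
    have hw0 : w t = 0 := hwF.resolve_right hFne.ne
    have hd := eventually_right_gt_of_hasDerivAt (T.hw t).neg
      (neg_pos.2 (mul_neg_of_pos_of_neg (cutMobility_pos m (f t)) hFne))
    have e1 : ∀ᶠ z in 𝓝[>] t, F z < 0 := nhdsWithin_le_nhds
      (T.continuous_F.continuousAt.eventually_lt continuousAt_const hFne)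
    have e2 : ∀ᶠ z in 𝓝[>] t, z * f₁ z - f z < 0 := nhdsWithin_le_nhds
      (T.continuous_G.continuousAt.eventually_lt continuousAt_const (not_le.1 hneg))
    obtain ⟨z, ⟨⟨hz1, hz2⟩, hz3⟩, hz4⟩ := (((hd.and e1).and e2).and self_mem_nhdsWithin).exists
    simp only [Pi.neg_apply] at hz1
    exact (hN z (ht0.trans hz4)).2 ⟨by linarith, hz2, hz3⟩
  refine ⟨t, ht0, ?_, hGt, hall⟩
  -- If w(t) > 0, then F(t) = 0. Moreover G(t) > 0: as G increases on [0,t], G(t) = 0 would make F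
  -- nonincreasing up to the value 0, against F < 0 before t. So the positive octant is entered just
  -- after t.
  by_contra hw0
  have hwpos : 0 < w t := lt_of_le_of_ne hwt (Ne.symm hw0)
  have hFz : F t = 0 := hwF.resolve_left hw0
  have hGpos : 0 < t * f₁ t - f t := by
    refine lt_of_le_of_ne hGt fun hG0 => ?_
    have hGle : ∀ y ∈ Icc 0 t, y * f₁ y - f y ≤ 0 := fun y hy => by
      have := le_of_hasDerivAt_nonneg hy.2 (fun z _ => T.hG z)
        (fun z hz => mul_nonneg (hy.1.trans hz.1.le) (hall z ⟨hy.1.trans hz.1.le, hz.2.le⟩).1)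
      linarith
    have := le_of_hasDerivAt_nonneg (u := fun y => -F y) (by linarith : t / 2 ≤ t)
      (fun z _ => (T.hF z).neg)
      (fun z hz => neg_nonneg.2 (hGle z ⟨by linarith [hz.1], hz.2.le⟩))
    linarith [(hsg (t / 2) ⟨by linarith, by linarith⟩).2]
  have hd := eventually_right_gt_of_hasDerivAt (T.hF t) hGpos
  have e1 : ∀ᶠ z in 𝓝[>] t, 0 < w z := nhdsWithin_le_nhds
    (continuousAt_const.eventually_lt T.continuous_w.continuousAt hwpos)
  have e2 : ∀ᶠ z in 𝓝[>] t, 0 < z * f₁ z - f z := nhdsWithin_le_nhds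
    (continuousAt_const.eventually_lt T.continuous_G.continuousAt hGpos)
  obtain ⟨z, ⟨⟨hz1, hz2⟩, hz3⟩, hz4⟩ := (((hd.and e1).and e2).and self_mem_nhdsWithin).exists
  exact (hN z (ht0.trans hz4)).1 ⟨hz2, by linarith, hz3⟩

/-- After the first convex phase, the slope `f / y` of the chord is controlled. -/
theorem abs_quot_sub_le_of_phase (T : IsTrajectory m p f f₁ w F) (hN : NonEscaping f f₁ w F)
    {t : ℝ} (ht : 0 < t) (hw : w t = 0) (hG : 0 ≤ t * f₁ t - f t) {Y : ℝ} (hY : t ≤ Y) :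
    |f Y / Y - f t / t| ≤ (t * f₁ t - f t) / t := by
  set g := t * f₁ t - f t with hg
  have hly : -lyap f f₁ w F t = g ^ 2 / (2 * t) := by
    unfold lyap
    rw [hw, ← hg]
    ring
  have hY0 : 0 < Y := ht.trans_le hY
  have hb : ∀ l, 0 < l → |f Y / Y - f t / t| ≤ l * (g ^ 2 / (2 * t)) + 1 / t / (2 * l) := by
    intro l hl
    have := T.abs_quot_sub_le hN ht hY hl
    rw [hly] at this
    refine this.trans ?_
    gcongr
    have : 0 < 1 / Y := by positivity
    linarith
  rcases eq_or_lt_of_le hG with h0 | h0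
  · rw [← h0] at hb ⊢
    simp only [zero_div]
    refine le_of_forall_pos_le_add fun ε hε => ?_
    -- For G(t) = 0 the first term vanishes, and this weight makes the second equal to ε.
    have := hb (1 / (2 * t * ε)) (by positivity)
    refine this.trans (le_of_eq ?_)
    field_simp
    ring
  -- The optimal weight: both terms become g/(2t).
  · refine (hb (1 / g) (by positivity)).trans (le_of_eq ?_)
    field_simp
    ring

/-- In an endless convex phase f₁ is nonnegative and increasing, which suffices. If the phase ends
at t, the chord slope stays above (f - G)/t = (2f - t f₁)/t ≥ 2/t, so f ≥ 2 from t on. In either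
case the cutoff of the mobility is never active. -/
theorem one_le_and_linear_bound (T : IsTrajectory m p f f₁ w F) (hN : NonEscaping f f₁ w F)
    (hp : 0 < p) : (∀ y, 1 ≤ f y) ∧ ∃ c > 0, ∀ y, 1 ≤ y → c * y ≤ f y := by
  have red : (∀ y, 0 ≤ y → 1 ≤ f y) → ∀ y, 1 ≤ f y := by
    intro h y
    rcases le_total 0 y with hy | hy
    · exact h y hy
    · rw [← T.f_even]; exact h _ (by linarith)
  rcases T.phase_dichotomy hN hp with h | ⟨t, ht, hw, hG, h⟩
  · have h' : ∀ t, ∀ y ∈ Icc 0 t, 0 ≤ w y ∧ F y ≤ 0 := by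
      intro t y hy
      rcases eq_or_lt_of_le hy.1 with h0 | h0
      · rw [← h0, T.w_zero, T.F_zero]; exact ⟨hp.le, le_rfl⟩
      · exact ⟨(h y h0).1.le, (h y h0).2.le⟩
    have hf1 : 0 < f₁ 1 := by
      have := lt_of_hasDerivAt_pos (zero_lt_one : (0 : ℝ) < 1) (fun z _ => T.hf₁ z)
        (fun z hz => (h z hz.1).1)
      rwa [T.f₁_zero] at this
    have hone : ∀ y, 0 ≤ y → 1 ≤ f y := fun y hy => (T.phase_estimates (h' y) ⟨hy, le_rfl⟩).2.1
    refine ⟨red hone, min 1 (f₁ 1), by positivity, fun y hy => ?_⟩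
    have hinc : ∀ z, 1 ≤ z → f₁ 1 ≤ f₁ z := fun z hz =>
      le_of_hasDerivAt_nonneg hz (fun z _ => T.hf₁ z)
        (fun z hz => (h z (by linarith [hz.1])).1.le)
    have := sub_le_sub_of_hasDerivAt_le (u := fun y => f₁ 1 * y) (u' := fun _ => f₁ 1) hy
      (fun z _ => by simpa using (hasDerivAt_id z).const_mul (f₁ 1)) (fun z _ => T.hf z)
      (fun z hz => hinc z hz.1.le)
    simp only [mul_one] at this
    have h1 := hone 1 zero_le_one
    have m1 := min_le_left 1 (f₁ 1)
    have m2 := min_le_right 1 (f₁ 1)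
    nlinarith
  · obtain ⟨_, h1, h2, h3, -⟩ := T.phase_estimates h (y := t) ⟨ht.le, le_rfl⟩
    have hlow : ∀ Y, t ≤ Y → 2 / t * Y ≤ f Y := by
      intro Y hY
      have hY0 : 0 < Y := ht.trans_le hY
      have := (abs_le.1 (T.abs_quot_sub_le_of_phase hN ht hw hG hY)).1
      have h4 : 2 / t ≤ f Y / Y := by
        have : 2 / t ≤ f t / t - (t * f₁ t - f t) / t := by
          rw [← sub_div]
          gcongr
          linarith
        linarith
      rwa [le_div_iff₀ hY0] at h4
    have hone : ∀ y, 0 ≤ y → 1 ≤ f y := by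
      intro y hy
      rcases le_total y t with hyt | hyt
      · exact (T.phase_estimates h ⟨hy, hyt⟩).2.1
      · have h5 := hlow y hyt
        have : 2 ≤ 2 / t * y := by
          rw [div_mul_eq_mul_div, le_div_iff₀ ht]
          linarith
        linarith
    refine ⟨red hone, min (2 / t) (1 / t), by positivity, fun y hy => ?_⟩
    rcases le_total y t with hyt | hyt
    · have h6 := hone y (by linarith)
      have : min (2 / t) (1 / t) * y ≤ 1 / t * y := by
        gcongr
        exact min_le_right _ _
      have h7 : 1 / t * y ≤ 1 := by
        rw [div_mul_eq_mul_div, div_le_one ht]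
        linarith
      linarith
    · have : min (2 / t) (1 / t) * y ≤ 2 / t * y := by
        gcongr
        exact min_le_left _ _
      linarith [hlow y hyt]

end IsTrajectory

end

end ThinFilm

namespace ThinFilm

noncomputable section

/-! ### Self-similar profiles -/

/-- Positive even solutions of `(f ^ m f_yyy)_y = b (y f_y - f)` that are asymptotic to `a |y|`, with
`f₁ = f_y`, `f₂ = f_yy`, `F = f ^ m f_yyy`. -/
structure IsProfile (m b a : ℝ) (f f₁ f₂ F : ℝ → ℝ) : Prop where
  pos : ∀ y, 0 < f y
  even : ∀ y, f (-y) = f y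
  hf : ∀ y, HasDerivAt f (f₁ y) y
  hf₁ : ∀ y, HasDerivAt f₁ (f₂ y) y
  hf₂ : ∀ y, HasDerivAt f₂ (f y ^ (-m) * F y) y
  hF : ∀ y, HasDerivAt F (b * (y * f₁ y - f y)) y
  slope : ∃ C, ∀ y, |f y - (a * |y|)| ≤ C * (1 + √|y|)
  energy : ∃ C, ∀ Y, 0 ≤ Y → ∫ y in (-Y)..Y, f₁ y ^ 2 ≤ C * (1 + Y)
  flux : ∃ C, ∀ y, |F y| ≤ C * (1 + |y| ^ (3 / 2 : ℝ))
  dissipation : Integrable fun y => f y ^ (-m) * F y ^ 2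

theorem integral_neg_self_of_even {u : ℝ → ℝ} (hc : Continuous u) (hu : ∀ y, u (-y) = u y) (y : ℝ) :
    ∫ s in (-y)..y, u s = 2 * ∫ s in (0 : ℝ)..y, u s := by
  rw [← intervalIntegral.integral_add_adjacent_intervals (hc.intervalIntegrable (-y) 0)
    (hc.intervalIntegrable 0 y), intervalIntegral.integral_symm, integral_zero_neg_of_even hu]
  ring

theorem exists_bound_on_Icc {u : ℝ → ℝ} (hu : Continuous u) (a b : ℝ) :
    ∃ C, 0 ≤ C ∧ ∀ y ∈ Icc a b, |u y| ≤ C := by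
  obtain ⟨C, hC⟩ := isCompact_Icc.exists_bound_of_continuousOn (s := Icc a b) hu.continuousOn
  exact ⟨max C 0, le_max_right _ _, fun y hy => (hC y hy).trans (le_max_left _ _)⟩

namespace IsTrajectory

variable {m p : ℝ} {f f₁ w F : ℝ → ℝ}

/-- The weight l = 1/√X in `abs_quot_sub_le` balances the two terms, giving a Cauchy estimate of
order X^(-1/2). The limit is positive by the linear lower bound. -/
theorem exists_quot_limit (T : IsTrajectory m p f f₁ w F) (hN : NonEscaping f f₁ w F)
    (hp : 0 < p) : ∃ a > 0, Tendsto (fun y => f y / y) atTop (𝓝 a) ∧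
      ∃ C, 0 ≤ C ∧ ∀ X, 1 ≤ X → |f X / X - a| ≤ C / √X := by
  set D := -lyap f f₁ w F 1 with hD
  have hD0 : 0 ≤ D := neg_nonneg.2 (T.lyap_nonpos hN one_pos)
  have hb : ∀ X Y, 1 ≤ X → X ≤ Y → |f Y / Y - f X / X| ≤ (D + 1 / 2) / √X := by
    intro X Y hX hXY
    have hX0 : 0 < X := by linarith
    have hs : 0 < √X := Real.sqrt_pos.2 hX0
    have := T.abs_quot_sub_le hN hX0 hXY (l := 1 / √X) (by positivity)
    refine this.trans ?_
    have h1 : -lyap f f₁ w F X ≤ D := neg_le_neg (T.lyap_mono one_pos hX)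
    have h2 : 1 / X - 1 / Y ≤ 1 / X := by
      have : 0 < 1 / Y := by have := hX0.trans_le hXY; positivity
      linarith
    calc 1 / √X * -lyap f f₁ w F X + (1 / X - 1 / Y) / (2 * (1 / √X))
        ≤ 1 / √X * D + (1 / X) / (2 * (1 / √X)) := by gcongr
      _ = (D + 1 / 2) / √X := by
        field_simp
        rw [Real.sq_sqrt hX0.le]
        field_simp
  have hC : CauchySeq fun y : ℝ => f (max 1 y) / max 1 y := by
    refine cauchySeq_of_le_tendsto_0' (fun y : ℝ => (D + 1 / 2) / √(max 1 y)) (fun n k hnk => ?_) ?_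
    · rw [dist_comm, Real.dist_eq]
      exact hb _ _ (le_max_left _ _) (max_le_max_left 1 hnk)
    · exact tendsto_const_nhds.div_atTop (Real.tendsto_sqrt_atTop.comp
        (tendsto_atTop_mono (fun y => le_max_right 1 y) tendsto_id))
  obtain ⟨a, ha⟩ := cauchySeq_tendsto_of_complete hC
  have ha' : Tendsto (fun y => f y / y) atTop (𝓝 a) := by
    refine ha.congr' ?_
    filter_upwards [eventually_ge_atTop 1] with y hy
    rw [max_eq_right hy]
  obtain ⟨c, hc, hlow⟩ := (T.one_le_and_linear_bound hN hp).2
  refine ⟨a, hc.trans_le (ge_of_tendsto ha' ?_), ha', D + 1 / 2, by positivity, fun X hX => ?_⟩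
  · filter_upwards [eventually_ge_atTop 1] with y hy
    rw [le_div_iff₀ (by linarith)]
    exact hlow y hy
  · rw [abs_sub_comm]
    refine le_of_tendsto ((ha'.sub_const (f X / X)).abs) ?_
    filter_upwards [eventually_ge_atTop X] with Y hY using hb X Y hX hY

/-- Since F' = G, integrate |G| ≤ l G²/(2y²) + y²/(2l). The first part is bounded by `l` times the
total dissipation and the second by Y³/(6l), so l = Y^(3/2) is optimal. -/
theorem exists_flux_bound (T : IsTrajectory m p f f₁ w F) (hN : NonEscaping f f₁ w F) :
    ∃ C, ∀ y, |F y| ≤ C * (1 + |y| ^ (3 / 2 : ℝ)) := by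
  set D := -lyap f f₁ w F 1 with hD
  have hD0 : 0 ≤ D := neg_nonneg.2 (T.lyap_nonpos hN one_pos)
  obtain ⟨B, hB0, hB⟩ := exists_bound_on_Icc T.continuous_F 0 1
  have hpos : ∀ y, 0 ≤ y → |F y| ≤ (B + D + 1) * (1 + y ^ (3 / 2 : ℝ)) := by
    intro Y hY
    have hpw : 0 ≤ Y ^ (3 / 2 : ℝ) := Real.rpow_nonneg hY _
    rcases le_total Y 1 with h1 | h1
    · have := hB Y ⟨hY, h1⟩
      nlinarith [mul_nonneg (show 0 ≤ B + D + 1 by positivity) hpw]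
    set l := Y ^ (3 / 2 : ℝ) with hl
    have hl0 : 0 < l := Real.rpow_pos_of_pos (by linarith) _
    have hll : l * l = Y ^ 3 := by
      rw [hl, ← Real.rpow_add (by linarith)]
      norm_num
    have hd : ∀ y ∈ Icc 1 Y, HasDerivAt (fun y => l * lyap f f₁ w F y + 1 / (6 * l) * y ^ 3)
        (l * (cutMobility m (f y) * F y ^ 2 + (y * f₁ y - f y) ^ 2 / (2 * y ^ 2))
          + 1 / (2 * l) * y ^ 2) y := by
      intro y hy
      have hy0 : 0 < y := by linarith [hy.1]
      refine (((T.hasDerivAt_lyap hy0).const_mul l).add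
        ((hasDerivAt_pow 3 y).const_mul (1 / (6 * l)))).congr_deriv ?_
      push_cast
      field_simp
      ring
    have key : ∀ y ∈ Ioo 1 Y, |y * f₁ y - f y| ≤
        l * (cutMobility m (f y) * F y ^ 2 + (y * f₁ y - f y) ^ 2 / (2 * y ^ 2))
          + 1 / (2 * l) * y ^ 2 := by
      intro y hy
      have hy0 : 0 < y := by linarith [hy.1]
      have h1 := cutMobility_pos m (f y)
      have h2 : 0 ≤ l * (cutMobility m (f y) * F y ^ 2) := by positivity
      set g := y * f₁ y - f y
      have h3 : l * (g ^ 2 / (2 * y ^ 2)) + 1 / (2 * l) * y ^ 2 - |g|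
          = (l * |g| - y ^ 2) ^ 2 / (2 * l * y ^ 2) := by
        rw [← sq_abs g]
        field_simp
        ring
      have h4 : 0 ≤ (l * |g| - y ^ 2) ^ 2 / (2 * l * y ^ 2) := by positivity
      linarith
    have u1 := sub_le_sub_of_hasDerivAt_le h1 (fun y _ => T.hF y) hd
      (fun y hy => (le_abs_self _).trans (key y hy))
    have u2 := sub_le_sub_of_hasDerivAt_le h1 (fun y _ => (T.hF y).neg) hd
      (fun y hy => (neg_le_abs _).trans (key y hy))
    have h0 := mul_nonpos_of_nonneg_of_nonpos hl0.le
      (T.lyap_nonpos hN (show 0 < Y by linarith))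
    have h5 : 1 / (6 * l) * Y ^ 3 = l / 6 := by
      rw [← hll]
      field_simp
    have h6 : 0 ≤ 1 / (6 * l) * 1 ^ 3 := by positivity
    have h7 : l * lyap f f₁ w F 1 = -(l * D) := by rw [hD]; ring
    have h8 := hB 1 (by simp)
    simp only [Pi.neg_apply] at u2
    have h9 := abs_le.1 h8
    rw [abs_le]
    constructor <;> nlinarith [mul_nonneg hB0 hl0.le]
  refine ⟨B + D + 1, fun y => ?_⟩
  rcases le_total 0 y with hy | hy
  · rw [abs_of_nonneg hy]; exact hpos y hy
  · have := hpos (-y) (by linarith)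
    rwa [T.F_odd, abs_neg, ← abs_of_nonpos hy] at this

/-- Write f₁ = f/y + G/y. The first term is bounded by convergence of the chord slope, and 2(G/y)²
is at most four times the derivative of the Lyapunov function. -/
theorem exists_energy_bound (T : IsTrajectory m p f f₁ w F) (hN : NonEscaping f f₁ w F)
    (hp : 0 < p) : ∃ C, ∀ Y, 0 ≤ Y → ∫ y in (-Y)..Y, f₁ y ^ 2 ≤ C * (1 + Y) := by
  set D := -lyap f f₁ w F 1 with hD
  have hD0 : 0 ≤ D := neg_nonneg.2 (T.lyap_nonpos hN one_pos)
  obtain ⟨a, ha, -, C, hC0, hC⟩ := T.exists_quot_limit hN hp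
  have hc2 : Continuous fun y => f₁ y ^ 2 := T.continuous_f₁.pow 2
  have hE := hasDerivAt_primitive hc2
  set E : ℝ → ℝ := fun Y => ∫ y in (0 : ℝ)..Y, f₁ y ^ 2 with hEdef
  have hmono : ∀ x y, x ≤ y → E x ≤ E y := fun x y hxy =>
    le_of_hasDerivAt_nonneg hxy (fun z _ => hE z) fun z _ => sq_nonneg _
  have hE0 : E 0 = 0 := by simp [hEdef]
  have hE1 : 0 ≤ E 1 := by rw [← hE0]; exact hmono 0 1 zero_le_one
  set B := a + C with hB
  have hB0 : 0 ≤ B := by positivity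
  have hbound : ∀ Y, 0 ≤ Y → E Y ≤ (E 1 + 2 * B ^ 2 + 4 * D) * (1 + Y) := by
    intro Y hY
    rcases le_total Y 1 with h1 | h1
    · have := hmono Y 1 h1
      nlinarith [mul_nonneg (show 0 ≤ E 1 + 2 * B ^ 2 + 4 * D by positivity) hY, sq_nonneg B]
    have u := sub_le_sub_of_hasDerivAt_le (v := fun y => 2 * B ^ 2 * y + 4 * lyap f f₁ w F y)
      (v' := fun y => 2 * B ^ 2 + 4 * (cutMobility m (f y) * F y ^ 2
        + (y * f₁ y - f y) ^ 2 / (2 * y ^ 2))) h1 (fun y _ => hE y)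
      (fun y hy => (((hasDerivAt_id y).const_mul (2 * B ^ 2)).add
        ((T.hasDerivAt_lyap (show 0 < y by linarith [hy.1])).const_mul 4)).congr_deriv (by simp))
      (fun y hy => by
        have hy0 : 0 < y := by linarith [hy.1]
        have hq := hC y hy.1.le
        have hq' : C / √y ≤ C := div_le_self hC0 (Real.one_le_sqrt.2 hy.1.le)
        have hqa : |f y / y| ≤ B := by
          have h3 := abs_le.1 (hq.trans hq')
          rw [abs_le]
          constructor <;> linarith
        have hq2 : (f y / y) ^ 2 ≤ B ^ 2 := by
          rw [← sq_abs]
          gcongr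
        have e : f₁ y = f y / y + (y * f₁ y - f y) / y := by
          field_simp
          ring
        have h4 : 0 ≤ cutMobility m (f y) * F y ^ 2 := by
          have := cutMobility_pos m (f y); positivity
        have e2 : (y * f₁ y - f y) ^ 2 / (2 * y ^ 2) = ((y * f₁ y - f y) / y) ^ 2 / 2 := by
          field_simp
        rw [e2]
        set g := (y * f₁ y - f y) / y
        rw [e]
        nlinarith [sq_nonneg (f y / y - g)])
    have h0 := T.lyap_nonpos hN (show 0 < Y by linarith)
    have hl1 : lyap f f₁ w F 1 = -D := by rw [hD]; ring
    nlinarith [mul_nonneg hE1 hY, mul_nonneg hD0 hY, sq_nonneg B]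
  refine ⟨2 * (E 1 + 2 * B ^ 2 + 4 * D), fun Y hY => ?_⟩
  rw [integral_neg_self_of_even hc2 (fun y => by rw [T.f₁_odd]; ring)]
  have := hbound Y hY
  simp only [hEdef] at this ⊢
  linarith

/-- The dissipation is part of the derivative of a function bounded above by 0, so on [1, ∞) its
integral is at most minus the value of that function at 1. -/
theorem integrable_dissipation (T : IsTrajectory m p f f₁ w F) (hN : NonEscaping f f₁ w F) :
    Integrable fun y => cutMobility m (f y) * F y ^ 2 := by
  set D := -lyap f f₁ w F 1 with hD
  have hD0 : 0 ≤ D := neg_nonneg.2 (T.lyap_nonpos hN one_pos)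
  have hc : Continuous fun y => cutMobility m (f y) * F y ^ 2 :=
    ((continuous_cutMobility m).comp T.continuous_f).mul (T.continuous_F.pow 2)
  have hE := hasDerivAt_primitive hc
  set E : ℝ → ℝ := fun Y => ∫ y in (0 : ℝ)..Y, cutMobility m (f y) * F y ^ 2 with hEdef
  refine integrable_of_intervalIntegral_norm_bounded (ι := ℝ) (l := atTop) (a := fun Y => -Y)
    (b := fun Y => Y) (2 * (E 1 + D)) (fun Y => hc.integrableOn_Ioc) tendsto_neg_atTop_atBot
    tendsto_id ?_
  filter_upwards [eventually_ge_atTop 1] with Y hY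
  have hn : ∀ y, ‖cutMobility m (f y) * F y ^ 2‖ = cutMobility m (f y) * F y ^ 2 := fun y => by
    have := cutMobility_pos m (f y)
    rw [Real.norm_eq_abs, abs_of_nonneg (by positivity)]
  simp only [hn]
  rw [integral_neg_self_of_even hc (fun y => by rw [T.f_even, T.F_odd]; ring)]
  have u := sub_le_sub_of_hasDerivAt_le hY (fun y _ => hE y)
    (fun y hy => T.hasDerivAt_lyap (show 0 < y by linarith [hy.1]))
    (fun y _ => by
      have : 0 ≤ (y * f₁ y - f y) ^ 2 / (2 * y ^ 2) := by positivity
      linarith)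
  have h0 := T.lyap_nonpos hN (show 0 < Y by linarith)
  simp only [hEdef] at u ⊢
  linarith

theorem isProfile (T : IsTrajectory m p f f₁ w F) (hN : NonEscaping f f₁ w F) (hp : 0 < p) {a : ℝ}
    (ha : ∃ C, 0 ≤ C ∧ ∀ X, 1 ≤ X → |f X / X - a| ≤ C / √X) :
    IsProfile m 1 a f f₁ w F := by
  have hone := (T.one_le_and_linear_bound hN hp).1
  refine ⟨fun y => zero_lt_one.trans_le (hone y), T.f_even, T.hf, T.hf₁, fun y => ?_, fun y => ?_,
    ?_, T.exists_energy_bound hN hp, T.exists_flux_bound hN, ?_⟩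
  · rw [← cutMobility_of_one_le (hone y)]; exact T.hw y
  · simpa using T.hF y
  · obtain ⟨C, hC0, hC⟩ := ha
    obtain ⟨B, hB0, hB⟩ := exists_bound_on_Icc (u := fun y => f y - a * y)
      (T.continuous_f.sub (continuous_const.mul continuous_id)) 0 1
    have hpos : ∀ y, 0 ≤ y → |f y - a * y| ≤ (B + C) * (1 + √y) := by
      intro y hy
      have hs := Real.sqrt_nonneg y
      rcases le_total y 1 with h1 | h1
      · have : |f y - a * y| ≤ B := hB y ⟨hy, h1⟩
        nlinarith [mul_nonneg (add_nonneg hB0 hC0) hs]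
      · have hy0 : 0 < y := by linarith
        have hs0 : 0 < √y := Real.sqrt_pos.2 hy0
        have h2 := hC y h1
        have e : f y - a * y = y * (f y / y - a) := by field_simp
        have h3 : y * (C / √y) = C * √y := by
          rw [← mul_div_assoc, div_eq_iff hs0.ne', mul_assoc, Real.mul_self_sqrt hy]
          ring
        rw [e, abs_mul, abs_of_pos hy0]
        have := mul_le_mul_of_nonneg_left h2 hy
        nlinarith [mul_nonneg hB0 hs]
    refine ⟨B + C, fun y => ?_⟩
    rcases le_total 0 y with hy | hy
    · rw [abs_of_nonneg hy]; exact hpos y hy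
    · have := hpos (-y) (by linarith)
      rwa [T.f_even, ← abs_of_nonpos hy] at this
  · refine (T.integrable_dissipation hN).congr (Eventually.of_forall fun y => ?_)
    simp only [cutMobility_of_one_le (hone y)]

end IsTrajectory

/-- The two scaling parameters make b and a independent unless m = 4, where b/a⁴ is invariant. -/
theorem IsProfile.scale {m b a : ℝ} {f f₁ f₂ F : ℝ → ℝ} (P : IsProfile m b a f f₁ f₂ F) {A L : ℝ}
    (hA : 0 < A) (hL : 0 < L) :
    IsProfile m (A ^ m / L ^ 4 * b) (A / L * a) (fun y => A * f (y / L))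
      (fun y => A / L * f₁ (y / L)) (fun y => A / L ^ 2 * f₂ (y / L))
      (fun y => A ^ m * A / L ^ 3 * F (y / L)) := by
  have hd : ∀ {u u' : ℝ → ℝ}, (∀ y, HasDerivAt u (u' y) y) → ∀ c y,
      HasDerivAt (fun y => c * u (y / L)) (c * (u' (y / L) / L)) y := by
    intro u u' hu c y
    have h1 := (hu (y / L)).comp y ((hasDerivAt_id y).div_const L)
    exact (h1.const_mul c).congr_deriv (by simp [div_eq_mul_inv])
  have hAm : 0 < A ^ m := Real.rpow_pos_of_pos hA m
  have hneg : ∀ y, (A * f y) ^ (-m) = (A ^ m)⁻¹ * f y ^ (-m) := fun y => by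
    rw [Real.mul_rpow hA.le (P.pos y).le, Real.rpow_neg hA.le]
  refine ⟨fun y => mul_pos hA (P.pos _), fun y => by simp only [neg_div, P.even], fun y => ?_,
    fun y => ?_, fun y => ?_, fun y => ?_, ?_, ?_, ?_, ?_⟩
  · exact (hd P.hf A y).congr_deriv (by ring)
  · exact (hd P.hf₁ (A / L) y).congr_deriv (by field_simp)
  · refine (hd P.hf₂ (A / L ^ 2) y).congr_deriv ?_
    rw [hneg]
    field_simp
  · refine (hd P.hF (A ^ m * A / L ^ 3) y).congr_deriv ?_
    field_simp
  · obtain ⟨C, hC⟩ := P.slope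
    refine ⟨A * |C| * (1 + (√L)⁻¹), fun y => ?_⟩
    have h1 := hC (y / L)
    have e : A * f (y / L) - A / L * a * |y| = A * (f (y / L) - a * |y / L|) := by
      rw [abs_div, abs_of_pos hL]
      field_simp
    have e2 : √|y / L| = √|y| * (√L)⁻¹ := by
      rw [abs_div, abs_of_pos hL, Real.sqrt_div (abs_nonneg y)]
      rfl
    rw [e, abs_mul, abs_of_pos hA]
    rw [e2] at h1
    have hs := Real.sqrt_nonneg |y|
    have hi : 0 ≤ (√L)⁻¹ := by positivity
    calc A * |f (y / L) - (a * |y / L|)| ≤ A * (|C| * (1 + √|y| * (√L)⁻¹)) := by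
          gcongr
          refine h1.trans ?_
          gcongr
          exact le_abs_self C
      _ ≤ A * |C| * ((1 + (√L)⁻¹) * (1 + √|y|)) := by
        rw [mul_assoc]
        gcongr
        nlinarith
      _ = _ := by ring
  · obtain ⟨C, hC⟩ := P.energy
    refine ⟨L * (A / L) ^ 2 * |C| * (1 + L⁻¹), fun Y hY => ?_⟩
    have h1 := hC (Y / L) (by positivity)
    have e : ∫ y in (-Y)..Y, (A / L * f₁ (y / L)) ^ 2
        = L * (A / L) ^ 2 * ∫ y in (-(Y / L))..(Y / L), f₁ y ^ 2 := by
      simp only [mul_pow]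
      rw [intervalIntegral.integral_const_mul,
        intervalIntegral.integral_comp_div (fun y => f₁ y ^ 2) hL.ne', neg_div]
      simp only [smul_eq_mul]
      ring
    rw [e]
    have hi : 0 ≤ L⁻¹ := by positivity
    calc L * (A / L) ^ 2 * ∫ y in (-(Y / L))..(Y / L), f₁ y ^ 2
        ≤ L * (A / L) ^ 2 * (|C| * (1 + Y / L)) := by
          gcongr
          refine h1.trans ?_
          gcongr
          exact le_abs_self C
      _ ≤ L * (A / L) ^ 2 * |C| * ((1 + L⁻¹) * (1 + Y)) := by
        rw [mul_assoc (L * (A / L) ^ 2)]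
        gcongr
        rw [div_eq_mul_inv]
        nlinarith
      _ = _ := by ring
  · obtain ⟨C, hC⟩ := P.flux
    set k := (L ^ (3 / 2 : ℝ))⁻¹ with hk
    have hk0 : 0 ≤ k := by positivity
    refine ⟨A ^ m * A / L ^ 3 * |C| * (1 + k), fun y => ?_⟩
    have h1 := hC (y / L)
    have e2 : |y / L| ^ (3 / 2 : ℝ) = |y| ^ (3 / 2 : ℝ) * k := by
      rw [abs_div, abs_of_pos hL, Real.div_rpow (abs_nonneg y) hL.le]
      rfl
    rw [e2] at h1
    have hs : 0 ≤ |y| ^ (3 / 2 : ℝ) := by positivity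
    rw [abs_mul, abs_of_pos (show 0 < A ^ m * A / L ^ 3 by positivity)]
    calc A ^ m * A / L ^ 3 * |F (y / L)|
        ≤ A ^ m * A / L ^ 3 * (|C| * (1 + |y| ^ (3 / 2 : ℝ) * k)) := by
          gcongr
          refine h1.trans ?_
          gcongr
          exact le_abs_self C
      _ ≤ A ^ m * A / L ^ 3 * |C| * ((1 + k) * (1 + |y| ^ (3 / 2 : ℝ))) := by
        rw [mul_assoc (A ^ m * A / L ^ 3)]
        gcongr
        nlinarith
      _ = _ := by ring
  · have h1 := (P.dissipation.comp_div hL.ne').const_mul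
      ((A ^ m)⁻¹ * (A ^ m * A / L ^ 3) ^ 2)
    refine h1.congr (Eventually.of_forall fun y => ?_)
    simp only [hneg]
    ring

end

end ThinFilm

namespace ThinFilm

noncomputable section

/-! ### Time intervals -/

/-- The times after the initial time. -/
def timeInterior (t₀ : WithBot ℝ) : Set ℝ := {t : ℝ | t₀ < (t : WithBot ℝ)}

theorem timeInterval_bot : timeInterval ⊥ = univ := by
  ext t; simp [timeInterval]

theorem timeInterval_coe (s : ℝ) : timeInterval (s : WithBot ℝ) = Ici s := by
  ext t; simp [timeInterval]

theorem timeInterior_bot : timeInterior ⊥ = univ := by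
  ext t; simp [timeInterior]

theorem timeInterior_coe (s : ℝ) : timeInterior (s : WithBot ℝ) = Ioi s := by
  ext t; simp [timeInterior]

theorem timeInterior_subset (t₀ : WithBot ℝ) : timeInterior t₀ ⊆ timeInterval t₀ :=
  fun t (ht : t₀ < (t : WithBot ℝ)) => (le_of_lt ht : t₀ ≤ (t : WithBot ℝ))

theorem isOpen_timeInterior (t₀ : WithBot ℝ) : IsOpen (timeInterior t₀) := by
  induction t₀ using WithBot.recBotCoe with
  | bot => rw [timeInterior_bot]; exact isOpen_univ
  | coe s => rw [timeInterior_coe]; exact isOpen_Ioi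

theorem measurableSet_timeInterval (t₀ : WithBot ℝ) : MeasurableSet (timeInterval t₀) := by
  induction t₀ using WithBot.recBotCoe with
  | bot => rw [timeInterval_bot]; exact MeasurableSet.univ
  | coe s => rw [timeInterval_coe]; exact measurableSet_Ici

theorem timeInterior_ae_eq (t₀ : WithBot ℝ) :
    (timeInterior t₀ : Set ℝ) =ᵐ[volume] timeInterval t₀ := by
  induction t₀ using WithBot.recBotCoe with
  | bot => rw [timeInterior_bot, timeInterval_bot]; exact ae_eq_refl _
  | coe s => rw [timeInterior_coe, timeInterval_coe]; exact Ioi_ae_eq_Ici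

theorem ae_mem_timeInterior (t₀ : WithBot ℝ) :
    ∀ᵐ t : ℝ, t ∈ timeInterval t₀ → t ∈ timeInterior t₀ := by
  filter_upwards [(timeInterior_ae_eq t₀).mem_iff] with t ht using ht.2

/-! ### Integration by parts against compactly supported functions -/

theorem integrable_of_continuous_of_eq_zero {u : ℝ → ℝ} (hu : Continuous u) {R : ℝ}
    (h : ∀ x, R < |x| → u x = 0) : Integrable u := by
  refine hu.integrable_of_hasCompactSupport (HasCompactSupport.intro (isCompact_Icc (a := -R)
    (b := R)) fun x hx => h x ?_)
  by_contra hxR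
  exact hx (abs_le.1 (not_lt.1 hxR))

theorem integral_mul_deriv_of_eq_zero {u u' v v' : ℝ → ℝ} (hu : ∀ x, HasDerivAt u (u' x) x)
    (hu' : Continuous u') (hv : ∀ x, HasDerivAt v (v' x) x) (hv' : Continuous v') {R : ℝ}
    (h : ∀ x, R < |x| → v x = 0) (h' : ∀ x, R < |x| → v' x = 0) :
    ∫ x, u x * v' x = -∫ x, u' x * v x := by
  have uc : Continuous u := continuous_iff_continuousAt.2 fun y => (hu y).continuousAt
  have vc : Continuous v := continuous_iff_continuousAt.2 fun y => (hv y).continuousAt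
  exact integral_mul_deriv_eq_deriv_mul_of_integrable (fun x _ => hu x) (fun x _ => hv x)
    (integrable_of_continuous_of_eq_zero (R := R) (uc.mul hv') fun x hx => by simp [h' x hx])
    (integrable_of_continuous_of_eq_zero (R := R) (hu'.mul vc) fun x hx => by simp [h x hx])
    (integrable_of_continuous_of_eq_zero (R := R) (uc.mul vc) fun x hx => by simp [h x hx])

/-- The partial derivatives of a test function on the plane. -/
theorem exists_partial_derivs {ψ : ℝ × ℝ → ℝ} (hψ : ContDiff ℝ ∞ ψ) (hc : HasCompactSupport ψ) :
    ∃ (ψx ψt : ℝ × ℝ → ℝ) (R C : ℝ), 0 < R ∧ 0 ≤ C ∧ Continuous ψx ∧ Continuous ψt ∧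
      (∀ x t, HasDerivAt (fun z => ψ (z, t)) (ψx (x, t)) x) ∧
      (∀ x t, HasDerivAt (fun s => ψ (x, s)) (ψt (x, t)) t) ∧
      (∀ x t, R < |x| ∨ R < |t| → ψ (x, t) = 0 ∧ ψx (x, t) = 0 ∧ ψt (x, t) = 0) ∧
      ∀ q, |ψx q| ≤ C := by
  have hfd : Continuous (fderiv ℝ ψ) := hψ.continuous_fderiv (by simp)
  have hd : ∀ q, HasFDerivAt ψ (fderiv ℝ ψ q) q := fun q =>
    (hψ.differentiable (by simp) q).hasFDerivAt
  have hx : Continuous fun q => fderiv ℝ ψ q (1, 0) := hfd.clm_apply continuous_const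
  have ht : Continuous fun q => fderiv ℝ ψ q (0, 1) := hfd.clm_apply continuous_const
  obtain ⟨R, hR⟩ := hc.isBounded.subset_closedBall (0 : ℝ × ℝ)
  have hcx : HasCompactSupport fun q => fderiv ℝ ψ q (1, 0) :=
    (hc.fderiv ℝ).comp_left (g := fun L : (ℝ × ℝ) →L[ℝ] ℝ => L (1, 0)) (by simp)
  obtain ⟨C, hC⟩ := hcx.exists_bound_of_continuous hx
  refine ⟨_, _, |R| + 1, |C|, by positivity, abs_nonneg C, hx, ht, fun x t => ?_, fun x t => ?_,
    fun x t hxt => ?_, fun q => (hC q).trans (le_abs_self C)⟩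
  · have := (hd (x, t)).comp_hasDerivAt x ((hasDerivAt_id x).prodMk (hasDerivAt_const x t))
    exact this
  · have := (hd (x, t)).comp_hasDerivAt t ((hasDerivAt_const t x).prodMk (hasDerivAt_id t))
    exact this
  · have hn : (x, t) ∉ tsupport ψ := by
      intro hmem
      have h1 := hR hmem
      rw [mem_closedBall_zero_iff, Prod.norm_def, max_le_iff, Real.norm_eq_abs,
        Real.norm_eq_abs] at h1
      have := le_abs_self R
      rcases hxt with h | h
      · linarith [h1.1]
      · linarith [h1.2]
    have h0 : fderiv ℝ ψ (x, t) = 0 := by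
      by_contra h
      exact hn (support_fderiv_subset ℝ h)
    exact ⟨image_eq_zero_of_notMem_tsupport hn, by simp [h0], by simp [h0]⟩

/-! ### The weak form of a conservation law -/

/-- A function that satisfies `h_t + J_x = 0` classically after the initial time, with a flux that
is integrable up to the initial time, satisfies the weak form of the conservation law. -/
theorem weak_identity {t₀ : WithBot ℝ} {h ht J : ℝ → ℝ → ℝ}
    (hcont : ContinuousOn (fun p : ℝ × ℝ => h p.1 p.2) (univ ×ˢ timeInterval t₀))
    (htc : ContinuousOn (fun p : ℝ × ℝ => ht p.1 p.2) (univ ×ˢ timeInterior t₀))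
    (hJc : ContinuousOn (fun p : ℝ × ℝ => J p.1 p.2) (univ ×ˢ timeInterior t₀))
    (hd : ∀ x, ∀ t ∈ timeInterior t₀, HasDerivAt (fun s => h x s) (ht x t) t)
    (hJ : ∀ x, ∀ t ∈ timeInterior t₀, HasDerivAt (fun z => J z t) (-ht x t) x)
    (hb : ∀ R : ℝ, 0 < R → ∃ g : ℝ → ℝ, IntegrableOn g (timeInterval t₀ ∩ Icc (-R) R) ∧
      ∀ x t, |x| ≤ R → t ∈ timeInterior t₀ → |t| ≤ R → |J x t| ≤ g t)
    {ψ : ℝ × ℝ → ℝ} (hψ : ContDiff ℝ ∞ ψ) (hψc : HasCompactSupport ψ) :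
    (∫ t in timeInterval t₀, ∫ x, h x t * deriv (fun s => ψ (x, s)) t)
      + (∫ t in timeInterval t₀, ∫ x, J x t * deriv (fun z => ψ (z, t)) x)
      + WithBot.recBotCoe (C := fun _ => ℝ) 0 (fun s => ∫ x, h x s * ψ (x, s)) t₀ = 0 := by
  obtain ⟨ψx, ψt, R, C, hR, hC, hxc, htψ, hψx, hψt, hz, hbd⟩ := exists_partial_derivs hψ hψc
  have ψc : Continuous ψ := hψ.continuous
  simp only [fun x t => (hψx x t).deriv, fun x t => (hψt x t).deriv]
  set A : ℝ → ℝ := fun t => ∫ x, h x t * ψt (x, t) with hA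
  set B : ℝ → ℝ := fun t => ∫ x, J x t * ψx (x, t) with hB
  set M : ℝ → ℝ := fun t => ∫ x, h x t * ψ (x, t) with hM
  have hK : ∀ x, x ∉ Icc (-R) R → R < |x| := fun x hx => by
    by_contra hxR
    exact hx (abs_le.1 (not_lt.1 hxR))
  have swapC : ∀ {u : ℝ × ℝ → ℝ} {S : Set ℝ}, ContinuousOn u (univ ×ˢ S) →
      ContinuousOn (fun p : ℝ × ℝ => u (p.2, p.1)) (S ×ˢ univ) := by
    intro u S hu
    exact hu.comp (by fun_prop) fun p hp => ⟨trivial, hp.1⟩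
  have par : ∀ {u : ℝ → ℝ → ℝ} {v : ℝ × ℝ → ℝ} {S : Set ℝ},
      ContinuousOn (fun p : ℝ × ℝ => u p.1 p.2) (univ ×ˢ S) → Continuous v →
      (∀ x t, R < |x| → v (x, t) = 0) → ContinuousOn (fun t => ∫ x, u x t * v (x, t)) S := by
    intro u v S hu hv hv0
    refine continuousOn_integral_of_compact_support (isCompact_Icc (a := -R) (b := R)) ?_ ?_
    · exact (swapC (hu.mul hv.continuousOn))
    · intro t x _ hx
      rw [hv0 x t (hK x hx), mul_zero]
  have hAc : ContinuousOn A (timeInterval t₀) :=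
    par hcont htψ fun x t hx => (hz x t (Or.inl hx)).2.2
  have hMc : ContinuousOn M (timeInterval t₀) := par hcont ψc fun x t hx => (hz x t (Or.inl hx)).1
  have hBc : ContinuousOn B (timeInterior t₀) := par hJc hxc fun x t hx => (hz x t (Or.inl hx)).2.1
  have slice : ∀ {u : ℝ → ℝ → ℝ} {S : Set ℝ},
      ContinuousOn (fun p : ℝ × ℝ => u p.1 p.2) (univ ×ˢ S) →
        ∀ t ∈ S, Continuous fun x => u x t := by
    intro u S hu t ht
    exact hu.comp_continuous (f := fun x : ℝ => (x, t)) (by fun_prop) fun x => ⟨trivial, ht⟩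
  have hio := isOpen_timeInterior t₀
  -- Differentiation under the integral gives ∫ (h_t ψ + h ψ_t), and integration by parts in x turns
  -- ∫ h_t ψ into ∫ J ψ_x.
  have hMd : ∀ t ∈ timeInterior t₀, HasDerivAt M (A t + B t) t := by
    intro t htI
    obtain ⟨δ, hδ, hball⟩ := Metric.isOpen_iff.1 hio t htI
    have hsub : Icc (t - δ / 2) (t + δ / 2) ⊆ timeInterior t₀ := fun s hs => hball (by
      rw [Metric.mem_ball, Real.dist_eq, abs_lt]
      constructor <;> linarith [hs.1, hs.2])
    have hcd : ContinuousOn (fun p : ℝ × ℝ => ht p.1 p.2 * ψ p + h p.1 p.2 * ψt p)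
        (univ ×ˢ timeInterior t₀) :=
      (htc.mul ψc.continuousOn).add ((hcont.mono (prod_mono_right (timeInterior_subset t₀))).mul
        htψ.continuousOn)
    obtain ⟨D, hD⟩ := ((isCompact_Icc (a := -R) (b := R)).prod
      (isCompact_Icc (a := t - δ / 2) (b := t + δ / 2))).exists_bound_of_continuousOn
      (hcd.mono (prod_mono (subset_univ _) hsub))
    have hder := hasDerivAt_integral_of_dominated_loc_of_deriv_le (μ := volume)
      (F := fun s x => h x s * ψ (x, s)) (F' := fun s x => ht x s * ψ (x, s) + h x s * ψt (x, s))
      (x₀ := t) (s := Icc (t - δ / 2) (t + δ / 2))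
      (bound := (Icc (-R) R).indicator fun _ => D)
      (Icc_mem_nhds (by linarith) (by linarith))
      (by
        filter_upwards [hio.mem_nhds htI] with s hs
        exact ((slice hcont s (timeInterior_subset t₀ hs)).mul
          (by fun_prop)).aestronglyMeasurable)
      (integrable_of_continuous_of_eq_zero ((slice hcont t (timeInterior_subset t₀ htI)).mul
        (by fun_prop)) fun x hx => by rw [(hz x t (Or.inl hx)).1, mul_zero])
      (slice (u := fun x t => ht x t * ψ (x, t) + h x t * ψt (x, t)) hcd t
        htI).aestronglyMeasurable
      (Eventually.of_forall fun x s hs => by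
        by_cases hx : x ∈ Icc (-R) R
        · rw [indicator_of_mem hx]
          exact hD (x, s) ⟨hx, hs⟩
        · rw [indicator_of_notMem hx, (hz x s (Or.inl (hK x hx))).1,
            (hz x s (Or.inl (hK x hx))).2.2]
          simp)
      ((integrable_indicator_iff measurableSet_Icc).2 (by simp))
      (Eventually.of_forall fun x s hs => by
        exact ((hd x s (hsub hs)).mul (hψt x s)))
    refine hder.2.congr_deriv ?_
    have hhc := slice hcont t (timeInterior_subset t₀ htI)
    have hhtc := slice htc t htI
    have i1 : Integrable fun x => ht x t * ψ (x, t) :=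
      integrable_of_continuous_of_eq_zero (hhtc.mul (by fun_prop))
        fun x hx => by rw [(hz x t (Or.inl hx)).1, mul_zero]
    have i2 : Integrable fun x => h x t * ψt (x, t) :=
      integrable_of_continuous_of_eq_zero (hhc.mul (by fun_prop))
        fun x hx => by rw [(hz x t (Or.inl hx)).2.2, mul_zero]
    rw [integral_add i1 i2]
    have ibp := integral_mul_deriv_of_eq_zero (fun x => hJ x t htI) hhtc.neg
      (fun x => hψx x t) (by fun_prop : Continuous fun x => ψx (x, t))
      (fun x hx => (hz x t (Or.inl hx)).1) (fun x hx => (hz x t (Or.inl hx)).2.1)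
    have e : B t = ∫ x, ht x t * ψ (x, t) := by
      simp only [hB]
      rw [ibp, ← integral_neg]
      simp
    rw [e]
    ring
  have hAz : ∀ t, R < |t| → A t = 0 := fun t h => by simp [hA, (hz _ t (Or.inr h)).2.2]
  have hBz : ∀ t, R < |t| → B t = 0 := fun t h => by simp [hB, (hz _ t (Or.inr h)).2.1]
  have hMz : ∀ t, R < |t| → M t = 0 := fun t h => by simp [hM, (hz _ t (Or.inr h)).1]
  -- The flux may blow up at the initial time, so B is controlled only by the integrable majorant.
  -- Its integrability allows the fundamental theorem of calculus up to the endpoint, where M is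
  -- merely continuous.
  have hBint : ∀ S, 0 < S → IntegrableOn B (timeInterval t₀ ∩ Icc (-S) S) := by
    intro S hS
    set S' := max R S with hS'
    obtain ⟨g, hg, hgb⟩ := hb S' (hR.trans_le (le_max_left _ _))
    have hmeas : AEStronglyMeasurable B (volume.restrict (timeInterval t₀ ∩ Icc (-S) S)) := by
      have h1 : AEStronglyMeasurable B (volume.restrict (timeInterior t₀)) :=
        hBc.aestronglyMeasurable hio.measurableSet
      rw [Measure.restrict_congr_set (timeInterior_ae_eq t₀)] at h1
      exact h1.mono_measure (Measure.restrict_mono inter_subset_left le_rfl)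
    have hg' : IntegrableOn (fun t => g t * C * (2 * R)) (timeInterval t₀ ∩ Icc (-S) S) := by
      refine ((hg.mono_set ?_).mul_const C).mul_const (2 * R)
      exact inter_subset_inter_right _ (Icc_subset_Icc (neg_le_neg (le_max_right _ _))
        (le_max_right _ _))
    refine Integrable.mono' hg' hmeas ?_
    have hmI : MeasurableSet (timeInterval t₀ ∩ Icc (-S) S) :=
      (measurableSet_timeInterval t₀).inter measurableSet_Icc
    filter_upwards [ae_restrict_mem hmI, ae_restrict_of_ae (ae_mem_timeInterior t₀)] with t h1 h2
    have htI := h2 h1.1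
    have hts : |t| ≤ S' := (abs_le.2 h1.2).trans (le_max_right _ _)
    have e : B t = ∫ x in Icc (-R) R, J x t * ψx (x, t) := by
      refine (setIntegral_eq_integral_of_forall_compl_eq_zero fun x hx => ?_).symm
      rw [(hz x t (Or.inl (hK x hx))).2.1, mul_zero]
    rw [e]
    have := norm_setIntegral_le_of_norm_le_const (μ := volume) (s := Icc (-R) R)
      (f := fun x => J x t * ψx (x, t)) (C := g t * C) (by simp) (fun x hx => by
        have hx' : |x| ≤ S' := (abs_le.2 hx).trans (le_max_left _ _)
        have hj := hgb x t hx' htI hts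
        rw [norm_mul]
        exact mul_le_mul hj (hbd _) (norm_nonneg _) ((abs_nonneg _).trans hj))
    refine this.trans (le_of_eq ?_)
    rw [Real.volume_real_Icc_of_le (by linarith)]
    ring
  have final : ∀ S T, S ≤ T → Icc S T ⊆ timeInterval t₀ → (∀ t ∈ Ioo S T, t ∈ timeInterior t₀) →
      (∀ t ∈ timeInterval t₀ \ Icc S T, R < |t|) → R < T →
      (∫ t in timeInterval t₀, A t) + (∫ t in timeInterval t₀, B t) + M S = 0 := by
    intro S T hST hsub hint hout hRT
    have eA : ∫ t in timeInterval t₀, A t = ∫ t in S..T, A t := by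
      rw [setIntegral_eq_of_subset_of_forall_sdiff_eq_zero (measurableSet_timeInterval t₀) hsub
        (fun t ht => hAz t (hout t ht)), integral_Icc_eq_integral_Ioc,
        intervalIntegral.integral_of_le hST]
    have eB : ∫ t in timeInterval t₀, B t = ∫ t in S..T, B t := by
      rw [setIntegral_eq_of_subset_of_forall_sdiff_eq_zero (measurableSet_timeInterval t₀) hsub
        (fun t ht => hBz t (hout t ht)), integral_Icc_eq_integral_Ioc,
        intervalIntegral.integral_of_le hST]
    have iA : IntervalIntegrable A volume S T :=
      (hAc.mono (by rw [uIcc_of_le hST]; exact hsub)).intervalIntegrable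
    have iB : IntervalIntegrable B volume S T := by
      rw [intervalIntegrable_iff_integrableOn_Icc_of_le hST]
      refine (hBint (|S| + |T| + 1) (by positivity)).mono_set (subset_inter hsub ?_)
      exact Icc_subset_Icc (by linarith [neg_abs_le S, abs_nonneg T])
        (by linarith [le_abs_self T, abs_nonneg S])
    have ftc := intervalIntegral.integral_eq_sub_of_hasDerivAt_of_le hST (hMc.mono hsub)
      (fun t ht => hMd t (hint t ht)) (iA.add iB)
    rw [intervalIntegral.integral_add iA iB] at ftc
    rw [eA, eB, ftc, hMz T (hRT.trans_le (le_abs_self T))]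
    ring
  induction t₀ using WithBot.recBotCoe with
  | bot =>
    have h1 := final (-(R + 1)) (R + 1) (by linarith)
      (by rw [timeInterval_bot]; exact subset_univ _)
      (fun t _ => by rw [timeInterior_bot]; trivial)
      (fun t ht => by
        by_contra h
        have := abs_le.1 (not_lt.1 h)
        exact ht.2 ⟨by linarith [this.1], by linarith [this.2]⟩) (by linarith)
    rw [hMz (-(R + 1)) (by rw [abs_neg, abs_of_pos (by linarith)]; linarith)] at h1
    exact h1
  | coe s =>
    have h1 := final s (|s| + R + 1) (by linarith [le_abs_self s])
      (by rw [timeInterval_coe]; exact Icc_subset_Ici_self)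
      (fun t ht => by rw [timeInterior_coe]; exact ht.1)
      (fun t ht => by
        rw [timeInterval_coe] at ht
        by_contra h
        exact ht.2 ⟨ht.1, by linarith [le_abs_self t, not_lt.1 h, abs_nonneg s]⟩)
      (by linarith [abs_nonneg s])
    exact h1

end

end ThinFilm

namespace ThinFilm

noncomputable section

/-! ### Regularity of smooth slices -/

theorem exists_radius_of_hasCompactSupport {φ : ℝ → ℝ} (hc : HasCompactSupport φ) :
    ∃ R, ∀ x, R < |x| → x ∉ tsupport φ := by
  obtain ⟨R, hR⟩ := hc.isBounded.subset_closedBall (0 : ℝ)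
  refine ⟨R, fun x hx hmem => ?_⟩
  have := hR hmem
  rw [mem_closedBall_zero_iff, Real.norm_eq_abs] at this
  linarith

/-- A smooth compactly supported function on the line with its first three derivatives. -/
theorem exists_three_derivs {φ : ℝ → ℝ} (hφ : ContDiff ℝ ∞ φ) (hc : HasCompactSupport φ) :
    ∃ (φ₁ φ₂ : ℝ → ℝ) (R : ℝ), (∀ x, HasDerivAt φ (φ₁ x) x) ∧ (∀ x, HasDerivAt φ₁ (φ₂ x) x) ∧
      (∀ x, HasDerivAt φ₂ (iteratedDeriv 3 φ x) x) ∧ Continuous (iteratedDeriv 3 φ) ∧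
      ∀ x, R < |x| → φ x = 0 ∧ φ₁ x = 0 ∧ φ₂ x = 0 ∧ iteratedDeriv 3 φ x = 0 := by
  obtain ⟨R, hR⟩ := exists_radius_of_hasCompactSupport hc
  have hd : ∀ k : ℕ, ∀ x, HasDerivAt (iteratedDeriv k φ) (iteratedDeriv (k + 1) φ x) x := by
    intro k x
    rw [iteratedDeriv_succ]
    exact ((hφ.differentiable_iteratedDeriv k
      (by exact_mod_cast ENat.natCast_lt_top k)) x).hasDerivAt
  have hz : ∀ k : ℕ, ∀ x, R < |x| → iteratedDeriv k φ x = 0 := by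
    intro k x hx
    have hev : φ =ᶠ[𝓝 x] fun _ => (0 : ℝ) := notMem_tsupport_iff_eventuallyEq.1 (hR x hx)
    rw [hev.iteratedDeriv_eq k]
    simp
  refine ⟨iteratedDeriv 1 φ, iteratedDeriv 2 φ, R, fun x => ?_, hd 1, hd 2,
    hφ.continuous_iteratedDeriv 3 (WithTop.coe_le_coe.2 (le_top : ((3 : ℕ) : ℕ∞) ≤ ⊤)),
    fun x hx => ⟨?_, hz 1 x hx, hz 2 x hx, hz 3 x hx⟩⟩
  · simpa using hd 0 x
  · simpa using hz 0 x hx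

/-- The classical third derivative is continuous, hence a distribution of order 0, and a continuous
weight is enough for the product. -/
theorem isWeightedThirdDeriv_of_hasDerivAt (m : ℝ) {u u₁ u₂ u₃ : ℝ → ℝ} (hpos : ∀ x, 0 < u x)
    (h₁ : ∀ x, HasDerivAt u (u₁ x) x) (h₂ : ∀ x, HasDerivAt u₁ (u₂ x) x)
    (h₃ : ∀ x, HasDerivAt u₂ (u₃ x) x) (hc : Continuous u₃) :
    IsWeightedThirdDeriv m u fun x => u x ^ (m / 2) * u₃ x := by
  have c0 : Continuous u := continuous_iff_continuousAt.2 fun y => (h₁ y).continuousAt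
  have c1 : Continuous u₁ := continuous_iff_continuousAt.2 fun y => (h₂ y).continuousAt
  have c2 : Continuous u₂ := continuous_iff_continuousAt.2 fun y => (h₃ y).continuousAt
  have hloc : LocallyIntegrableOn u₃ ((⊤ : TopologicalSpace.Opens ℝ) : Set ℝ) volume :=
    hc.locallyIntegrable.locallyIntegrableOn _
  let T : 𝓓'^{((0 : ℕ) : ℕ∞)}((⊤ : TopologicalSpace.Opens ℝ), ℝ) :=
    (TestFunction.integralAgainstBilinCLM (ContinuousLinearMap.mul ℝ ℝ) volume u₃ :
      𝓓^{((0 : ℕ) : ℕ∞)}((⊤ : TopologicalSpace.Opens ℝ), ℝ) →L[ℝ] ℝ)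
  have hT : ∀ φ, T φ = ∫ x, φ x * u₃ x := fun φ =>
    TestFunction.integralAgainstBilinCLM_eq_integral hloc
  refine ⟨0, ?_, T, fun φ hφ => ?_, fun φ hφ => ?_⟩
  · have : Continuous fun x => u x ^ (m / 2) :=
      c0.rpow_const fun x => Or.inl (hpos x).ne'
    exact contDiff_zero.2 this
  · obtain ⟨φ₁, φ₂, R, d1, d2, d3, hc3, hz⟩ := exists_three_derivs hφ φ.hasCompactSupport
    have cφ₁ : Continuous φ₁ := continuous_iff_continuousAt.2 fun y => (d2 y).continuousAt
    have cφ₂ : Continuous φ₂ := continuous_iff_continuousAt.2 fun y => (d3 y).continuousAt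
    have e1 := integral_mul_deriv_of_eq_zero h₁ c1 d3 hc3 (fun x hx => (hz x hx).2.2.1)
      (fun x hx => (hz x hx).2.2.2)
    have e2 := integral_mul_deriv_of_eq_zero h₂ c2 d2 cφ₂ (fun x hx => (hz x hx).2.1)
      (fun x hx => (hz x hx).2.2.1)
    have e3 := integral_mul_deriv_of_eq_zero h₃ hc d1 cφ₁ (fun x hx => (hz x hx).1)
      (fun x hx => (hz x hx).2.1)
    rw [hT, e1, e2, e3]
    simp only [neg_neg]
    exact integral_congr_ae (Eventually.of_forall fun x => mul_comm _ _)
  · rw [hT]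
    refine integral_congr_ae (Eventually.of_forall fun x => ?_)
    change u x ^ (m / 2) * φ x * u₃ x = u x ^ (m / 2) * u₃ x * φ x
    ring

theorem hasWeakDeriv_of_hasDerivAt {u u₁ : ℝ → ℝ} (h₁ : ∀ x, HasDerivAt u (u₁ x) x)
    (hc : Continuous u₁) : HasWeakDeriv u u₁ := by
  refine ⟨hc.locallyIntegrable, fun φ hφ hφc => ?_⟩
  obtain ⟨φ₁, φ₂, R, d1, d2, d3, hc3, hz⟩ := exists_three_derivs hφ hφc
  have cφ₁ : Continuous φ₁ := continuous_iff_continuousAt.2 fun y => (d2 y).continuousAt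
  simp only [fun x => (d1 x).deriv]
  exact integral_mul_deriv_of_eq_zero h₁ hc d1 cφ₁ (fun x hx => (hz x hx).1)
      (fun x hx => (hz x hx).2.1)

/-! ### Slices of self-similar solutions -/

namespace IsProfile

variable {m b a : ℝ} {f f₁ f₂ F : ℝ → ℝ}

theorem continuous_f (P : IsProfile m b a f f₁ f₂ F) : Continuous f :=
  continuous_iff_continuousAt.2 fun y => (P.hf y).continuousAt

theorem continuous_f₁ (P : IsProfile m b a f f₁ f₂ F) : Continuous f₁ :=
  continuous_iff_continuousAt.2 fun y => (P.hf₁ y).continuousAt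

theorem continuous_F (P : IsProfile m b a f f₁ f₂ F) : Continuous F :=
  continuous_iff_continuousAt.2 fun y => (P.hF y).continuousAt

theorem continuous_third (P : IsProfile m b a f f₁ f₂ F) : Continuous fun y => f y ^ (-m) * F y :=
  (P.continuous_f.rpow_const fun y => Or.inl (P.pos y).ne').mul P.continuous_F

/-- The third derivative of `x ↦ l f(x / l)`. -/
def third (m : ℝ) (f F : ℝ → ℝ) (l x : ℝ) : ℝ := f (x / l) ^ (-m) * F (x / l) / l / l

theorem hasDerivAt_comp_div {u u' : ℝ → ℝ} (hu : ∀ y, HasDerivAt u (u' y) y) (l x : ℝ) :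
    HasDerivAt (fun x => u (x / l)) (u' (x / l) / l) x :=
  ((hu (x / l)).comp x ((hasDerivAt_id x).div_const l)).congr_deriv (by simp [div_eq_mul_inv])

theorem hasDerivAt_slice (P : IsProfile m b a f f₁ f₂ F) {l : ℝ} (hl : 0 < l) (x : ℝ) :
    HasDerivAt (fun x => l * f (x / l)) (f₁ (x / l)) x :=
  ((hasDerivAt_comp_div P.hf l x).const_mul l).congr_deriv (by field_simp)

theorem isWeightedThirdDeriv_slice (P : IsProfile m b a f f₁ f₂ F) {l : ℝ} (hl : 0 < l) :
    IsWeightedThirdDeriv m (fun x => l * f (x / l))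
      fun x => (l * f (x / l)) ^ (m / 2) * third m f F l x := by
  refine isWeightedThirdDeriv_of_hasDerivAt m (u₂ := fun x => f₂ (x / l) / l)
    (fun x => mul_pos hl (P.pos _)) (P.hasDerivAt_slice hl) (hasDerivAt_comp_div P.hf₁ l)
    (fun x => (hasDerivAt_comp_div P.hf₂ l x).div_const l) ?_
  have := P.continuous_third.comp (continuous_id.div_const l)
  exact (this.div_const l).div_const l

/-- The flux h^m h_xxx of a slice at scale `l`: the factor l^m comes from h^m and l^(-2) from the
third derivative. -/
theorem flux_slice (P : IsProfile m b a f f₁ f₂ F) {l : ℝ} (hl : 0 < l) (x : ℝ) :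
    (l * f (x / l)) ^ (m / 2) * ((l * f (x / l)) ^ (m / 2) * third m f F l x)
      = l ^ (m - 2) * F (x / l) := by
  have hf := P.pos (x / l)
  have hlf : 0 < l * f (x / l) := mul_pos hl hf
  rw [← mul_assoc, ← Real.rpow_add hlf, add_halves, Real.mul_rpow hl.le hf.le, third,
    Real.rpow_neg hf.le, Real.rpow_sub hl]
  have h1 : 0 < f (x / l) ^ m := Real.rpow_pos_of_pos hf m
  rw [Real.rpow_two]
  field_simp

/-- Up to a power of `l`, the square of h^(m/2) h_xxx is the rescaled dissipation density f^(-m) F².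
-/
theorem memLp_slice (P : IsProfile m b a f f₁ f₂ F) {l : ℝ} (hl : 0 < l) :
    MemLp (fun x => (l * f (x / l)) ^ (m / 2) * third m f F l x) 2 volume := by
  have hc : Continuous fun x => (l * f (x / l)) ^ (m / 2) * third m f F l x := by
    have c1 : Continuous fun x => l * f (x / l) :=
      continuous_const.mul (P.continuous_f.comp (continuous_id.div_const l))
    have c2 := P.continuous_third.comp (continuous_id.div_const l)
    exact (c1.rpow_const fun x => Or.inl (mul_pos hl (P.pos _)).ne').mul
      ((c2.div_const l).div_const l)
  rw [memLp_two_iff_integrable_sq hc.aestronglyMeasurable]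
  refine ((P.dissipation.comp_div hl.ne').const_mul (l ^ m / l ^ 4)).congr
    (Eventually.of_forall fun x => ?_)
  have hf := P.pos (x / l)
  have hlf : 0 < l * f (x / l) := mul_pos hl hf
  have e1 : ((l * f (x / l)) ^ (m / 2)) ^ 2 = l ^ m * f (x / l) ^ m := by
    rw [sq, ← Real.rpow_add hlf, add_halves, Real.mul_rpow hl.le hf.le]
  have h1 : 0 < f (x / l) ^ m := Real.rpow_pos_of_pos hf m
  simp only [third, mul_pow, e1, Real.rpow_neg hf.le]
  field_simp

/-- Uniformity as l → 0 holds because the energy of f₁ on [-Y, Y] grows at most linearly: after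
rescaling, l (1 + R/l) = l + R stays bounded. The values are controlled by closeness to the cone. -/
theorem exists_H1_bound (P : IsProfile m b a f f₁ f₂ F) (Λ R : ℝ) :
    ∃ C, ∀ l, 0 < l → l ≤ Λ → ∫ x in Icc (-R) R, ((l * f (x / l)) ^ 2 + f₁ (x / l) ^ 2) ≤ C := by
  rcases lt_or_ge R 0 with hR | hR
  · exact ⟨0, fun l _ _ => by rw [Icc_eq_empty (by linarith)]; simp⟩
  obtain ⟨C₁, h1⟩ := P.slope
  obtain ⟨C₂, h2⟩ := P.energy
  set B := |a| * R + |C₁| * (|Λ| + √(|Λ| * R)) with hB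
  refine ⟨B ^ 2 * (2 * R) + |C₂| * (|Λ| + R), fun l hl hlΛ => ?_⟩
  have hΛ : l ≤ |Λ| := hlΛ.trans (le_abs_self Λ)
  have c1 : Continuous fun x => (l * f (x / l)) ^ 2 :=
    (continuous_const.mul (P.continuous_f.comp (continuous_id.div_const l))).pow 2
  have c2 : Continuous fun x => f₁ (x / l) ^ 2 :=
    (P.continuous_f₁.comp (continuous_id.div_const l)).pow 2
  rw [integral_add (c1.integrableOn_Icc) (c2.integrableOn_Icc)]
  have i1 : ∫ x in Icc (-R) R, (l * f (x / l)) ^ 2 ≤ B ^ 2 * (2 * R) := by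
    refine (Real.le_norm_self _).trans ((norm_setIntegral_le_of_norm_le_const (μ := volume)
      (f := fun x => (l * f (x / l)) ^ 2) (s := Icc (-R) R)
      (C := B ^ 2) measure_Icc_lt_top fun x hx => ?_).trans (le_of_eq ?_))
    · have hx' : |x| ≤ R := abs_le.2 hx
      have h3 := h1 (x / l)
      rw [abs_div, abs_of_pos hl] at h3
      have e : l * f (x / l) = l * (f (x / l) - a * (|x| / l)) + a * |x| := by
        field_simp
        ring
      have hs : l * √(|x| / l) ≤ √(|Λ| * R) := by
        have : l * √(|x| / l) = √(l * |x|) := by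
          rw [show l * |x| = l ^ 2 * (|x| / l) by field_simp, Real.sqrt_mul (by positivity),
            Real.sqrt_sq hl.le]
        rw [this]
        gcongr
      have h4 : |l * f (x / l)| ≤ B := by
        rw [e]
        refine (abs_add_le _ _).trans ?_
        rw [abs_mul, abs_mul, abs_abs, abs_of_pos hl]
        have h5 : l * |f (x / l) - a * (|x| / l)| ≤ |C₁| * (|Λ| + √(|Λ| * R)) := by
          calc l * |f (x / l) - a * (|x| / l)| ≤ l * (|C₁| * (1 + √(|x| / l))) := by
                gcongr
                refine h3.trans ?_
                gcongr
                exact le_abs_self _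
            _ = |C₁| * (l + l * √(|x| / l)) := by ring
            _ ≤ _ := by gcongr
        have h6 : |a| * |x| ≤ |a| * R := by gcongr
        linarith
      rw [Real.norm_eq_abs, abs_pow]
      gcongr
    · rw [Real.volume_real_Icc_of_le (by linarith)]
      ring
  have i2 : ∫ x in Icc (-R) R, f₁ (x / l) ^ 2 ≤ |C₂| * (|Λ| + R) := by
    rw [integral_Icc_eq_integral_Ioc, ← intervalIntegral.integral_of_le (by linarith),
      intervalIntegral.integral_comp_div (fun y => f₁ y ^ 2) hl.ne', neg_div, smul_eq_mul]
    have h3 := h2 (R / l) (by positivity)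
    calc l * ∫ y in (-(R / l))..(R / l), f₁ y ^ 2 ≤ l * (|C₂| * (1 + R / l)) := by
          gcongr
          refine h3.trans ?_
          gcongr
          exact le_abs_self _
      _ = |C₂| * (l + R) := by field_simp
      _ ≤ _ := by gcongr
  linarith

/-! ### Self-similar weak solutions -/

/-- The law λ' = b λ^(m-3) balances the two terms of the equation. Integrability of λ^(m-2) and
λ^(m-7/2) is what the growth |y|^(3/2) of the profile flux requires, since |J| ≤ C (λ^(m-2) +
R^(3/2) λ^(m-7/2)) for |x| ≤ R. -/
theorem isWeakSolution (P : IsProfile m b a f f₁ f₂ F) {t₀ : WithBot ℝ} {h : ℝ → ℝ → ℝ}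
    {lam : ℝ → ℝ} (hpos : ∀ t ∈ timeInterior t₀, 0 < lam t)
    (hlam : ∀ t ∈ timeInterior t₀, HasDerivAt lam (b * lam t ^ (m - 3)) t)
    (hh : ∀ x, ∀ t ∈ timeInterior t₀, h x t = lam t * f (x / lam t))
    (hcont : ContinuousOn (fun p : ℝ × ℝ => h p.1 p.2) (univ ×ˢ timeInterval t₀))
    (hnn : ∀ x : ℝ, ∀ t ∈ timeInterval t₀, 0 ≤ h x t)
    (hup : ∀ T : ℝ, ∃ Λ, ∀ t ∈ timeInterior t₀, t ≤ T → lam t ≤ Λ)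
    (hi₁ : ∀ R, IntegrableOn (fun t => lam t ^ (m - 2)) (timeInterval t₀ ∩ Icc (-R) R))
    (hi₂ : ∀ R, IntegrableOn (fun t => lam t ^ (m - 7 / 2)) (timeInterval t₀ ∩ Icc (-R) R)) :
    IsWeakSolution m t₀ h := by
  set J : ℝ → ℝ → ℝ := fun x t => lam t ^ (m - 2) * F (x / lam t) with hJdef
  set q : ℝ → ℝ → ℝ := fun x t => h x t ^ (m / 2) * third m f F (lam t) x with hqdef
  set ht : ℝ → ℝ → ℝ := fun x t =>
    b * lam t ^ (m - 3) * (f (x / lam t) - x / lam t * f₁ (x / lam t)) with htdef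
  have hio := isOpen_timeInterior t₀
  have hlc : ContinuousOn (fun p : ℝ × ℝ => lam p.2) (univ ×ˢ timeInterior t₀) := by
    have : ContinuousOn lam (timeInterior t₀) := fun t ht =>
      (hlam t ht).continuousAt.continuousWithinAt
    exact this.comp continuousOn_snd fun p hp => hp.2
  have hlpos : ∀ p ∈ (univ : Set ℝ) ×ˢ timeInterior t₀, 0 < lam p.2 := fun p hp => hpos _ hp.2
  have hyc : ContinuousOn (fun p : ℝ × ℝ => p.1 / lam p.2) (univ ×ˢ timeInterior t₀) :=
    continuousOn_fst.div hlc fun p hp => (hlpos p hp).ne'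
  have hpw : ∀ r : ℝ, ContinuousOn (fun p : ℝ × ℝ => lam p.2 ^ r) (univ ×ˢ timeInterior t₀) :=
    fun r => hlc.rpow_const fun p hp => Or.inl (hlpos p hp).ne'
  have htc : ContinuousOn (fun p : ℝ × ℝ => ht p.1 p.2) (univ ×ˢ timeInterior t₀) :=
    (continuousOn_const.mul (hpw _)).mul ((P.continuous_f.comp_continuousOn hyc).sub
      (hyc.mul (P.continuous_f₁.comp_continuousOn hyc)))
  have hJc : ContinuousOn (fun p : ℝ × ℝ => J p.1 p.2) (univ ×ˢ timeInterior t₀) :=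
    (hpw _).mul (P.continuous_F.comp_continuousOn hyc)
  have hflux : ∀ x, ∀ t ∈ timeInterior t₀, h x t ^ (m / 2) * q x t = J x t := by
    intro x t ht
    simp only [hqdef, hJdef, hh x t ht]
    exact P.flux_slice (hpos t ht) x
  have hd : ∀ x, ∀ t ∈ timeInterior t₀, HasDerivAt (fun s => h x s) (ht x t) t := by
    intro x t htI
    have hl := hpos t htI
    have h1 : HasDerivAt (fun s => x / lam s) (-(x * (b * lam t ^ (m - 3))) / lam t ^ 2) t :=
      ((hasDerivAt_const t x).div (hlam t htI) hl.ne').congr_deriv (by simp)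
    have h2 := (hlam t htI).mul ((P.hf (x / lam t)).comp t h1)
    refine (h2.congr_of_eventuallyEq ?_).congr_deriv ?_
    · filter_upwards [hio.mem_nhds htI] with s hs using hh x s hs
    · simp only [htdef, Function.comp]
      field_simp
      ring
  have hJd : ∀ x, ∀ t ∈ timeInterior t₀, HasDerivAt (fun z => J z t) (-ht x t) x := by
    intro x t htI
    have hl := hpos t htI
    refine ((hasDerivAt_comp_div P.hF (lam t) x).const_mul (lam t ^ (m - 2))).congr_deriv ?_
    have e : lam t ^ (m - 3) = lam t ^ (m - 2) / lam t := by
      rw [← Real.rpow_sub_one hl.ne']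
      ring_nf
    simp only [htdef, e]
    field_simp
    ring
  obtain ⟨C, hC⟩ := P.flux
  have hJb : ∀ R : ℝ, 0 < R → ∀ x t, |x| ≤ R → t ∈ timeInterior t₀ →
      |J x t| ≤ |C| * (lam t ^ (m - 2) + R ^ (3 / 2 : ℝ) * lam t ^ (m - 7 / 2)) := by
    intro R hR x t hx htI
    have hl := hpos t htI
    have hp2 : 0 < lam t ^ (m - 2) := Real.rpow_pos_of_pos hl _
    have e : lam t ^ (m - 7 / 2) = lam t ^ (m - 2) / lam t ^ (3 / 2 : ℝ) := by
      rw [← Real.rpow_sub hl]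
      ring_nf
    have h1 : |x / lam t| ^ (3 / 2 : ℝ) ≤ R ^ (3 / 2 : ℝ) / lam t ^ (3 / 2 : ℝ) := by
      rw [abs_div, abs_of_pos hl, Real.div_rpow (abs_nonneg x) hl.le]
      gcongr
    calc |J x t| = lam t ^ (m - 2) * |F (x / lam t)| := by
          simp only [hJdef]
          rw [abs_mul, abs_of_pos hp2]
      _ ≤ lam t ^ (m - 2) * (|C| * (1 + R ^ (3 / 2 : ℝ) / lam t ^ (3 / 2 : ℝ))) := by
          gcongr
          refine (hC _).trans ?_
          gcongr
          exact le_abs_self C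
      _ = _ := by rw [e]; ring
  have hgint : ∀ R, IntegrableOn
      (fun t => |C| * (lam t ^ (m - 2) + R ^ (3 / 2 : ℝ) * lam t ^ (m - 7 / 2)))
      (timeInterval t₀ ∩ Icc (-R) R) := fun R =>
    ((hi₁ R).add ((hi₂ R).const_mul _)).const_mul _
  refine ⟨hcont, hnn, fun T R => ?_, q, ?_, ?_, fun ψ hψ hψc => ?_⟩
  · obtain ⟨Λ, hΛ⟩ := hup T
    obtain ⟨C', hC'⟩ := P.exists_H1_bound Λ R
    refine ⟨C', ?_⟩
    filter_upwards [ae_mem_timeInterior t₀] with t htI ht1 htT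
    have htI := htI ht1
    have hl := hpos t htI
    have hs : (fun x => h x t) = fun x => lam t * f (x / lam t) := funext fun x => hh x t htI
    have c1 : Continuous fun x => f₁ (x / lam t) :=
      P.continuous_f₁.comp (continuous_id.div_const _)
    refine ⟨fun x => f₁ (x / lam t), ?_, ?_, ?_⟩
    · rw [hs]
      exact hasWeakDeriv_of_hasDerivAt (P.hasDerivAt_slice hl) c1
    · rw [memLp_two_iff_integrable_sq c1.aestronglyMeasurable]
      exact (c1.pow 2).integrableOn_Icc
    · simp only [hh _ t htI]
      exact hC' _ hl (hΛ t htI htT)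
  · filter_upwards [ae_mem_timeInterior t₀] with t htI ht1
    have htI := htI ht1
    have hl := hpos t htI
    have hs : (fun x => h x t) = fun x => lam t * f (x / lam t) := funext fun x => hh x t htI
    have hq : (fun x => q x t) =
        fun x => (lam t * f (x / lam t)) ^ (m / 2) * third m f F (lam t) x := by
      funext x
      simp only [hqdef, hh x t htI]
    rw [hs, hq]
    exact ⟨P.memLp_slice hl, P.isWeightedThirdDeriv_slice hl⟩
  · rintro ⟨x₀, s₀⟩ hx
    set R := |x₀| + |s₀| + 1 with hR
    have hR0 : 0 < R := by positivity
    refine ⟨Icc (-R) R ×ˢ (timeInterval t₀ ∩ Icc (-R) R), ?_, ?_⟩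
    · have hn : Icc (-R) R ×ˢ Icc (-R) R ∈ 𝓝 (x₀, s₀) := by
        refine prod_mem_nhds (Icc_mem_nhds ?_ ?_) (Icc_mem_nhds ?_ ?_)
        · linarith [neg_abs_le x₀, abs_nonneg s₀]
        · linarith [le_abs_self x₀, abs_nonneg s₀]
        · linarith [neg_abs_le s₀, abs_nonneg x₀]
        · linarith [le_abs_self s₀, abs_nonneg x₀]
      filter_upwards [nhdsWithin_le_nhds hn, self_mem_nhdsWithin] with p h1 h2
      exact ⟨h1.1, h2.2, h1.2⟩
    -- The flux formula is known only after the initial time; that time is a null set and is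
    -- dropped.
    · have hae : (Icc (-R) R ×ˢ (timeInterior t₀ ∩ Icc (-R) R) : Set (ℝ × ℝ)) =ᵐ[volume]
          (Icc (-R) R ×ˢ (timeInterval t₀ ∩ Icc (-R) R) : Set (ℝ × ℝ)) :=
        Measure.set_prod_ae_eq (ae_eq_refl _)
          ((timeInterior_ae_eq t₀).inter (ae_eq_refl _))
      refine IntegrableOn.congr_set_ae ?_ hae.symm
      have hmS : MeasurableSet (Icc (-R) R ×ˢ (timeInterior t₀ ∩ Icc (-R) R) : Set (ℝ × ℝ)) :=
        measurableSet_Icc.prod (hio.measurableSet.inter measurableSet_Icc)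
      have hmeas : AEStronglyMeasurable (fun p : ℝ × ℝ => J p.1 p.2)
          (volume.restrict (Icc (-R) R ×ˢ (timeInterior t₀ ∩ Icc (-R) R))) :=
        (hJc.mono (prod_mono (subset_univ _) inter_subset_left)).aestronglyMeasurable hmS
      have hdom : IntegrableOn (fun p : ℝ × ℝ => (1 : ℝ) *
          (|C| * (lam p.2 ^ (m - 2) + R ^ (3 / 2 : ℝ) * lam p.2 ^ (m - 7 / 2))))
          (Icc (-R) R ×ˢ (timeInterior t₀ ∩ Icc (-R) R)) := by
        rw [IntegrableOn, Measure.volume_eq_prod, ← Measure.prod_restrict]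
        refine Integrable.mul_prod (f := fun _ : ℝ => (1 : ℝ)) (g := fun t =>
          |C| * (lam t ^ (m - 2) + R ^ (3 / 2 : ℝ) * lam t ^ (m - 7 / 2)))
          (μ := volume.restrict (Icc (-R) R))
          (ν := volume.restrict (timeInterior t₀ ∩ Icc (-R) R)) ?_ ?_
        · exact integrable_const _
        · exact (hgint R).mono_set (inter_subset_inter_left _ (timeInterior_subset t₀))
      have hJint : IntegrableOn (fun p : ℝ × ℝ => J p.1 p.2)
          (Icc (-R) R ×ˢ (timeInterior t₀ ∩ Icc (-R) R)) := by
        refine Integrable.mono' hdom hmeas ?_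
        filter_upwards [ae_restrict_mem hmS] with p hp
        rw [one_mul]
        exact hJb R hR0 p.1 p.2 (abs_le.2 hp.1) hp.2.1
      exact hJint.congr_fun (fun p hp => (hflux p.1 p.2 hp.2.1).symm) hmS
  · have hw := weak_identity hcont htc hJc hd hJd
      (fun R hR => ⟨_, hgint R, fun x t hx htI _ => hJb R hR x t hx htI⟩) hψ hψc
    have e : ∫ t in timeInterval t₀, ∫ x in {x | 0 < h x t},
        h x t ^ (m / 2) * q x t * deriv (fun z => ψ (z, t)) x
        = ∫ t in timeInterval t₀, ∫ x, J x t * deriv (fun z => ψ (z, t)) x := by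
      refine setIntegral_congr_ae (measurableSet_timeInterval t₀) ?_
      filter_upwards [ae_mem_timeInterior t₀] with t htI ht1
      have htI := htI ht1
      have hset : {x | 0 < h x t} = univ := by
        ext x
        simp only [mem_ofPred_eq, mem_univ, iff_true, hh x t htI]
        exact mul_pos (hpos t htI) (P.pos _)
      rw [hset, setIntegral_univ]
      simp only [hflux _ t htI]
    rw [e]
    exact hw

end IsProfile

end

end ThinFilm

/-! ### The cone as a stationary weak solution. -/

namespace ThinFilm

noncomputable section

theorem measurable_sign : Measurable Real.sign := by
  unfold Real.sign
  exact Measurable.ite measurableSet_Iio measurable_const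
    (Measurable.ite measurableSet_Ioi measurable_const measurable_const)

theorem abs_sign_le_one (x : ℝ) : |Real.sign x| ≤ 1 := by
  rcases Real.sign_apply_eq x with h | h | h <;> rw [h] <;> norm_num

theorem sign_mul_self_eq_abs (x : ℝ) : Real.sign x * x = |x| := by
  rcases lt_trichotomy x 0 with h | h | h
  · rw [Real.sign_of_neg h, abs_of_neg h]; ring
  · simp [h]
  · rw [Real.sign_of_pos h, abs_of_pos h]; ring

section IntegralSign

variable {v v' : ℝ → ℝ} {R : ℝ}

theorem integrable_sign_mul (hv : Continuous v) (hR : ∀ x, R < |x| → v x = 0) :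
    Integrable fun x => Real.sign x * v x :=
  (integrable_of_continuous_of_eq_zero hv hR).bdd_mul measurable_sign.aestronglyMeasurable
    (c := 1) (Eventually.of_forall fun x => abs_sign_le_one x)

/-- The distributional derivative of the sign function is 2δ. -/
theorem integral_sign_mul_deriv (hv : ∀ x, HasDerivAt v (v' x) x) (hc : Continuous v')
    (hR : ∀ x, R < |x| → v x = 0) (hR' : ∀ x, R < |x| → v' x = 0) :
    ∫ x, Real.sign x * v' x = -2 * v 0 := by
  have hi := integrable_sign_mul hc hR'
  have hi' := integrable_of_continuous_of_eq_zero hc hR'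
  have t1 : Tendsto v atTop (𝓝 0) := by
    refine tendsto_const_nhds.congr' ?_
    filter_upwards [eventually_gt_atTop R] with x hx
    exact (hR x (hx.trans_le (le_abs_self x))).symm
  have t2 : Tendsto v atBot (𝓝 0) := by
    refine tendsto_const_nhds.congr' ?_
    filter_upwards [eventually_lt_atBot (-R)] with x hx
    exact (hR x (by linarith [neg_le_abs x])).symm
  rw [← intervalIntegral.integral_Iic_add_Ioi (b := 0) hi.integrableOn hi.integrableOn]
  have e1 : ∫ x in Ioi (0 : ℝ), Real.sign x * v' x = 0 - v 0 := by
    rw [← integral_Ioi_of_hasDerivAt_of_tendsto' (fun x _ => hv x) hi'.integrableOn t1]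
    exact setIntegral_congr_fun measurableSet_Ioi fun x hx => by
      simp [Real.sign_of_pos (mem_Ioi.1 hx)]
  have e2 : ∫ x in Iic (0 : ℝ), Real.sign x * v' x = -(v 0 - 0) := by
    rw [← integral_Iic_of_hasDerivAt_of_tendsto' (fun x _ => hv x) hi'.integrableOn t2,
      integral_Iic_eq_integral_Iio, integral_Iic_eq_integral_Iio, ← integral_neg]
    exact setIntegral_congr_fun measurableSet_Iio fun x hx => by
      simp [Real.sign_of_neg (mem_Iio.1 hx)]
  rw [e1, e2]
  ring

/-- Apply the formula for the sign to x v(x), which vanishes at 0, and use sign(x) x = |x|. -/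
theorem integral_abs_mul_deriv (hv : ∀ x, HasDerivAt v (v' x) x) (hc : Continuous v')
    (hR : ∀ x, R < |x| → v x = 0) (hR' : ∀ x, R < |x| → v' x = 0) :
    ∫ x, |x| * v' x = -∫ x, Real.sign x * v x := by
  have cv : Continuous v := continuous_iff_continuousAt.2 fun y => (hv y).continuousAt
  have h := integral_sign_mul_deriv (R := R) (v := fun x => x * v x) (v' := fun x => v x + x * v' x)
    (fun x => ((hasDerivAt_id x).mul (hv x)).congr_deriv (by simp))
    (cv.add (continuous_id.mul hc)) (fun x hx => by simp [hR x hx])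
    (fun x hx => by simp [hR x hx, hR' x hx])
  have e : (fun x => Real.sign x * (v x + x * v' x)) =
      fun x => Real.sign x * v x + |x| * v' x := by
    funext x
    rw [← sign_mul_self_eq_abs]
    ring
  have ci : Integrable fun x => |x| * v' x :=
    integrable_of_continuous_of_eq_zero (continuous_abs.mul hc) (R := R)
      (fun x hx => by simp [hR' x hx])
  rw [e, integral_add (integrable_sign_mul cv hR) ci] at h
  linarith

end IntegralSign

theorem hasWeakDeriv_cone (a : ℝ) :
    HasWeakDeriv (fun x => a * |x|) fun x => a * Real.sign x := by
  refine ⟨(locallyIntegrable_const (|a|)).mono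
    (measurable_sign.const_mul a).aestronglyMeasurable (Eventually.of_forall fun x => ?_),
    fun φ hφ hc => ?_⟩
  · simp only [Real.norm_eq_abs, abs_mul, abs_abs]
    exact mul_le_of_le_one_right (abs_nonneg a) (abs_sign_le_one x)
  · obtain ⟨φ₁, φ₂, R, d1, d2, -, -, hz⟩ := exists_three_derivs hφ hc
    have h := integral_abs_mul_deriv d1
      (continuous_iff_continuousAt.2 fun y => (d2 y).continuousAt) (fun x hx => (hz x hx).1)
      (fun x hx => (hz x hx).2.1)
    have e : deriv φ = φ₁ := funext fun x => (d1 x).deriv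
    simp only [e, mul_assoc, integral_const_mul, h, mul_neg]

/-- The third derivative of a|x| is 2aδ', of order 1. For m > 2 the weight (a|x|)^(m/2) is C¹, and
it vanishes with its derivative at 0, so the product is zero. -/
theorem isWeightedThirdDeriv_cone {m a : ℝ} (hm : 2 < m) (ha : 0 < a) :
    IsWeightedThirdDeriv m (fun x => a * |x|) fun _ => 0 := by
  have hg0 : ContDiff ℝ 1 (fun x : ℝ => (a * |x|) ^ (m / 2)) := by
    have h := (contDiff_norm_rpow (E := ℝ) (p := m / 2) (by linarith)).const_smul (a ^ (m / 2))
    convert h using 1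
    funext x
    rw [Real.mul_rpow ha.le (abs_nonneg x)]
    rfl
  have hg : ContDiff ℝ ((1 : ℕ) : ℕ∞ω) (fun x : ℝ => (a * |x|) ^ (m / 2)) := by
    exact_mod_cast hg0
  let D : 𝓓'^{((1 : ℕ) : ℕ∞)}((⊤ : TopologicalSpace.Opens ℝ), ℝ) :=
    Distribution.lineDerivCLM (k := 0) (1 : ℝ) (Distribution.delta 0)
  have hD : ∀ φ, ((2 * a) • D) φ = -(2 * a) * deriv φ 0 := by
    intro φ
    change (2 * a) • (D φ) = _
    rw [Distribution.lineDerivCLM_apply, Distribution.delta_apply,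
      TestFunction.lineDerivCLM_apply_of_le (by simp), smul_eq_mul]
    rw [show lineDeriv ℝ φ 0 1 = deriv φ 0 by simp [lineDeriv]]
    ring
  refine ⟨1, hg, (2 * a) • D, fun φ hφ => ?_, fun φ hφ => ?_⟩
  · obtain ⟨φ₁, φ₂, R, d1, d2, d3, hc3, hz⟩ := exists_three_derivs hφ φ.hasCompactSupport
    rw [hD, (d1 0).deriv]
    simp only [mul_assoc, integral_const_mul]
    rw [integral_abs_mul_deriv d3 hc3 (fun x hx => (hz x hx).2.2.1) (fun x hx => (hz x hx).2.2.2),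
      integral_sign_mul_deriv d2 (continuous_iff_continuousAt.2 fun y => (d3 y).continuousAt)
        (fun x hx => (hz x hx).2.1) (fun x hx => (hz x hx).2.2.1)]
    ring
  · rw [hD]
    have g0 : (a * |(0 : ℝ)|) ^ (m / 2) = 0 := by
      rw [abs_zero, mul_zero, Real.zero_rpow (by linarith)]
    -- The origin is a minimum of the weight.
    have g1 : deriv (fun x : ℝ => (a * |x|) ^ (m / 2)) 0 = 0 := by
      refine IsLocalMin.deriv_eq_zero (Eventually.of_forall fun x => ?_)
      simp only [g0]
      positivity
    have e : deriv (fun x => (a * |x|) ^ (m / 2) * φ x) 0 = 0 := by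
      rw [deriv_fun_mul (hg0.differentiable (by norm_num) 0)
        (hφ.differentiable (by simp) 0), g0, g1]
      ring
    change -(2 * a) * deriv (fun x => (a * |x|) ^ (m / 2) * φ x) 0 = _
    rw [e]
    simp

theorem isWeakSolution_cone {m a : ℝ} (hm : 2 < m) (ha : 0 < a) (t₀ : WithBot ℝ) :
    IsWeakSolution m t₀ fun x _ => a * |x| := by
  have hcont : ContinuousOn (fun p : ℝ × ℝ => a * |p.1|) (univ ×ˢ timeInterval t₀) :=
    (continuous_const.mul continuous_fst.abs).continuousOn
  refine ⟨hcont, fun x _ _ => by positivity, fun T R => ?_, fun _ _ => 0,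
    Eventually.of_forall fun t _ => ⟨MemLp.zero, isWeightedThirdDeriv_cone hm ha⟩, ?_,
    fun ψ hψ hψc => ?_⟩
  · refine ⟨∫ x in Icc (-R) R, ((a * |x|) ^ 2 + (a * Real.sign x) ^ 2),
      Eventually.of_forall fun t _ _ => ⟨_, hasWeakDeriv_cone a, ?_, le_rfl⟩⟩
    refine MemLp.of_bound (measurable_sign.const_mul a).aestronglyMeasurable (|a|)
      (Eventually.of_forall fun x => ?_)
    rw [Real.norm_eq_abs, abs_mul]
    exact mul_le_of_le_one_right (abs_nonneg a) (abs_sign_le_one x)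
  · simp only [mul_zero]
    exact (locallyIntegrable_const (0 : ℝ)).locallyIntegrableOn _
  · have h := weak_identity (t₀ := t₀) (h := fun x _ => a * |x|) (ht := fun _ _ => 0)
      (J := fun _ _ => 0) hcont continuousOn_const continuousOn_const
      (fun x t _ => hasDerivAt_const _ _) (fun x t _ => by simpa using hasDerivAt_const x (0 : ℝ))
      (fun R hR => ⟨fun _ => 0, integrableOn_zero, fun _ _ _ _ _ => by simp⟩) hψ hψc
    simpa using h

end

end ThinFilm

/-! ### Lifting of the cone at time zero for exponents below four. -/

namespace ThinFilm

noncomputable section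

/-- Profiles of every slope and every rate for mobilities below the scale-invariant exponent. -/
theorem exists_isProfile {m b a : ℝ} (hm : 0 < m) (hm4 : m < 4) (hb : 0 < b) (ha : 0 < a) :
    ∃ f f₁ f₂ F : ℝ → ℝ, IsProfile m b a f f₁ f₂ F := by
  obtain ⟨p, f, f₁, w, F, hp, T, hN⟩ := exists_nonEscaping hm
  obtain ⟨a₀, ha₀, -, hC⟩ := T.exists_quot_limit hN hp
  have P := T.isProfile hN hp hC
  set c := a / a₀ with hc
  have hc0 : 0 < c := div_pos ha ha₀
  -- With A = c L the slope becomes a for any L. The rate (c L)^m / L⁴ equals b exactly when L^(4-m)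
  -- = c^m / b, which is solvable because m ≠ 4.
  set L := (c ^ m / b) ^ (1 / (4 - m)) with hL
  have hL0 : 0 < L := by positivity
  have hLp : L ^ (4 - m) = c ^ m / b := by
    rw [hL, ← Real.rpow_mul (by positivity), one_div_mul_cancel (by linarith), Real.rpow_one]
  have hL4 : L ^ 4 = L ^ m * (c ^ m / b) := by
    rw [← hLp, ← Real.rpow_add hL0]
    norm_num
  have e1 : (c * L) ^ m / L ^ 4 * 1 = b := by
    rw [hL4, Real.mul_rpow hc0.le hL0.le]
    have := (Real.rpow_pos_of_pos hL0 m).ne'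
    have := (Real.rpow_pos_of_pos hc0 m).ne'
    field_simp
  have e2 : c * L / L * a₀ = a := by
    rw [hc]
    field_simp
  have Q := P.scale (A := c * L) (L := L) (by positivity) hL0
  rw [e1, e2] at Q
  exact ⟨_, _, _, _, Q⟩

namespace IsProfile

variable {m b a : ℝ} {f f₁ f₂ F : ℝ → ℝ}

/-- The rescaled form of the slope estimate. The right side tends to 0 with the scale, locally
uniformly in x, which yields the initial data. -/
theorem exists_abs_scaled_sub_le (P : IsProfile m b a f f₁ f₂ F) :
    ∃ C, 0 ≤ C ∧ ∀ l x, 0 < l → |l * f (x / l) - (a * |x|)| ≤ C * (l + √(l * |x|)) := by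
  obtain ⟨C, hC⟩ := P.slope
  refine ⟨|C|, abs_nonneg C, fun l x hl => ?_⟩
  have h := hC (x / l)
  rw [abs_div, abs_of_pos hl] at h
  have e : l * f (x / l) - a * |x| = l * (f (x / l) - a * (|x| / l)) := by
    field_simp
  have hs : √(l * |x|) = l * √(|x| / l) := by
    rw [show l * |x| = l ^ 2 * (|x| / l) by field_simp, Real.sqrt_mul (by positivity),
      Real.sqrt_sq hl.le]
  rw [e, abs_mul, abs_of_pos hl, hs]
  calc l * |f (x / l) - a * (|x| / l)| ≤ l * (|C| * (1 + √(|x| / l))) := by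
        refine mul_le_mul_of_nonneg_left (h.trans ?_) hl.le
        exact mul_le_mul_of_nonneg_right (le_abs_self C) (by positivity)
    _ = |C| * (l + l * √(|x| / l)) := by ring

theorem eval_abs (P : IsProfile m b a f f₁ f₂ F) (y : ℝ) : f (|y|) = f y := by
  rcases abs_choice y with h | h <;> rw [h]
  exact P.even y

theorem eval_abs_div (P : IsProfile m b a f f₁ f₂ F) (x : ℝ) {l : ℝ} (hl : 0 < l) :
    f (|x| / l) = f (x / l) := by
  rw [← P.eval_abs (x / l), abs_div, abs_of_pos hl]

end IsProfile

/-- The self-similar solution with profile `f` and scale `t ^ α`, started from the cone. -/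
def coneLift (α a : ℝ) (f : ℝ → ℝ) (x t : ℝ) : ℝ :=
  if t ≤ 0 then a * |x| else t ^ α * f (x / t ^ α)

theorem coneLift_of_pos {α a : ℝ} {f : ℝ → ℝ} (x : ℝ) {t : ℝ} (ht : 0 < t) :
    coneLift α a f x t = t ^ α * f (x / t ^ α) := if_neg ht.not_ge

theorem coneLift_of_nonpos {α a : ℝ} {f : ℝ → ℝ} (x : ℝ) {t : ℝ} (ht : t ≤ 0) :
    coneLift α a f x t = a * |x| := if_pos ht

namespace IsProfile

variable {m b a : ℝ} {f f₁ f₂ F : ℝ → ℝ} {α : ℝ}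

theorem continuousOn_coneLift (P : IsProfile m b a f f₁ f₂ F) (hα : 0 < α) :
    ContinuousOn (fun p : ℝ × ℝ => coneLift α a f p.1 p.2) (univ ×ˢ Ici 0) := by
  rintro ⟨x, t⟩ ⟨-, ht⟩
  rcases (mem_Ici.1 ht).eq_or_lt with h | h
  · change (0 : ℝ) = t at h
    subst h
    obtain ⟨C, hC, hb⟩ := P.exists_abs_scaled_sub_le
    have hcα : Continuous fun t : ℝ => t ^ α := Real.continuous_rpow_const hα.le
    have hgc : Continuous fun p : ℝ × ℝ => C * (p.2 ^ α + √(p.2 ^ α * |p.1|)) := by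
      have := hcα.comp (continuous_snd (X := ℝ) (Y := ℝ))
      exact continuous_const.mul (this.add ((this.mul continuous_fst.abs).sqrt))
    have hg : Tendsto (fun p : ℝ × ℝ => C * (p.2 ^ α + √(p.2 ^ α * |p.1|)))
        (𝓝[univ ×ˢ Ici 0] (x, 0)) (𝓝 0) := by
      have := hgc.tendsto (x, 0)
      simp only [Real.zero_rpow hα.ne', zero_mul, Real.sqrt_zero, add_zero, mul_zero] at this
      exact this.mono_left nhdsWithin_le_nhds
    have hd : Tendsto (fun p : ℝ × ℝ => coneLift α a f p.1 p.2 - a * |p.1|)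
        (𝓝[univ ×ˢ Ici 0] (x, 0)) (𝓝 0) := by
      refine squeeze_zero_norm' ?_ hg
      filter_upwards [self_mem_nhdsWithin] with p hp
      rcases (mem_Ici.1 hp.2).eq_or_lt with h0 | h0
      · rw [coneLift_of_nonpos _ h0.symm.le, sub_self, norm_zero]
        have := Real.rpow_nonneg (mem_Ici.1 hp.2) α
        positivity
      · rw [coneLift_of_pos _ h0]
        exact hb _ _ (Real.rpow_pos_of_pos h0 α)
    have hc : Tendsto (fun p : ℝ × ℝ => a * |p.1|) (𝓝[univ ×ˢ Ici 0] (x, 0)) (𝓝 (a * |x|)) :=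
      ((continuous_const.mul continuous_fst.abs).tendsto (x, (0 : ℝ))).mono_left nhdsWithin_le_nhds
    have := hd.add hc
    simp only [sub_add_cancel, zero_add] at this
    rw [ContinuousWithinAt, coneLift_of_nonpos _ le_rfl]
    exact this
  · change (0 : ℝ) < t at h
    refine ContinuousAt.continuousWithinAt ?_
    have h1 : ContinuousAt (fun p : ℝ × ℝ => p.2 ^ α) (x, t) :=
      (Real.continuous_rpow_const hα.le).continuousAt.comp continuousAt_snd
    have h2 : ContinuousAt (fun p : ℝ × ℝ => p.2 ^ α * f (p.1 / p.2 ^ α)) (x, t) :=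
      h1.mul (P.continuous_f.continuousAt.comp
        (continuousAt_fst.div h1 (Real.rpow_pos_of_pos h α).ne'))
    refine h2.congr ?_
    filter_upwards [continuousAt_snd.eventually (lt_mem_nhds h)] with p hp
    exact (coneLift_of_pos p.1 hp).symm

theorem coneLift_nonneg (P : IsProfile m b a f f₁ f₂ F) (ha : 0 < a) (x t : ℝ) :
    0 ≤ coneLift α a f x t := by
  rcases le_or_gt t 0 with h | h
  · rw [coneLift_of_nonpos x h]
    positivity
  · rw [coneLift_of_pos x h]
    exact mul_nonneg (Real.rpow_nonneg h.le α) (P.pos _).le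

/-- With α = 1/(4-m) the flux majorants are t^(α(m-2)) and t^(α(m-7/2)). Both exponents exceed -1,
since α(m-4) = -1, so they are integrable at t = 0. -/
theorem isWeakSolution_coneLift (hm4 : m < 4) (ha : 0 < a)
    (P : IsProfile m (1 / (4 - m)) a f f₁ f₂ F) :
    IsWeakSolution m ((0 : ℝ) : WithBot ℝ) (coneLift (1 / (4 - m)) a f) := by
  set α := 1 / (4 - m) with hα
  have hα0 : 0 < α := one_div_pos.2 (by linarith)
  have hαm : α * (4 - m) = 1 := one_div_mul_cancel (by linarith)
  have hint : ∀ c, -1 < α * c → ∀ R, IntegrableOn (fun t : ℝ => (t ^ α) ^ c)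
      (timeInterval ((0 : ℝ) : WithBot ℝ) ∩ Icc (-R) R) := by
    intro c hc R
    rcases le_or_gt 0 R with hR | hR
    · have h := (intervalIntegral.intervalIntegrable_rpow' (a := 0) (b := R) hc).1
      have e : Ici (0 : ℝ) ∩ Icc (-R) R = Icc 0 R := by
        ext t
        simp only [mem_inter_iff, mem_Ici, mem_Icc]
        exact ⟨fun h => ⟨h.1, h.2.2⟩, fun h => ⟨h.1, by linarith [h.1], h.2⟩⟩
      rw [timeInterval_coe, e, integrableOn_Icc_iff_integrableOn_Ioc]
      refine h.congr_fun (fun t ht => ?_) measurableSet_Ioc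
      exact Real.rpow_mul ht.1.le α c
    · rw [Icc_eq_empty (by linarith), inter_empty]
      exact integrableOn_empty
  have hpos : ∀ t ∈ timeInterior ((0 : ℝ) : WithBot ℝ), 0 < t := by
    intro t ht
    rwa [timeInterior_coe] at ht
  refine P.isWeakSolution (lam := fun t => t ^ α)
    (fun t ht => Real.rpow_pos_of_pos (hpos t ht) α) (fun t ht => ?_)
    (fun x t ht => coneLift_of_pos x (hpos t ht)) ?_ (fun x t _ => P.coneLift_nonneg ha x t)
    (fun T => ⟨|T| ^ α, fun t ht htT => ?_⟩) (hint _ (by nlinarith)) (hint _ (by nlinarith))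
  · have h0 := hpos t ht
    refine (Real.hasDerivAt_rpow_const (Or.inl h0.ne')).congr_deriv ?_
    rw [← Real.rpow_mul h0.le, show α * (m - 3) = α - 1 by linarith]
  · rw [timeInterval_coe]
    exact P.continuousOn_coneLift hα0
  · exact Real.rpow_le_rpow (hpos t ht).le (htT.trans (le_abs_self T)) hα0.le

theorem hasInitialData_coneLift (P : IsProfile m b a f f₁ f₂ F) (hα : 0 < α) :
    HasInitialData ((0 : ℝ) : WithBot ℝ) (coneLift α a f) fun x => a * |x| := by
  intro x
  change Tendsto _ (𝓝[>] (0 : ℝ)) _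
  have h := P.continuousOn_coneLift hα (x, 0) ⟨mem_univ x, mem_Ici.2 le_rfl⟩
  rw [ContinuousWithinAt, coneLift_of_nonpos _ le_rfl] at h
  refine Tendsto.comp (f := fun t : ℝ => (x, t)) h (tendsto_nhdsWithin_iff.2 ⟨?_, ?_⟩)
  · exact ((continuous_const.prodMk continuous_id).tendsto (0 : ℝ)).mono_left nhdsWithin_le_nhds
  · filter_upwards [self_mem_nhdsWithin] with t ht
    exact ⟨mem_univ _, (mem_Ioi.1 ht).le⟩

end IsProfile

/-- For mobility exponents in `(0, 4)` the cone is lifted instantaneously. -/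
theorem exists_coneLift {m a : ℝ} (hm : 0 < m) (hm4 : m < 4) (ha : 0 < a) :
    ∃ (h : ℝ → ℝ → ℝ) (f : ℝ → ℝ),
      IsWeakSolution m ((0 : ℝ) : WithBot ℝ) h ∧
      HasInitialData ((0 : ℝ) : WithBot ℝ) h (fun x => a * |x|) ∧
      (∀ y : ℝ, 0 ≤ y → 0 < f y) ∧
      ∀ x t : ℝ, 0 < t → h x t = t ^ (1 / (4 - m)) * f (|x| / t ^ (1 / (4 - m))) := by
  have hα : 0 < 1 / (4 - m) := one_div_pos.2 (by linarith)
  obtain ⟨f, f₁, f₂, F, P⟩ := exists_isProfile hm hm4 hα ha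
  refine ⟨coneLift (1 / (4 - m)) a f, f, P.isWeakSolution_coneLift hm4 ha,
    P.hasInitialData_coneLift hα, fun y _ => P.pos y, fun x t ht => ?_⟩
  rw [coneLift_of_pos x ht, P.eval_abs_div x (Real.rpow_pos_of_pos ht _)]

end

end ThinFilm

namespace ThinFilm

noncomputable section

/-! ### The slope of the profile at infinity for mobility exponent four -/

/-- Maximization of a quadratic in g. The maximum is at g = x - 2 for x ≤ 2, at g = (2 - x)/2 for 2
≤ x ≤ 4, and at g = -1 for x ≥ 4. The constant 7/10 is slightly above the largest excess, attained
near x = 1.9. -/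
theorem mul_le_of_constraints {x g : ℝ} (hx : 1 ≤ x) (hg : -1 ≤ g) (hg' : g ≤ x - 2) :
    (x + g) * (2 - g) / 3 ≤ x - 1 + 7 / 10 / x := by
  have hx0 : 0 < x := by linarith
  have key : (x + g) * (2 - g) / 3 * x ≤ (x - 1) * x + 7 / 10 := by
    rcases le_total x 2 with h | h
    · have h1 : (x + g) * (2 - g) ≤ (2 * x - 2) * (4 - x) := by
        nlinarith [mul_nonneg (sub_nonneg.2 hg') (by linarith : (0 : ℝ) ≤ 4 - 2 * x),
          sq_nonneg (x - 2 - g)]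
      have h2 : 0 ≤ 2 * x ^ 3 - 7 * x ^ 2 + 5 * x + 21 / 10 := by
        nlinarith [mul_nonneg hx0.le (sq_nonneg (x - 19 / 10)), sq_nonneg (x - 19 / 10)]
      nlinarith [mul_le_mul_of_nonneg_right h1 hx0.le]
    · rcases le_total x 4 with h4 | h4
      · have h1 : (x + g) * (2 - g) ≤ (x + 2) ^ 2 / 4 := by nlinarith [sq_nonneg (x - 2 + 2 * g)]
        have h2 : x * (x - 4) ^ 2 ≤ 8 := by
          nlinarith [mul_nonneg (sub_nonneg.2 h) (sub_nonneg.2 h4),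
            mul_nonneg (mul_nonneg (sub_nonneg.2 h) (sub_nonneg.2 h4)) hx0.le]
        nlinarith [mul_le_mul_of_nonneg_right h1 hx0.le]
      · have h1 : (x + g) * (2 - g) ≤ 3 * (x - 1) := by
          nlinarith [mul_nonneg (by linarith : (0 : ℝ) ≤ g + 1) (by linarith : (0 : ℝ) ≤ x - 4),
            mul_nonneg (by linarith : (0 : ℝ) ≤ g + 1) (by linarith : (0 : ℝ) ≤ g + 1)]
        nlinarith [mul_le_mul_of_nonneg_right h1 hx0.le]
  rw [show x - 1 + 7 / 10 / x = ((x - 1) * x + 7 / 10) / x by field_simp, le_div_iff₀ hx0]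
  exact key

/-- An antiderivative of `(x - 1) (x - 1 + 7 / (10 x)) / (2 x ^ 4)` that vanishes at infinity. -/
def slopePotential (x : ℝ) : ℝ :=
  (-x ^ 3 + x ^ 2 - 17 / 30 * x + 7 / 40) / (2 * x ^ 4)

theorem hasDerivAt_slopePotential {x : ℝ} (hx : 0 < x) :
    HasDerivAt slopePotential ((x - 1) * (x - 1 + 7 / 10 / x) / (2 * x ^ 4)) x := by
  have h1 : HasDerivAt (fun x : ℝ => -x ^ 3 + x ^ 2 - 17 / 30 * x + 7 / 40)
      (-(3 * x ^ 2) + 2 * x - 17 / 30) x := by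
    have := ((((hasDerivAt_pow 3 x).neg.add (hasDerivAt_pow 2 x)).sub
      ((hasDerivAt_id x).const_mul (17 / 30 : ℝ))).add_const (7 / 40 : ℝ))
    exact this.congr_deriv (by norm_num)
  have h2 : HasDerivAt (fun x : ℝ => 2 * x ^ 4) (8 * x ^ 3) x :=
    ((hasDerivAt_pow 4 x).const_mul 2).congr_deriv (by norm_num; ring)
  refine (h1.div h2 (by positivity)).congr_deriv ?_
  field_simp
  ring

theorem slopePotential_nonpos {x : ℝ} (hx : 1 ≤ x) : slopePotential x ≤ 0 := by
  refine div_nonpos_of_nonpos_of_nonneg ?_ (by positivity)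
  nlinarith [mul_nonneg (sub_nonneg.2 hx) (sq_nonneg x)]

theorem slopePotential_one : slopePotential 1 = -(47 / 240) := by
  norm_num [slopePotential]

namespace IsTrajectory

variable {p : ℝ} {f f₁ w F : ℝ → ℝ}

/-- In the derivative of the left side the terms f₁³ w cancel, leaving a nonpositive term plus f₁²
(-F)(f - 1)/(2f⁴). The phase estimates give -F f₁ ≤ (f + G)(2 - G)/3 with -1 ≤ G ≤ f - 2, hence a
bound by a function of f times f₁, that is, by the derivative of `slopePotential` along f. Its total
increase from f = 1 to infinity is 47/240. -/
theorem slope_pow_four_le (T : IsTrajectory 4 p f f₁ w F) {t : ℝ} (ht : 0 ≤ t)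
    (h : ∀ y ∈ Icc 0 t, 0 ≤ w y ∧ F y ≤ 0) :
    f₁ t ^ 4 / 8 - f₁ t ^ 2 * w t * (f t - 1) / 2 ≤ 47 / 240 := by
  have hZ : ∀ y, HasDerivAt (fun y => f₁ y ^ 4 / 8 - f₁ y ^ 2 * w y * (f y - 1) / 2)
      (-(f₁ y * w y ^ 2 * (f y - 1)) - f₁ y ^ 2 * (cutMobility 4 (f y) * F y) * (f y - 1) / 2)
      y := by
    intro y
    have := ((((T.hf₁ y).pow 4).div_const 8).sub
      (((((T.hf₁ y).pow 2).mul (T.hw y)).mul ((T.hf y).sub_const 1)).div_const 2))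
    refine this.congr_deriv ?_
    norm_num
    ring
  have hK : ∀ y ∈ Icc 0 t, HasDerivAt (fun y => slopePotential (f y))
      ((f y - 1) * (f y - 1 + 7 / 10 / f y) / (2 * f y ^ 4) * f₁ y) y := fun y hy =>
    (hasDerivAt_slopePotential (by linarith [(T.phase_estimates h hy).2.1])).comp y (T.hf y)
  have key := sub_le_sub_of_hasDerivAt_le ht (fun y _ => hZ y) hK fun y hy => by
    have hy' := Ioo_subset_Icc_self hy
    obtain ⟨e1, e2, e3, e4, e5⟩ := T.phase_estimates h hy'
    obtain ⟨e6, e7⟩ := h y hy'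
    have hr : cutMobility 4 (f y) = (f y ^ 4)⁻¹ := by
      rw [cutMobility_of_one_le e2, Real.rpow_neg (by linarith)]
      norm_cast
    have hf4 : 0 < f y ^ 4 := by positivity
    have h1 : -F y * f₁ y ≤ f y - 1 + 7 / 10 / f y := by
      refine le_trans ?_ (mul_le_of_constraints e2 e4 (by linarith))
      nlinarith [mul_nonneg e5 e1]
    have h2 : 0 ≤ f₁ y * w y ^ 2 * (f y - 1) :=
      mul_nonneg (mul_nonneg e1 (sq_nonneg _)) (by linarith)
    have h3 : -(f₁ y ^ 2 * (cutMobility 4 (f y) * F y) * (f y - 1) / 2) =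
        (f y - 1) * (-F y * f₁ y) / (2 * f y ^ 4) * f₁ y := by
      rw [hr]
      field_simp
    have h4 : (f y - 1) * (-F y * f₁ y) / (2 * f y ^ 4) * f₁ y ≤
        (f y - 1) * (f y - 1 + 7 / 10 / f y) / (2 * f y ^ 4) * f₁ y := by
      have : 0 ≤ f y - 1 := by linarith
      gcongr
    linarith
  have e2 := (T.phase_estimates h (right_mem_Icc.2 ht)).2.1
  have k0 := slopePotential_nonpos e2
  simp only [T.f_zero, T.f₁_zero, slopePotential_one] at key
  norm_num at key
  linarith

/-- If the convex phase ends at t, then w(t) = 0 and the later chord slopes do not exceed f₁(t). If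
it never ends, then f₁ → a and the term containing w vanishes in the limit. -/
theorem quot_limit_pow_four_le (T : IsTrajectory 4 p f f₁ w F) (hN : NonEscaping f f₁ w F)
    (hp : 0 < p) {a : ℝ} (ha0 : 0 < a) (ha : Tendsto (fun y => f y / y) atTop (𝓝 a)) :
    a ^ 4 ≤ 47 / 30 := by
  rcases T.phase_dichotomy hN hp with h | ⟨t, ht, hw, hG, h⟩
  · have hall : ∀ t, ∀ y ∈ Icc 0 t, 0 ≤ w y ∧ F y ≤ 0 := by
      intro t y hy
      rcases eq_or_lt_of_le hy.1 with h0 | h0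
      · rw [← h0, T.w_zero, T.F_zero]; exact ⟨hp.le, le_rfl⟩
      · exact ⟨(h y h0).1.le, (h y h0).2.le⟩
    have hw0 : ∀ y, 0 ≤ y → 0 ≤ w y := fun y hy => (hall y y (right_mem_Icc.2 hy)).1
    have hmono : ∀ x y, 0 ≤ x → x ≤ y → f₁ x ≤ f₁ y := fun x y hx hxy =>
      le_of_hasDerivAt_nonneg hxy (fun z _ => T.hf₁ z) fun z hz => hw0 z (hx.trans hz.1.le)
    have hanti : ∀ x y, 0 ≤ x → x ≤ y → w y ≤ w x := fun x y hx hxy => by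
      have := le_of_hasDerivAt_nonneg hxy (fun z _ => (T.hw z).neg) fun z hz =>
        neg_nonneg.2 (mul_nonpos_of_nonneg_of_nonpos (cutMobility_pos 4 (f z)).le
          (hall z z (right_mem_Icc.2 (hx.trans hz.1.le))).2)
      simpa using this
    have hup : ∀ x, 0 ≤ x → f₁ x ≤ a := by
      intro x hx
      have hlin : ∀ᶠ y in atTop, f₁ x + (f x - f₁ x * x) / y ≤ f y / y := by
        filter_upwards [eventually_gt_atTop x, eventually_gt_atTop 0] with y hy hy0
        have := sub_le_sub_of_hasDerivAt_le hy.le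
          (fun z _ => (hasDerivAt_id z).const_mul (f₁ x)) (fun z _ => T.hf z)
          (fun z hz => by simpa using hmono x z hx hz.1.le)
        simp only [id] at this
        rw [le_div_iff₀ hy0, add_mul, div_mul_cancel₀ _ hy0.ne']
        linarith
      have hl : Tendsto (fun y : ℝ => f₁ x + (f x - f₁ x * x) / y) atTop (𝓝 (f₁ x + 0)) :=
        tendsto_const_nhds.add (tendsto_const_nhds.div_atTop tendsto_id)
      simpa using le_of_tendsto_of_tendsto hl ha hlin
    have hlow : ∀ y, 0 < y → f y / y - 1 / y ≤ f₁ y := by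
      intro y hy
      have := sub_le_sub_of_hasDerivAt_le hy.le (fun z _ => T.hf z)
        (fun z _ => (hasDerivAt_id z).const_mul (f₁ y))
        (fun z hz => by simpa using hmono z y hz.1.le hz.2.le)
      simp only [id, T.f_zero] at this
      rw [← sub_div, div_le_iff₀ hy]
      linarith
    have l1 : Tendsto f₁ atTop (𝓝 a) := by
      have h1 : Tendsto (fun y : ℝ => f y / y - 1 / y) atTop (𝓝 (a - 0)) :=
        ha.sub (tendsto_const_nhds.div_atTop tendsto_id)
      rw [sub_zero] at h1
      refine tendsto_of_tendsto_of_tendsto_of_le_of_le' h1 tendsto_const_nhds ?_ ?_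
      · filter_upwards [eventually_gt_atTop 0] with y hy using hlow y hy
      · filter_upwards [eventually_ge_atTop 0] with y hy using hup y hy
    -- As w decreases, y w(y)/2 is at most the increment of f₁ over [y/2, y], which tends to 0.
    have l2 : Tendsto (fun y => y * w y) atTop (𝓝 0) := by
      have h1 : Tendsto (fun y : ℝ => 2 * (f₁ y - f₁ (y / 2))) atTop (𝓝 (2 * (a - a))) :=
        (l1.sub (l1.comp (tendsto_id.atTop_div_const (by norm_num)))).const_mul 2
      rw [sub_self, mul_zero] at h1
      refine tendsto_of_tendsto_of_tendsto_of_le_of_le' tendsto_const_nhds h1 ?_ ?_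
      · filter_upwards [eventually_ge_atTop 0] with y hy using mul_nonneg hy (hw0 y hy)
      · filter_upwards [eventually_ge_atTop 0] with y hy
        have := sub_le_sub_of_hasDerivAt_le (by linarith : y / 2 ≤ y)
          (fun z _ => (hasDerivAt_id z).const_mul (w y)) (fun z _ => T.hf₁ z)
          (fun z hz => by simpa using hanti z y (by linarith [hz.1]) hz.2.le)
        simp only [id] at this
        linarith
    have l3 : Tendsto (fun y => f₁ y ^ 4 / 8 - f₁ y ^ 2 * ((y * w y) * (f y / y)) / 2 +
        f₁ y ^ 2 * ((y * w y) * (1 / y)) / 2) atTop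
        (𝓝 (a ^ 4 / 8 - a ^ 2 * (0 * a) / 2 + a ^ 2 * (0 * 0) / 2)) :=
      (((l1.pow 4).div_const 8).sub (((l1.pow 2).mul (l2.mul ha)).div_const 2)).add
        (((l1.pow 2).mul (l2.mul (tendsto_const_nhds.div_atTop tendsto_id))).div_const 2)
    have := le_of_tendsto l3 (b := 47 / 240) (by
      filter_upwards [eventually_gt_atTop 0] with y hy
      refine le_trans (le_of_eq ?_) (T.slope_pow_four_le hy.le (hall y))
      field_simp
      ring)
    linarith
  · have h1 := T.slope_pow_four_le ht.le h
    rw [hw] at h1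
    have h2 : a ≤ f₁ t := by
      refine le_of_tendsto ha ?_
      filter_upwards [eventually_ge_atTop t] with Y hY
      have := (abs_le.1 (T.abs_quot_sub_le_of_phase hN ht hw hG hY)).2
      have e : (t * f₁ t - f t) / t = f₁ t - f t / t := by field_simp
      linarith
    have h3 : a ^ 4 ≤ f₁ t ^ 4 := pow_le_pow_left₀ ha0.le h2 4
    linarith

end IsTrajectory

end

end ThinFilm

namespace ThinFilm

noncomputable section

/-! ### The characteristic polynomial -/

/-- The roots `z₁` and `-μ ± i ν` of `(z ^ 2 - 1) (z + 2) = β`. -/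
structure IsRootData (β z₁ μ ν : ℝ) : Prop where
  one_lt : 1 < z₁
  lt_mu : 3 / 2 < μ
  nu_pos : 0 < ν
  two_mu : 2 * μ = 2 + z₁
  four_nu_sq : 4 * ν ^ 2 = 3 * z₁ ^ 2 + 4 * z₁ - 8
  eq : β = (z₁ ^ 2 - 1) * (z₁ + 2)

/-- The positive root z₁ exists by the intermediate value theorem, and dividing it out leaves a
quadratic. The lower bound on β makes its discriminant negative; the cubic has three real roots for
β below about 0.631, so there is little room. -/
theorem exists_isRootData {β : ℝ} (hβ : 30 / 47 ≤ β) : ∃ z₁ μ ν, IsRootData β z₁ μ ν := by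
  have hc : ContinuousOn (fun z : ℝ => (z ^ 2 - 1) * (z + 2)) (Icc 1 (1 + β)) := by fun_prop
  have hmem : β ∈ Icc (((1 : ℝ) ^ 2 - 1) * (1 + 2)) (((1 + β) ^ 2 - 1) * ((1 + β) + 2)) := by
    refine ⟨by linarith, ?_⟩
    nlinarith [mul_nonneg (by linarith : 0 ≤ β) (by linarith : 0 ≤ β),
      mul_nonneg (mul_nonneg (by linarith : 0 ≤ β) (by linarith : 0 ≤ β)) (by linarith : 0 ≤ β)]
  obtain ⟨z, hz, hzβ⟩ := intermediate_value_Icc (by linarith) hc hmem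
  change (z ^ 2 - 1) * (z + 2) = β at hzβ
  -- The discriminant condition 3z² + 4z - 8 > 0 holds for z above about 1.0972, while at 1.0975 the
  -- cubic is still below 30/47.
  have hz1 : 10975 / 10000 < z := by
    by_contra! h
    have h1 := hz.1
    nlinarith [mul_le_mul (by nlinarith : z ^ 2 - 1 ≤ (10975 / 10000) ^ 2 - 1)
      (by linarith : z + 2 ≤ 10975 / 10000 + 2) (by linarith) (by norm_num)]
  have hν : 0 < (3 * z ^ 2 + 4 * z - 8) / 4 := by nlinarith
  refine ⟨z, (2 + z) / 2, √((3 * z ^ 2 + 4 * z - 8) / 4), by linarith, by linarith,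
    Real.sqrt_pos.2 hν, by ring, ?_, hzβ.symm⟩
  rw [Real.sq_sqrt hν.le]
  ring

theorem IsRootData.isLeadingRoot {β z₁ μ ν : ℝ} (h : IsRootData β z₁ μ ν) :
    IsLeadingRoot β ⟨-μ, ν⟩ := by
  have hfac : ∀ z : ℂ, (1 - z ^ 2) * (2 + z) + (β : ℂ) =
      -((z - z₁) * ((z + μ - ν * Complex.I) * (z + μ + ν * Complex.I))) := by
    intro z
    have h1 : 2 * (μ : ℂ) = 2 + z₁ := by exact_mod_cast h.two_mu
    have h2 : 4 * (ν : ℂ) ^ 2 = 3 * (z₁ : ℂ) ^ 2 + 4 * z₁ - 8 := by exact_mod_cast h.four_nu_sq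
    have h3 : (β : ℂ) = ((z₁ : ℂ) ^ 2 - 1) * (z₁ + 2) := by exact_mod_cast h.eq
    have h4 : (μ : ℂ) = (2 + z₁) / 2 := by linear_combination h1 / 2
    have h5 : (z + μ - ν * Complex.I) * (z + μ + ν * Complex.I) = (z + μ) ^ 2 + (ν : ℂ) ^ 2 := by
      linear_combination (-(ν : ℂ) ^ 2) * Complex.I_sq
    rw [h5, h3, h4]
    linear_combination (z - z₁) / 4 * h2
  have hz0 : (⟨-μ, ν⟩ : ℂ) = -μ + ν * Complex.I := by
    apply Complex.ext <;> simp
  have hμ := h.lt_mu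
  refine ⟨?_, by simp only; linarith, h.nu_pos.le, fun z hz hre => ?_⟩
  · rw [hfac, hz0]
    ring
  · rw [hfac, neg_eq_zero, mul_eq_zero, mul_eq_zero] at hz
    rcases hz with hz | hz | hz
    · have : z.re = z₁ := by
        have := congrArg Complex.re (sub_eq_zero.1 hz)
        simpa using this
      linarith [h.one_lt]
    · have := congrArg Complex.re hz
      simp at this
      simp only
      linarith
    · have := congrArg Complex.re hz
      simp at this
      simp only
      linarith

end

end ThinFilm

namespace ThinFilm

noncomputable section

/-! ### Exponential decay estimates -/

section Decay

variable {E : Type*} [NormedAddCommGroup E] [NormedSpace ℝ E]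

theorem norm_sub_le_of_norm_deriv_le {u u' : ℝ → E} {v v' : ℝ → ℝ} {a b : ℝ} (hab : a ≤ b)
    (hu : ∀ s, HasDerivAt u (u' s) s) (hv : ∀ s, HasDerivAt v (v' s) s)
    (h : ∀ s ∈ Ico a b, ‖u' s‖ ≤ v' s) : ‖u b - u a‖ ≤ v b - v a := by
  have := image_norm_le_of_norm_deriv_right_le_deriv_boundary (f := fun s => u s - u a)
    (f' := u') (B := fun s => v s - v a) (B' := v') (a := a) (b := b)
    (fun s _ => ((hu s).continuousAt.continuousWithinAt).sub continuousWithinAt_const)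
    (fun s _ => ((hu s).sub_const _).hasDerivWithinAt) (by simp)
    (fun s => (hv s).sub_const _) h (right_mem_Icc.2 hab)
  exact this

theorem hasDerivAt_exp_mul_div {c : ℝ} (hc : c ≠ 0) (C s : ℝ) :
    HasDerivAt (fun s => C / c * Real.exp (c * s)) (C * Real.exp (c * s)) s := by
  have h := (((hasDerivAt_id s).const_mul c).exp).const_mul (C / c)
  refine h.congr_deriv ?_
  simp only [id, mul_one]
  field_simp

theorem exists_limit_of_norm_deriv_le [CompleteSpace E] {u u' : ℝ → E} {C δ : ℝ} (hδ : 0 < δ)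
    (hu : ∀ s, HasDerivAt u (u' s) s) (h : ∀ s, 0 ≤ s → ‖u' s‖ ≤ C * Real.exp (-δ * s)) :
    ∃ k, Tendsto u atTop (𝓝 k) ∧ ∀ s, 0 ≤ s → ‖u s - k‖ ≤ C / δ * Real.exp (-δ * s) := by
  have hC : 0 ≤ C := by simpa using (norm_nonneg _).trans (h 0 le_rfl)
  have key : ∀ s t, 0 ≤ s → s ≤ t → ‖u t - u s‖ ≤ C / δ * Real.exp (-δ * s) := by
    intro s t hs hst
    have := norm_sub_le_of_norm_deriv_le hst hu
      (fun r => hasDerivAt_exp_mul_div (neg_ne_zero.2 hδ.ne') C r) (fun r hr => h r (hs.trans hr.1))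
    have h2 : 0 ≤ C / δ * Real.exp (-δ * t) := by positivity
    rw [div_neg] at this
    linarith
  have hlim : Tendsto (fun s : ℝ => C / δ * Real.exp (-δ * s)) atTop (𝓝 0) := by
    have : Tendsto (fun s : ℝ => -δ * s) atTop atBot :=
      tendsto_id.const_mul_atTop_of_neg (neg_lt_zero.2 hδ)
    simpa using (Real.tendsto_exp_atBot.comp this).const_mul (C / δ)
  have hcau : CauchySeq u := by
    refine Metric.cauchySeq_iff'.2 fun ε hε => ?_
    obtain ⟨N, hN, hN0⟩ := ((hlim.eventually (gt_mem_nhds hε)).and (eventually_ge_atTop 0)).exists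
    refine ⟨N, fun n hn => ?_⟩
    rw [dist_eq_norm]
    exact (key N n hN0 hn).trans_lt hN
  obtain ⟨k, hk⟩ := cauchySeq_tendsto_of_complete hcau
  refine ⟨k, hk, fun s hs => ?_⟩
  rw [norm_sub_rev]
  refine le_of_tendsto (hk.sub_const (u s)).norm ?_
  filter_upwards [eventually_ge_atTop s] with t ht using key s t hs ht

end Decay

/-- `u` is bounded by a multiple of `exp (-κ s)` on the half line. -/
def DecaysAt (κ : ℝ) (u : ℝ → ℝ) : Prop := ∃ C, ∀ s, 0 ≤ s → |u s| ≤ C * Real.exp (-κ * s)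

namespace DecaysAt

variable {κ κ' : ℝ} {u v : ℝ → ℝ}

theorem exists_nonneg (h : DecaysAt κ u) :
    ∃ C, 0 ≤ C ∧ ∀ s, 0 ≤ s → |u s| ≤ C * Real.exp (-κ * s) := by
  obtain ⟨C, hC⟩ := h
  exact ⟨C, by simpa using (abs_nonneg _).trans (hC 0 le_rfl), hC⟩

theorem mono (h : DecaysAt κ u) (hκ : κ' ≤ κ) : DecaysAt κ' u := by
  obtain ⟨C, h0, hC⟩ := h.exists_nonneg
  refine ⟨C, fun s hs => (hC s hs).trans ?_⟩
  gcongr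

theorem add (h : DecaysAt κ u) (h' : DecaysAt κ v) : DecaysAt κ fun s => u s + v s := by
  obtain ⟨C, hC⟩ := h
  obtain ⟨D, hD⟩ := h'
  refine ⟨C + D, fun s hs => (abs_add_le _ _).trans ?_⟩
  rw [add_mul]
  exact add_le_add (hC s hs) (hD s hs)

theorem const_mul (h : DecaysAt κ u) (c : ℝ) : DecaysAt κ fun s => c * u s := by
  obtain ⟨C, hC⟩ := h
  refine ⟨|c| * C, fun s hs => ?_⟩
  rw [abs_mul, mul_assoc]
  exact mul_le_mul_of_nonneg_left (hC s hs) (abs_nonneg c)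

theorem of_abs_le_mul {e : ℝ → ℝ} {M : ℝ} (h : DecaysAt κ u) (h' : DecaysAt κ' v)
    (he : ∀ s, 0 ≤ s → |e s| ≤ M * (|u s| * |v s|)) : DecaysAt (κ + κ') e := by
  obtain ⟨C, h0, hC⟩ := h.exists_nonneg
  obtain ⟨D, -, hD⟩ := h'.exists_nonneg
  refine ⟨|M| * (C * D), fun s hs => (he s hs).trans ?_⟩
  have h1 : |u s| * |v s| ≤ (C * Real.exp (-κ * s)) * (D * Real.exp (-κ' * s)) :=
    mul_le_mul (hC s hs) (hD s hs) (abs_nonneg _) (by positivity)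
  calc M * (|u s| * |v s|) ≤ |M| * ((C * Real.exp (-κ * s)) * (D * Real.exp (-κ' * s))) :=
        mul_le_mul (le_abs_self M) h1 (by positivity) (abs_nonneg M)
    _ = |M| * (C * D) * Real.exp (-(κ + κ') * s) := by
        rw [show -(κ + κ') * s = -κ * s + -κ' * s by ring, Real.exp_add]
        ring

theorem tendsto_zero (h : DecaysAt κ u) (hκ : 0 < κ) : Tendsto u atTop (𝓝 0) := by
  obtain ⟨C, hC⟩ := h
  have h1 : Tendsto (fun s : ℝ => -κ * s) atTop atBot :=
    tendsto_id.const_mul_atTop_of_neg (neg_lt_zero.2 hκ)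
  have h2 : Tendsto (fun s : ℝ => C * Real.exp (-κ * s)) atTop (𝓝 0) := by
    simpa using (Real.tendsto_exp_atBot.comp h1).const_mul C
  refine squeeze_zero_norm' ?_ h2
  filter_upwards [eventually_ge_atTop 0] with s hs using hC s hs

/-- Non-decaying modes inherit the decay of the forcing. -/
theorem of_unstable {z : ℝ} {e : ℝ → ℝ} (hz : 0 ≤ z) (hκ : 0 < κ)
    (hu : ∀ s, HasDerivAt u (z * u s + e s) s) (he : DecaysAt κ e) (h0 : Tendsto u atTop (𝓝 0)) :
    DecaysAt κ u := by
  obtain ⟨C, hC⟩ := he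
  have hd : ∀ s, HasDerivAt (fun s => Real.exp (-z * s) * u s) (Real.exp (-z * s) * e s) s := by
    intro s
    have h1 := (((hasDerivAt_id s).const_mul (-z)).exp).mul (hu s)
    refine h1.congr_deriv ?_
    simp only [id, mul_one]
    ring
  obtain ⟨k, hk, hb⟩ := exists_limit_of_norm_deriv_le (C := C) (δ := z + κ) (by linarith) hd
    fun s hs => by
      rw [norm_mul, Real.norm_of_nonneg (Real.exp_nonneg _),
        show -(z + κ) * s = -z * s + -κ * s by ring, Real.exp_add]
      have := mul_le_mul_of_nonneg_left (hC s hs) (Real.exp_nonneg (-z * s))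
      rw [Real.norm_eq_abs]
      linarith
  have hk0 : k = 0 := by
    refine tendsto_nhds_unique hk (squeeze_zero_norm' ?_ (tendsto_norm_zero.comp h0))
    filter_upwards [eventually_ge_atTop 0] with s hs
    rw [norm_mul, Real.norm_of_nonneg (Real.exp_nonneg _)]
    refine mul_le_of_le_one_left (norm_nonneg _) (Real.exp_le_one_iff.2 ?_)
    nlinarith
  refine ⟨C / (z + κ), fun s hs => ?_⟩
  have h1 := hb s hs
  rw [hk0, sub_zero, norm_mul, Real.norm_of_nonneg (Real.exp_nonneg _), Real.norm_eq_abs,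
    show -(z + κ) * s = -z * s + -κ * s by ring, Real.exp_add] at h1
  have h2 := Real.exp_pos (-z * s)
  nlinarith

end DecaysAt

section Spiral

variable {μ ν κ : ℝ} {R I e : ℝ → ℝ}

/-- R + iI solves Z' = (-μ + iν) Z + e, and the exponential is its integrating factor. -/
theorem hasDerivAt_spiral (hR : ∀ s, HasDerivAt R (-μ * R s - ν * I s + e s) s)
    (hI : ∀ s, HasDerivAt I (ν * R s - μ * I s) s) (s : ℝ) :
    HasDerivAt (fun s : ℝ => Complex.exp (-(⟨-μ, ν⟩ : ℂ) * s) * (R s + I s * Complex.I))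
      (Complex.exp (-(⟨-μ, ν⟩ : ℂ) * s) * e s) s := by
  have hz0 : (⟨-μ, ν⟩ : ℂ) = -μ + ν * Complex.I := by
    apply Complex.ext <;> simp
  have h1 : HasDerivAt (fun s : ℝ => -(⟨-μ, ν⟩ : ℂ) * s) (-(⟨-μ, ν⟩ : ℂ)) s := by
    simpa using (Complex.ofRealCLM.hasDerivAt (x := s)).const_mul (-(⟨-μ, ν⟩ : ℂ))
  have h2 := h1.cexp.mul ((hR s).ofReal_comp.add ((hI s).ofReal_comp.mul_const Complex.I))
  refine h2.congr_deriv ?_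
  rw [hz0]
  simp only [Pi.add_apply]
  push_cast
  linear_combination (-(ν : ℂ) * I s) * Complex.exp (-(-μ + ν * Complex.I) * s) * Complex.I_sq

theorem norm_exp_spiral (s : ℝ) :
    ‖Complex.exp (-(⟨-μ, ν⟩ : ℂ) * s)‖ = Real.exp (μ * s) := by
  rw [Complex.norm_exp]
  simp

theorem abs_le_norm_spiral (s : ℝ) :
    |R s| ≤ ‖(R s + I s * Complex.I : ℂ)‖ ∧ |I s| ≤ ‖(R s + I s * Complex.I : ℂ)‖ := by
  constructor
  · simpa using Complex.abs_re_le_norm (R s + I s * Complex.I : ℂ)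
  · simpa using Complex.abs_im_le_norm (R s + I s * Complex.I : ℂ)

/-- A damped spiral inherits slower decay of the forcing. -/
theorem DecaysAt.of_spiral (hR : ∀ s, HasDerivAt R (-μ * R s - ν * I s + e s) s)
    (hI : ∀ s, HasDerivAt I (ν * R s - μ * I s) s) (he : DecaysAt κ e) (hκ : κ < μ) :
    DecaysAt κ R ∧ DecaysAt κ I := by
  obtain ⟨C, h0, hC⟩ := he.exists_nonneg
  set B := ‖(R 0 + I 0 * Complex.I : ℂ)‖ + C / (μ - κ) with hB
  have key : ∀ s, 0 ≤ s → ‖(R s + I s * Complex.I : ℂ)‖ ≤ B * Real.exp (-κ * s) := by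
    intro s hs
    have h1 := norm_sub_le_of_norm_deriv_le hs (hasDerivAt_spiral hR hI)
      (fun r => hasDerivAt_exp_mul_div (sub_pos.2 hκ).ne' C r) fun r hr => by
        rw [norm_mul, norm_exp_spiral, Complex.norm_real, Real.norm_eq_abs]
        refine (mul_le_mul_of_nonneg_left (hC r hr.1) (Real.exp_nonneg _)).trans (le_of_eq ?_)
        rw [show (μ - κ) * r = μ * r + -κ * r by ring, Real.exp_add]
        ring
    have h2 := (norm_sub_norm_le _ _).trans h1
    rw [norm_mul, norm_exp_spiral, norm_mul, norm_exp_spiral] at h2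
    simp only [mul_zero, Real.exp_zero, one_mul, mul_one] at h2
    have h3 : 0 ≤ C / (μ - κ) := div_nonneg h0 (sub_pos.2 hκ).le
    have h4 : 1 ≤ Real.exp ((μ - κ) * s) :=
      Real.one_le_exp (mul_nonneg (sub_pos.2 hκ).le hs)
    have h5 : Real.exp (μ * s) * ‖(R s + I s * Complex.I : ℂ)‖ ≤
        B * Real.exp ((μ - κ) * s) := by
      rw [hB]
      nlinarith [norm_nonneg (R 0 + I 0 * Complex.I : ℂ)]
    rw [show (μ - κ) * s = μ * s + -κ * s by ring, Real.exp_add] at h5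
    have h6 := Real.exp_pos (μ * s)
    nlinarith
  exact ⟨⟨B, fun s hs => (abs_le_norm_spiral s).1.trans (key s hs)⟩,
    ⟨B, fun s hs => (abs_le_norm_spiral s).2.trans (key s hs)⟩⟩

/-- A damped spiral with rapidly decaying forcing is asymptotic to a free spiral. -/
theorem exists_spiral_limit (hR : ∀ s, HasDerivAt R (-μ * R s - ν * I s + e s) s)
    (hI : ∀ s, HasDerivAt I (ν * R s - μ * I s) s) (he : DecaysAt κ e) (hκ : μ < κ) :
    ∃ (k : ℂ) (C : ℝ), ∀ s, 0 ≤ s →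
      ‖(R s + I s * Complex.I : ℂ) - k * Complex.exp ((⟨-μ, ν⟩ : ℂ) * s)‖ ≤
        C * Real.exp (-κ * s) := by
  obtain ⟨C, hC⟩ := he
  obtain ⟨k, -, hk⟩ := exists_limit_of_norm_deriv_le (C := C) (δ := κ - μ) (sub_pos.2 hκ)
    (hasDerivAt_spiral hR hI) fun s hs => by
      rw [norm_mul, norm_exp_spiral, Complex.norm_real, Real.norm_eq_abs]
      refine (mul_le_mul_of_nonneg_left (hC s hs) (Real.exp_nonneg _)).trans (le_of_eq ?_)
      rw [show -(κ - μ) * s = μ * s + -κ * s by ring, Real.exp_add]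
      ring
  refine ⟨k, C / (κ - μ), fun s hs => ?_⟩
  have h1 := hk s hs
  have e1 : Complex.exp (-(⟨-μ, ν⟩ : ℂ) * s) * Complex.exp ((⟨-μ, ν⟩ : ℂ) * s) = 1 := by
    rw [← Complex.exp_add]
    simp
  have e2 : Complex.exp (-(⟨-μ, ν⟩ : ℂ) * s) * (R s + I s * Complex.I) - k =
      Complex.exp (-(⟨-μ, ν⟩ : ℂ) * s) *
        ((R s + I s * Complex.I) - k * Complex.exp ((⟨-μ, ν⟩ : ℂ) * s)) := by
    linear_combination k * e1
  rw [e2, norm_mul, norm_exp_spiral, show -(κ - μ) * s = μ * s + -κ * s by ring,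
    Real.exp_add] at h1
  have h6 := Real.exp_pos (μ * s)
  nlinarith

end Spiral

end

end ThinFilm

namespace ThinFilm

noncomputable section

/-! ### Asymptotics of the autonomous system -/

/-- The profile equation with mobility exponent four in logarithmic variables: `φ = f / y`,
`Γ = f_y - f / y`, `W = y f_yy` and `H = f ^ 4 f_yyy / y ^ 2` as functions of `log y`. -/
structure IsLogProfile (φ Γ W H : ℝ → ℝ) : Prop where
  hφ : ∀ s, HasDerivAt φ (Γ s) s
  hΓ : ∀ s, HasDerivAt Γ (-Γ s + W s) s
  hW : ∀ s, HasDerivAt W (W s + H s * (φ s ^ 4)⁻¹) s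
  hH : ∀ s, HasDerivAt H (-2 * H s + Γ s) s

namespace IsLogProfile

variable {φ Γ W H : ℝ → ℝ} {a β z₁ μ ν κ : ℝ}

/-- The deviation from the linearization is quadratic, so its decay rate is the sum of those of H
and φ - a. -/
theorem exists_abs_error_le (ha : 0 < a) {c B : ℝ} (hc : 0 < c) (hφc : ∀ s, 0 ≤ s → c ≤ φ s)
    (hφB : ∀ s, 0 ≤ s → φ s ≤ B) :
    ∃ M, ∀ s, 0 ≤ s → |H s * ((φ s ^ 4)⁻¹ - (a ^ 4)⁻¹)| ≤ M * (|H s| * |φ s - a|) := by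
  refine ⟨(a ^ 3 + a ^ 2 * B + a * B ^ 2 + B ^ 3) / (a ^ 4 * c ^ 4), fun s hs => ?_⟩
  have h1 := hφc s hs
  have h2 := hφB s hs
  have h3 : 0 < φ s := hc.trans_le h1
  have e : (φ s ^ 4)⁻¹ - (a ^ 4)⁻¹ = -((φ s - a) *
      ((a ^ 3 + a ^ 2 * φ s + a * φ s ^ 2 + φ s ^ 3) / (a ^ 4 * φ s ^ 4))) := by
    field_simp
    ring
  have h4 : 0 ≤ (a ^ 3 + a ^ 2 * φ s + a * φ s ^ 2 + φ s ^ 3) / (a ^ 4 * φ s ^ 4) := by positivity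
  have h5 : (a ^ 3 + a ^ 2 * φ s + a * φ s ^ 2 + φ s ^ 3) / (a ^ 4 * φ s ^ 4) ≤
      (a ^ 3 + a ^ 2 * B + a * B ^ 2 + B ^ 3) / (a ^ 4 * c ^ 4) := by
    have : 0 ≤ B := h3.le.trans h2
    gcongr
  rw [e, abs_mul, abs_neg, abs_mul, abs_of_nonneg h4]
  calc |H s| * (|φ s - a| * ((a ^ 3 + a ^ 2 * φ s + a * φ s ^ 2 + φ s ^ 3) / (a ^ 4 * φ s ^ 4)))
      ≤ |H s| * (|φ s - a| * ((a ^ 3 + a ^ 2 * B + a * B ^ 2 + B ^ 3) / (a ^ 4 * c ^ 4))) := by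
        gcongr
    _ = _ := by ring

variable (φ H β) in
/-- The deviation from the linearized system. -/
def forcing (s : ℝ) : ℝ := H s * ((φ s ^ 4)⁻¹ - β)

variable (Γ W H) in
/-- The coordinate along a real eigenvector. -/
def realMode (z s : ℝ) : ℝ := (z - 1) * Γ s + W s + (z ^ 2 - 1) * H s

variable (Γ W H) in
/-- The real part of the coordinate along a complex eigenvector. -/
def reMode (μ ν s : ℝ) : ℝ := (-μ - 1) * Γ s + W s + (μ ^ 2 - ν ^ 2 - 1) * H s

variable (Γ H) in
/-- The imaginary part of the coordinate along a complex eigenvector. -/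
def imMode (μ ν s : ℝ) : ℝ := ν * Γ s - 2 * μ * ν * H s

variable (φ Γ W H) in
/-- The coordinate along the kernel of the linearization. -/
def neutralMode (a β s : ℝ) : ℝ :=
  φ s - a + (2 * Γ s - 2 * W s - β * H s) / (2 + β)

/-- (z - 1, 1, z² - 1) is a left eigenvector of the linearized system for (Γ, W, H) exactly when (z²
- 1)(z + 2) = β. -/
theorem hasDerivAt_realMode (L : IsLogProfile φ Γ W H) (hz : IsRootData β z₁ μ ν) (s : ℝ) :
    HasDerivAt (realMode Γ W H z₁) (z₁ * realMode Γ W H z₁ s + forcing φ H β s) s := by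
  have h := (((L.hΓ s).const_mul (z₁ - 1)).add (L.hW s)).add ((L.hH s).const_mul (z₁ ^ 2 - 1))
  refine h.congr_deriv ?_
  simp only [realMode, forcing]
  linear_combination (H s) * hz.eq

theorem hasDerivAt_reMode (L : IsLogProfile φ Γ W H) (hz : IsRootData β z₁ μ ν) (s : ℝ) :
    HasDerivAt (reMode Γ W H μ ν)
      (-μ * reMode Γ W H μ ν s - ν * imMode Γ H μ ν s + forcing φ H β s) s := by
  have h := (((L.hΓ s).const_mul (-μ - 1)).add (L.hW s)).add
    ((L.hH s).const_mul (μ ^ 2 - ν ^ 2 - 1))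
  refine h.congr_deriv ?_
  have hμ : μ = (2 + z₁) / 2 := by linarith [hz.two_mu]
  have hν : ν ^ 2 = (3 * z₁ ^ 2 + 4 * z₁ - 8) / 4 := by linarith [hz.four_nu_sq]
  have key : β - 2 * (μ ^ 2 - ν ^ 2 - 1) + μ * (μ ^ 2 - ν ^ 2 - 1) - 2 * μ * ν ^ 2 = 0 := by
    rw [hν, hμ, hz.eq]
    ring
  simp only [reMode, imMode, forcing]
  linear_combination (H s) * key

theorem hasDerivAt_imMode (L : IsLogProfile φ Γ W H) (hz : IsRootData β z₁ μ ν) (s : ℝ) :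
    HasDerivAt (imMode Γ H μ ν) (ν * reMode Γ W H μ ν s - μ * imMode Γ H μ ν s) s := by
  have h := ((L.hΓ s).const_mul ν).sub ((L.hH s).const_mul (2 * μ * ν))
  refine h.congr_deriv ?_
  have hμ : μ = (2 + z₁) / 2 := by linarith [hz.two_mu]
  have hν : ν ^ 2 = (3 * z₁ ^ 2 + 4 * z₁ - 8) / 4 := by linarith [hz.four_nu_sq]
  have key : 4 * μ - 3 * μ ^ 2 + ν ^ 2 + 1 = 0 := by
    rw [hν, hμ]
    ring
  simp only [reMode, imMode]
  linear_combination (ν * H s) * key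

theorem hasDerivAt_neutralMode (L : IsLogProfile φ Γ W H) (hβ : 0 < β) (s : ℝ) :
    HasDerivAt (neutralMode φ Γ W H a β)
      (0 * neutralMode φ Γ W H a β s + -2 / (2 + β) * forcing φ H β s) s := by
  have h := ((L.hφ s).sub_const a).add (((((L.hΓ s).const_mul 2).sub
    ((L.hW s).const_mul 2)).sub ((L.hH s).const_mul β)).div_const (2 + β))
  refine h.congr_deriv ?_
  simp only [forcing]
  field_simp
  ring

/-- Recovery of `H` from the eigenmodes. -/
theorem H_eq (hz : IsRootData β z₁ μ ν) (s : ℝ) :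
    H s = ((z₁ + μ) ^ 2 + ν ^ 2)⁻¹ * (realMode Γ W H z₁ s + (-1) * reMode Γ W H μ ν s +
      (-((z₁ + μ) / ν)) * imMode Γ H μ ν s) := by
  have hν := hz.nu_pos
  have hD : (z₁ + μ) ^ 2 + ν ^ 2 ≠ 0 := by positivity
  rw [eq_inv_mul_iff_mul_eq₀ hD]
  simp only [realMode, reMode, imMode]
  field_simp
  ring

theorem Γ_eq (hz : IsRootData β z₁ μ ν) (s : ℝ) :
    Γ s = ν⁻¹ * imMode Γ H μ ν s + 2 * μ * H s := by
  have hν := hz.nu_pos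
  simp only [imMode]
  field_simp
  ring

theorem W_eq (s : ℝ) :
    W s = reMode Γ W H μ ν s + (μ + 1) * Γ s + (-(μ ^ 2 - ν ^ 2 - 1)) * H s := by
  simp only [reMode]
  ring

theorem φ_sub_eq (s : ℝ) :
    φ s - a = neutralMode φ Γ W H a β s + (-(2 / (2 + β))) * Γ s + 2 / (2 + β) * W s +
      β / (2 + β) * H s := by
  simp only [neutralMode]
  ring

/-- The four modes are coordinates on the state space. The coefficient of the neutral mode is 1; the
others are not needed explicitly. -/
theorem φ_sub_eq_modes (hz : IsRootData β z₁ μ ν) :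
    ∃ c₁ c₂ c₃ : ℝ, ∀ s, φ s - a = neutralMode φ Γ W H a β s + c₁ * realMode Γ W H z₁ s +
      (c₂ * reMode Γ W H μ ν s + c₃ * imMode Γ H μ ν s) := by
  set d := ((z₁ + μ) ^ 2 + ν ^ 2)⁻¹ with hd
  set c := (-(2 / (2 + β))) * (2 * μ) + 2 / (2 + β) * ((μ + 1) * (2 * μ) - (μ ^ 2 - ν ^ 2 - 1)) +
    β / (2 + β) with hc
  refine ⟨c * d, 2 / (2 + β) - c * d, (-(2 / (2 + β))) * ν⁻¹ + 2 / (2 + β) * ((μ + 1) * ν⁻¹) -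
    c * d * ((z₁ + μ) / ν), fun s => ?_⟩
  have h1 := H_eq (Γ := Γ) (W := W) (H := H) hz s
  have h2 := Γ_eq (Γ := Γ) (H := H) hz s
  have h3 := W_eq (Γ := Γ) (W := W) (H := H) (μ := μ) (ν := ν) s
  have h4 := φ_sub_eq (φ := φ) (Γ := Γ) (W := W) (H := H) (a := a) (β := β) s
  linear_combination h4 + (2 / (2 + β)) * h3 +
    (-(2 / (2 + β)) + 2 / (2 + β) * (μ + 1)) * h2 + c * h1

/-- The modes that do not decay freely inherit the decay of the forcing. -/
theorem decaysAt_modes (L : IsLogProfile φ Γ W H) (hβ : 0 < β) (hz : IsRootData β z₁ μ ν)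
    (hκ : 0 < κ) (he : DecaysAt κ (forcing φ H β)) (hH : Tendsto H atTop (𝓝 0))
    (hφ : Tendsto φ atTop (𝓝 a)) :
    DecaysAt κ (realMode Γ W H z₁) ∧ DecaysAt κ (neutralMode φ Γ W H a β) := by
  have hμ := hz.lt_mu
  -- Here κ may exceed μ, so the rate is lowered. Convergence of all unknowns to 0 is enough to
  -- start the integration from infinity.
  obtain ⟨dR, dI⟩ := DecaysAt.of_spiral (κ := min κ 1) (L.hasDerivAt_reMode hz)
    (L.hasDerivAt_imMode hz) (he.mono (min_le_left _ _)) ((min_le_right _ _).trans_lt (by linarith))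
  have hmin : 0 < min κ 1 := lt_min hκ one_pos
  have tR := dR.tendsto_zero hmin
  have tI := dI.tendsto_zero hmin
  have tΓ : Tendsto Γ atTop (𝓝 0) := by
    have h : Tendsto (fun s => ν⁻¹ * imMode Γ H μ ν s + 2 * μ * H s) atTop
        (𝓝 (ν⁻¹ * 0 + 2 * μ * 0)) := (tI.const_mul _).add (hH.const_mul _)
    simp only [mul_zero, add_zero] at h
    exact h.congr fun s => (Γ_eq hz s).symm
  have tW : Tendsto W atTop (𝓝 0) := by
    have h : Tendsto (fun s => reMode Γ W H μ ν s + (μ + 1) * Γ s + (-(μ ^ 2 - ν ^ 2 - 1)) * H s)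
        atTop (𝓝 (0 + (μ + 1) * 0 + (-(μ ^ 2 - ν ^ 2 - 1)) * 0)) :=
      (tR.add (tΓ.const_mul _)).add (hH.const_mul _)
    simp only [mul_zero, add_zero] at h
    exact h.congr fun s => (W_eq s).symm
  have t1 : Tendsto (realMode Γ W H z₁) atTop (𝓝 0) := by
    have h : Tendsto (realMode Γ W H z₁) atTop
        (𝓝 ((z₁ - 1) * 0 + 0 + (z₁ ^ 2 - 1) * 0)) :=
      ((tΓ.const_mul _).add tW).add (hH.const_mul _)
    simpa only [mul_zero, add_zero] using h
  have t0 : Tendsto (neutralMode φ Γ W H a β) atTop (𝓝 0) := by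
    have h : Tendsto (neutralMode φ Γ W H a β) atTop
        (𝓝 (a - a + (2 * 0 - 2 * 0 - β * 0) / (2 + β))) :=
      (hφ.sub_const a).add ((((tΓ.const_mul 2).sub (tW.const_mul 2)).sub
        (hH.const_mul β)).div_const _)
    simpa using h
  exact ⟨DecaysAt.of_unstable (by linarith [hz.one_lt]) hκ (L.hasDerivAt_realMode hz) he t1,
    DecaysAt.of_unstable le_rfl hκ (L.hasDerivAt_neutralMode hβ) (he.const_mul _) t0⟩

/-- Slow decay of the forcing is inherited by the unknowns. -/
theorem decaysAt_of_forcing (L : IsLogProfile φ Γ W H) (hβ : 0 < β) (hz : IsRootData β z₁ μ ν)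
    (hκ : 0 < κ) (hκμ : κ < μ) (he : DecaysAt κ (forcing φ H β)) (hH : Tendsto H atTop (𝓝 0))
    (hφ : Tendsto φ atTop (𝓝 a)) : DecaysAt κ H ∧ DecaysAt κ fun s => φ s - a := by
  obtain ⟨dR, dI⟩ := DecaysAt.of_spiral (L.hasDerivAt_reMode hz) (L.hasDerivAt_imMode hz) he hκμ
  obtain ⟨d1, d0⟩ := L.decaysAt_modes hβ hz hκ he hH hφ
  refine ⟨?_, ?_⟩
  · have h := ((d1.add (dR.const_mul (-1))).add (dI.const_mul (-((z₁ + μ) / ν)))).const_mul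
      ((z₁ + μ) ^ 2 + ν ^ 2)⁻¹
    rw [show H = _ from funext (H_eq (Γ := Γ) (W := W) hz)]
    exact h
  · obtain ⟨c₁, c₂, c₃, hc⟩ := φ_sub_eq_modes (φ := φ) (Γ := Γ) (W := W) (H := H) (a := a) hz
    rw [show (fun s => φ s - a) = _ from funext hc]
    exact (d0.add (d1.const_mul c₁)).add ((dR.const_mul c₂).add (dI.const_mul c₃))

/-- The deviation of `φ` from its limit is a damped oscillation to leading order. -/
theorem exists_expansion (L : IsLogProfile φ Γ W H) (ha : 0 < a)
    (hz : IsRootData (a ^ 4)⁻¹ z₁ μ ν) {c : ℝ} (hc : 0 < c) (hφc : ∀ s, 0 ≤ s → c ≤ φ s)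
    (hφ : DecaysAt (1 / 2) fun s => φ s - a) (hH : DecaysAt (1 / 2) H) :
    ∃ (K : ℂ) (C : ℝ), ∀ s, 0 ≤ s →
      |φ s - a - (K * Complex.exp ((⟨-μ, ν⟩ : ℂ) * s)).re| ≤ C * Real.exp (-(μ + 1 / 4) * s) := by
  have hβ : 0 < (a ^ 4)⁻¹ := by positivity
  have hμ := hz.lt_mu
  obtain ⟨B, hB0, hB⟩ := hφ.exists_nonneg
  obtain ⟨M, hM⟩ := exists_abs_error_le (H := H) ha hc hφc (B := a + B) fun s hs => by
    have h1 := (le_abs_self _).trans (hB s hs)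
    have h2 : Real.exp (-(1 / 2) * s) ≤ 1 := Real.exp_le_one_iff.2 (by linarith)
    nlinarith
  have tH := hH.tendsto_zero (by norm_num)
  have tφ : Tendsto φ atTop (𝓝 a) := by
    simpa using (hφ.tendsto_zero (by norm_num)).add_const a
  have hforce : ∀ κ, DecaysAt κ H → DecaysAt κ (fun s => φ s - a) →
      DecaysAt (κ + κ) (forcing φ H (a ^ 4)⁻¹) := fun κ h1 h2 => h1.of_abs_le_mul h2 hM
  -- Bootstrap: the quadratic forcing doubles the rate, and the spiral modes pass on any rate below
  -- μ. Only a gain of 1/2 per step is kept.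
  have step : ∀ n : ℕ, DecaysAt (min ((n + 1) / 2) (μ - 1 / 4)) H ∧
      DecaysAt (min ((n + 1) / 2) (μ - 1 / 4)) fun s => φ s - a := by
    intro n
    induction n with
    | zero =>
      rw [Nat.cast_zero, zero_add, min_eq_left (by linarith)]
      exact ⟨hH, hφ⟩
    | succ n ih =>
      have hn : (0 : ℝ) ≤ n := n.cast_nonneg
      refine L.decaysAt_of_forcing hβ hz (lt_min (by positivity) (by linarith))
        ((min_le_right _ _).trans_lt (by linarith)) ((hforce _ ih.1 ih.2).mono ?_) tH tφ
      rcases min_cases (((n : ℝ) + 1) / 2) (μ - 1 / 4) with h | h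
      · rw [h.1]
        refine (min_le_left _ _).trans ?_
        push_cast
        linarith
      · rw [h.1]
        exact (min_le_right _ _).trans (by linarith)
  obtain ⟨n, hn⟩ := exists_nat_gt (2 * μ)
  have hs := step n
  rw [min_eq_right (by linarith)] at hs
  -- Doubling μ - 1/4 passes μ because μ > 3/2; the forcing is now negligible compared with the free
  -- spiral.
  have he := (hforce _ hs.1 hs.2).mono (by linarith : μ + 1 / 4 ≤ _)
  have hκ : 0 < μ + 1 / 4 := by linarith
  obtain ⟨k, D, hk⟩ := exists_spiral_limit (L.hasDerivAt_reMode hz) (L.hasDerivAt_imMode hz) he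
    (by linarith)
  obtain ⟨d1, d0⟩ := L.decaysAt_modes hβ hz hκ he tH tφ
  obtain ⟨c₁, c₂, c₃, hc⟩ := φ_sub_eq_modes (φ := φ) (Γ := Γ) (W := W) (H := H) (a := a) hz
  obtain ⟨C, hC⟩ := d0.add (d1.const_mul c₁)
  -- Chosen so that Re(q (R + iI)) = c₂ R + c₃ I.
  set q : ℂ := ⟨c₂, -c₃⟩ with hq
  refine ⟨q * k, C + ‖q‖ * D, fun s hs => ?_⟩
  have e : φ s - a - (q * k * Complex.exp ((⟨-μ, ν⟩ : ℂ) * s)).re =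
      (neutralMode φ Γ W H a (a ^ 4)⁻¹ s + c₁ * realMode Γ W H z₁ s) +
        (q * ((reMode Γ W H μ ν s + imMode Γ H μ ν s * Complex.I) -
          k * Complex.exp ((⟨-μ, ν⟩ : ℂ) * s))).re := by
    have : (q * (reMode Γ W H μ ν s + imMode Γ H μ ν s * Complex.I)).re =
        c₂ * reMode Γ W H μ ν s + c₃ * imMode Γ H μ ν s := by
      simp [hq]
    rw [mul_sub, Complex.sub_re, this, hc s, mul_assoc q k]
    ring
  rw [e, add_mul, mul_assoc]
  refine (abs_add_le _ _).trans (add_le_add (hC s hs) ?_)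
  refine (Complex.abs_re_le_norm _).trans ?_
  rw [norm_mul]
  exact mul_le_mul_of_nonneg_left (hk s hs) (norm_nonneg q)

end IsLogProfile

end

end ThinFilm

namespace ThinFilm

noncomputable section

/-! ### Lifting from time minus infinity -/

/-- Translates the oscillation in s = log y into a complex power of y. -/
theorem mul_cpow_one_add_re {y : ℝ} (hy : 0 < y) (K z : ℂ) :
    (K * (y : ℂ) ^ (1 + z)).re = y * (K * Complex.exp (z * (Real.log y : ℝ))).re := by
  have h0 : (y : ℂ) ≠ 0 := by exact_mod_cast hy.ne'
  rw [Complex.cpow_add _ _ h0, Complex.cpow_one, Complex.cpow_def_of_ne_zero h0,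
    Complex.ofReal_log hy.le, mul_comm z, show K * (y * Complex.exp (Complex.log y * z)) =
      (y : ℂ) * (K * Complex.exp (Complex.log y * z)) by ring, Complex.re_ofReal_mul]

theorem abs_mul_cpow_re_le {y : ℝ} (hy : 0 < y) (K z : ℂ) :
    |(K * (y : ℂ) ^ z).re| ≤ ‖K‖ * y ^ z.re := by
  refine (Complex.abs_re_le_norm _).trans ?_
  rw [norm_mul, Complex.norm_cpow_eq_rpow_re_of_pos hy]

namespace IsProfile

variable {a b : ℝ} {f f₁ f₂ F : ℝ → ℝ}

theorem isLogProfile (P : IsProfile 4 1 a f f₁ f₂ F) :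
    IsLogProfile (fun s => f (Real.exp s) / Real.exp s)
      (fun s => f₁ (Real.exp s) - f (Real.exp s) / Real.exp s)
      (fun s => Real.exp s * f₂ (Real.exp s)) (fun s => F (Real.exp s) / Real.exp s ^ 2) := by
  have he : ∀ s : ℝ, Real.exp s ≠ 0 := fun s => (Real.exp_pos s).ne'
  have d0 : ∀ s, HasDerivAt (fun s => f (Real.exp s) / Real.exp s)
      (f₁ (Real.exp s) - f (Real.exp s) / Real.exp s) s := fun s => by
    refine (((P.hf _).comp s (Real.hasDerivAt_exp s)).div (Real.hasDerivAt_exp s)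
      (he s)).congr_deriv ?_
    have := he s
    simp only [Function.comp]
    field_simp
  refine ⟨d0, fun s => ?_, fun s => ?_, fun s => ?_⟩
  · refine (((P.hf₁ _).comp s (Real.hasDerivAt_exp s)).sub (d0 s)).congr_deriv ?_
    ring
  · refine ((Real.hasDerivAt_exp s).mul ((P.hf₂ _).comp s (Real.hasDerivAt_exp s))).congr_deriv ?_
    have h1 : f (Real.exp s) ^ (-4 : ℝ) = (f (Real.exp s) ^ 4)⁻¹ := by
      rw [Real.rpow_neg (P.pos _).le]
      norm_cast
    have h2 := (P.pos (Real.exp s)).ne'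
    have := he s
    simp only [Function.comp]
    rw [h1]
    field_simp
  · refine (((P.hF _).comp s (Real.hasDerivAt_exp s)).div ((Real.hasDerivAt_exp s).pow 2)
      (pow_ne_zero 2 (he s))).congr_deriv ?_
    have := he s
    simp only [Function.comp, Pi.pow_apply]
    field_simp
    ring

/-- The √y bound in the slope estimate, divided by y, is the rate 1/2 from which the bootstrap
starts. -/
theorem decaysAt_quot (P : IsProfile 4 1 a f f₁ f₂ F) :
    DecaysAt (1 / 2) fun s => f (Real.exp s) / Real.exp s - a := by
  obtain ⟨C, hC⟩ := P.slope
  refine ⟨2 * |C|, fun s hs => ?_⟩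
  have h0 := Real.exp_pos s
  have h1 : 1 ≤ Real.exp (s / 2) := Real.one_le_exp (by linarith)
  have h3 : Real.exp (-(1 / 2) * s) * Real.exp s = Real.exp (s / 2) := by
    rw [← Real.exp_add]; ring_nf
  have h := hC (Real.exp s)
  rw [abs_of_pos h0, ← Real.exp_half] at h
  have e : f (Real.exp s) / Real.exp s - a = (f (Real.exp s) - a * Real.exp s) / Real.exp s := by
    field_simp
  simp only [e]
  rw [abs_div, abs_of_pos h0, div_le_iff₀ h0, mul_assoc, h3]
  have h4 : C * (1 + Real.exp (s / 2)) ≤ |C| * (2 * Real.exp (s / 2)) :=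
    mul_le_mul (le_abs_self C) (by linarith) (by linarith) (abs_nonneg C)
  linarith

theorem decaysAt_flux (P : IsProfile 4 1 a f f₁ f₂ F) :
    DecaysAt (1 / 2) fun s => F (Real.exp s) / Real.exp s ^ 2 := by
  obtain ⟨C, hC⟩ := P.flux
  refine ⟨2 * |C|, fun s hs => ?_⟩
  have h0 := Real.exp_pos s
  have h1 : 1 ≤ Real.exp (3 / 2 * s) := Real.one_le_exp (by linarith)
  have h3 : Real.exp (-(1 / 2) * s) * Real.exp s ^ 2 = Real.exp (3 / 2 * s) := by
    rw [← Real.exp_nat_mul, ← Real.exp_add]; push_cast; ring_nf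
  have h := hC (Real.exp s)
  rw [abs_of_pos h0, ← Real.exp_mul, mul_comm s] at h
  rw [abs_div, abs_of_pos (pow_pos h0 2), div_le_iff₀ (pow_pos h0 2), mul_assoc, h3]
  have h4 : C * (1 + Real.exp (3 / 2 * s)) ≤ |C| * (2 * Real.exp (3 / 2 * s)) :=
    mul_le_mul (le_abs_self C) (by linarith) (by linarith) (abs_nonneg C)
  linarith

theorem exists_expansion (P : IsProfile 4 1 a f f₁ f₂ F) (ha : 0 < a)
    (hlin : ∃ c > 0, ∀ y, 1 ≤ y → c * y ≤ f y) {z₁ μ ν : ℝ}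
    (hz : IsRootData (a ^ 4)⁻¹ z₁ μ ν) :
    ∃ (K : ℂ) (C : ℝ), ∀ y, 1 ≤ y →
      |f y - a * y - (K * (y : ℂ) ^ (1 + (⟨-μ, ν⟩ : ℂ))).re| ≤ C * y ^ (1 + -μ - 1 / 4) := by
  obtain ⟨c, hc, hcy⟩ := hlin
  obtain ⟨K, C, h⟩ := P.isLogProfile.exists_expansion ha hz hc
    (fun s hs => by
      rw [le_div_iff₀ (Real.exp_pos s)]
      exact hcy _ (Real.one_le_exp hs)) P.decaysAt_quot P.decaysAt_flux
  refine ⟨K, C, fun y hy => ?_⟩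
  have hy0 : 0 < y := by linarith
  have h1 := h (Real.log y) (Real.log_nonneg hy)
  rw [Real.exp_log hy0] at h1
  have e : f y - a * y - (K * (y : ℂ) ^ (1 + (⟨-μ, ν⟩ : ℂ))).re =
      y * (f y / y - a - (K * Complex.exp ((⟨-μ, ν⟩ : ℂ) * (Real.log y : ℝ))).re) := by
    rw [mul_cpow_one_add_re hy0]
    field_simp
  have e2 : y ^ (1 + -μ - 1 / 4) = y * Real.exp (-(μ + 1 / 4) * Real.log y) := by
    rw [show 1 + -μ - 1 / 4 = 1 + -(μ + 1 / 4) by ring, Real.rpow_add hy0, Real.rpow_one,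
      Real.rpow_def_of_pos hy0, mul_comm (Real.log y)]
  rw [e, e2, abs_mul, abs_of_pos hy0]
  nlinarith [mul_le_mul_of_nonneg_left h1 hy0.le]

theorem isWeakSolution_exp (P : IsProfile 4 b a f f₁ f₂ F) (hb : 0 < b) :
    IsWeakSolution 4 ⊥ fun x t => Real.exp (b * t) * f (|x| / Real.exp (b * t)) := by
  have hc : Continuous fun t : ℝ => Real.exp (b * t) := by fun_prop
  have hrp : ∀ q : ℝ, Continuous fun t : ℝ => Real.exp (b * t) ^ q := fun q =>
    hc.rpow_const fun t => Or.inl (Real.exp_pos _).ne'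
  refine P.isWeakSolution (lam := fun t => Real.exp (b * t)) (fun t _ => Real.exp_pos _)
    (fun t _ => ?_) (fun x t _ => ?_) ?_ (fun x t _ => ?_)
    (fun T => ⟨Real.exp (b * T), fun t _ htT => ?_⟩) (fun R => ?_) (fun R => ?_)
  · refine (((hasDerivAt_id t).const_mul b).exp).congr_deriv ?_
    norm_num
    ring
  · rw [P.eval_abs_div x (Real.exp_pos _)]
  · have h1 : Continuous fun p : ℝ × ℝ => Real.exp (b * p.2) := by fun_prop
    exact (h1.mul (P.continuous_f.comp
      (continuous_fst.abs.div h1 fun p => (Real.exp_pos _).ne'))).continuousOn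
  · exact mul_nonneg (Real.exp_nonneg _) (P.pos _).le
  · exact Real.exp_le_exp.2 (mul_le_mul_of_nonneg_left htT hb.le)
  · exact (hrp _).integrableOn_Icc.mono_set inter_subset_right
  · exact (hrp _).integrableOn_Icc.mono_set inter_subset_right

theorem tendstoUniformlyOn_exp (P : IsProfile 4 b a f f₁ f₂ F) (hb : 0 < b) {R : ℝ} :
    TendstoUniformlyOn (fun t x => Real.exp (b * t) * f (|x| / Real.exp (b * t)))
      (fun x => a * |x|) atBot (Icc (-R) R) := by
  obtain ⟨C, hC, h⟩ := P.exists_abs_scaled_sub_le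
  have h1 : Tendsto (fun t => Real.exp (b * t)) atBot (𝓝 0) :=
    Real.tendsto_exp_atBot.comp (tendsto_id.const_mul_atBot hb)
  have h2 : Tendsto (fun t => C * (Real.exp (b * t) + √(Real.exp (b * t) * R))) atBot
      (𝓝 (C * (0 + √(0 * R)))) :=
    (h1.add (h1.mul_const R).sqrt).const_mul C
  simp only [zero_mul, Real.sqrt_zero, add_zero, mul_zero] at h2
  refine Metric.tendstoUniformlyOn_iff.2 fun ε hε => ?_
  filter_upwards [h2.eventually (gt_mem_nhds hε)] with t ht x hx
  have hx' : |x| ≤ R := abs_le.2 hx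
  rw [dist_comm, Real.dist_eq, P.eval_abs_div x (Real.exp_pos _)]
  refine ((h _ x (Real.exp_pos _)).trans ?_).trans_lt ht
  gcongr

end IsProfile

section Remainder

variable {a : ℝ} {f : ℝ → ℝ} {K z : ℂ} {C : ℝ}

theorem exists_remainder_le_small (hK : ∀ y, 1 ≤ y →
      |f y - a * y - (K * (y : ℂ) ^ (1 + z)).re| ≤ C * y ^ (1 + z.re - 1 / 4)) {ε : ℝ}
    (hε : 0 < ε) : ∃ M : ℝ, 0 < M ∧ ∀ y, M ≤ y →
      |f y - a * y - (K * (y : ℂ) ^ (1 + z)).re| ≤ ε * y ^ (1 + z.re) := by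
  have h : Tendsto (fun y : ℝ => C * y ^ (-(1 / 4 : ℝ))) atTop (𝓝 0) := by
    simpa using (tendsto_rpow_neg_atTop (by norm_num : (0 : ℝ) < 1 / 4)).const_mul C
  obtain ⟨M, hM⟩ := eventually_atTop.1 (h.eventually (gt_mem_nhds hε))
  refine ⟨max M 1, by positivity, fun y hy => ?_⟩
  have hy1 : 1 ≤ y := (le_max_right _ _).trans hy
  have hy0 : 0 < y := by linarith
  refine (hK y hy1).trans ?_
  rw [sub_eq_add_neg (1 + z.re), Real.rpow_add hy0]
  have h1 := (hM y ((le_max_left _ _).trans hy)).le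
  have h2 := Real.rpow_nonneg hy0.le (1 + z.re)
  nlinarith

/-- For y ≥ 1 this is the expansion. For y < 1 the power y^(1 + Re z) is at least 1 because Re z <
-1, so it dominates both the bounded difference f - ay and the oscillating term. -/
theorem exists_remainder_le (hz : z.re < -1) {D : ℝ}
    (hf : ∀ y, |f y - (a * |y|)| ≤ D * (1 + √|y|))
    (hK : ∀ y, 1 ≤ y →
      |f y - a * y - (K * (y : ℂ) ^ (1 + z)).re| ≤ C * y ^ (1 + z.re - 1 / 4)) :
    ∃ B, ∀ y, 0 < y → |f y - a * y - (K * (y : ℂ) ^ (1 + z)).re| ≤ B * y ^ (1 + z.re) := by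
  refine ⟨|C| + (2 * |D| + ‖K‖), fun y hy => ?_⟩
  have hp := Real.rpow_pos_of_pos hy (1 + z.re)
  rcases le_or_gt 1 y with h1 | h1
  · refine (hK y h1).trans ?_
    have h2 : y ^ (1 + z.re - 1 / 4) ≤ y ^ (1 + z.re) :=
      Real.rpow_le_rpow_of_exponent_le h1 (by linarith)
    calc C * y ^ (1 + z.re - 1 / 4) ≤ |C| * y ^ (1 + z.re) :=
          mul_le_mul (le_abs_self C) h2 (by positivity) (abs_nonneg C)
      _ ≤ _ := by
          refine mul_le_mul_of_nonneg_right ?_ hp.le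
          linarith [abs_nonneg D, norm_nonneg K]
  · have h2 := hf y
    rw [abs_of_pos hy] at h2
    have h3 := abs_mul_cpow_re_le hy K (1 + z)
    have h4 : √y ≤ 1 := Real.sqrt_le_one.2 h1.le
    have h5 : D * (1 + √y) ≤ |D| * 2 :=
      mul_le_mul (le_abs_self D) (by linarith) (by positivity) (abs_nonneg D)
    have h6 : 1 ≤ y ^ (1 + z.re) :=
      Real.one_le_rpow_of_pos_of_le_one_of_nonpos hy h1.le (by linarith)
    have h7 : (1 + z).re = 1 + z.re := by simp
    rw [h7] at h3
    have h8 := abs_sub (f y - a * y) (K * (y : ℂ) ^ (1 + z)).re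
    nlinarith [abs_nonneg D, abs_nonneg C, mul_nonneg (abs_nonneg C) hp.le]

end Remainder

/-- For mobility exponent four the cone is lifted from time `-∞`. -/
theorem exists_expLift {a : ℝ} (ha : 0 < a) :
    ∃ (b : ℝ) (h : ℝ → ℝ → ℝ) (f : ℝ → ℝ) (K z₀ : ℂ),
      0 < b ∧ IsWeakSolution 4 ⊥ h ∧ (∀ y : ℝ, 0 ≤ y → 0 < f y) ∧
      (∀ x t : ℝ, h x t = Real.exp (b * t) * f (|x| / Real.exp (b * t))) ∧
      IsLeadingRoot (b / a ^ 4) z₀ ∧ z₀.re < -1 ∧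
      (fun y : ℝ => f y - a * y - (K * (y : ℂ) ^ (1 + z₀)).re)
        =o[atTop] (fun y : ℝ => y ^ (1 + z₀.re)) ∧
      (∀ ε : ℝ, 0 < ε → ∃ M : ℝ, 0 < M ∧ ∀ x t : ℝ, M ≤ |x| / Real.exp (b * t) →
        |h x t - a * |x|
            - Real.exp (b * t) * (K * ((|x| / Real.exp (b * t) : ℝ) : ℂ) ^ (1 + z₀)).re|
          ≤ ε * (Real.exp (b * t) * (|x| / Real.exp (b * t)) ^ (1 + z₀.re))) ∧
      (∀ R : ℝ, 0 < R → ∀ ε : ℝ, 0 < ε → ∃ T : ℝ, ∀ t : ℝ, t ≤ T → ∀ x : ℝ, x ≠ 0 → |x| ≤ R →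
        |h x t - a * |x|
            - Real.exp (b * t) * (K * ((|x| / Real.exp (b * t) : ℝ) : ℂ) ^ (1 + z₀)).re|
          ≤ ε * (|x| / Real.exp (b * t)) ^ (1 + z₀.re)) ∧
      ∀ R : ℝ, 0 < R →
        TendstoUniformlyOn (fun t x => h x t) (fun x => a * |x|) atBot (Icc (-R) R) := by
  obtain ⟨p, f, f₁, w, F, hp, T, hN⟩ := exists_nonEscaping (m := 4) (by norm_num)
  obtain ⟨a₀, ha₀, hlim, hC⟩ := T.exists_quot_limit hN hp
  have P := T.isProfile hN hp hC
  have h4 := T.quot_limit_pow_four_le hN hp ha₀ hlim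
  obtain ⟨z₁, μ, ν, hz⟩ := exists_isRootData (β := (a₀ ^ 4)⁻¹) (by
    rw [le_inv_comm₀ (by norm_num) (by positivity)]
    norm_num
    exact h4)
  obtain ⟨K, C, hK⟩ := P.exists_expansion ha₀ (T.one_le_and_linear_bound hN hp).2 hz
  set c := a / a₀ with hc
  have hc0 : 0 < c := div_pos ha ha₀
  have hca : c * a₀ = a := div_mul_cancel₀ a ha₀.ne'
  -- Only the amplitude is scaled: the slope becomes a, the rate is then b = c⁴, and b/a⁴ keeps the
  -- value a₀^(-4) for which the roots were computed.
  have Q := P.scale hc0 one_pos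
  simp only [div_one, one_pow, mul_one, hca] at Q
  set b := c ^ (4 : ℝ) with hb
  have hb0 : 0 < b := Real.rpow_pos_of_pos hc0 4
  have hβ : b / a ^ 4 = (a₀ ^ 4)⁻¹ := by
    rw [hb, ← hca, show c ^ (4 : ℝ) = c ^ 4 by norm_cast, mul_pow]
    field_simp
  have hre : (⟨-μ, ν⟩ : ℂ).re < -1 := by
    simp only
    linarith [hz.lt_mu]
  set z₀ : ℂ := ⟨-μ, ν⟩ with hz0
  have hK' : ∀ y : ℝ, 1 ≤ y → |c * f y - a * y - (c * K * (y : ℂ) ^ (1 + z₀)).re| ≤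
      c * C * y ^ (1 + z₀.re - 1 / 4) := by
    intro y hy
    have e : c * f y - a * y - (c * K * (y : ℂ) ^ (1 + z₀)).re =
        c * (f y - a₀ * y - (K * (y : ℂ) ^ (1 + z₀)).re) := by
      rw [mul_assoc, Complex.re_ofReal_mul, ← hca]
      ring
    rw [e, abs_mul, abs_of_pos hc0, mul_assoc]
    exact mul_le_mul_of_nonneg_left (hK y hy) hc0.le
  have hsmall := fun ε hε => exists_remainder_le_small (ε := ε) hK' hε
  have hrem : ∀ x t : ℝ, Real.exp (b * t) * (c * f (|x| / Real.exp (b * t))) - a * |x|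
      - Real.exp (b * t) * (c * K * ((|x| / Real.exp (b * t) : ℝ) : ℂ) ^ (1 + z₀)).re =
      Real.exp (b * t) * (c * f (|x| / Real.exp (b * t)) - a * (|x| / Real.exp (b * t))
        - (c * K * ((|x| / Real.exp (b * t) : ℝ) : ℂ) ^ (1 + z₀)).re) := by
    intro x t
    have : Real.exp (b * t) * (a * (|x| / Real.exp (b * t))) = a * |x| := by
      have := (Real.exp_pos (b * t)).ne'
      field_simp
    rw [mul_sub, mul_sub, this]
  refine ⟨b, fun x t => Real.exp (b * t) * (c * f (|x| / Real.exp (b * t))), fun y => c * f y,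
    c * K, z₀, hb0, Q.isWeakSolution_exp hb0, fun y _ => Q.pos y, fun x t => rfl,
    hβ ▸ hz.isLeadingRoot, hre, ?_, fun ε hε => ?_, fun R hR ε hε => ?_,
    fun R hR => Q.tendstoUniformlyOn_exp hb0⟩
  · refine isLittleO_iff.2 fun ε hε => ?_
    obtain ⟨M, hM0, hM⟩ := hsmall ε hε
    filter_upwards [eventually_ge_atTop M] with y hy
    rw [Real.norm_eq_abs, Real.norm_of_nonneg (Real.rpow_nonneg (hM0.le.trans hy) _)]
    exact hM y hy
  · obtain ⟨M, hM0, hM⟩ := hsmall ε hε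
    refine ⟨M, hM0, fun x t hxt => ?_⟩
    rw [hrem, abs_mul, abs_of_pos (Real.exp_pos _), mul_left_comm]
    exact mul_le_mul_of_nonneg_left (hM _ hxt) (Real.exp_nonneg _)
  · obtain ⟨D, hD⟩ := Q.slope
    obtain ⟨B, hB⟩ := exists_remainder_le hre hD hK'
    -- The remainder bound holds for all y > 0, so the smallness comes from the prefactor e^(bt)
    -- alone and the threshold does not depend on R.
    have hlim0 : Tendsto (fun t => Real.exp (b * t) * B) atBot (𝓝 0) := by
      simpa using (Real.tendsto_exp_atBot.comp (tendsto_id.const_mul_atBot hb0)).mul_const B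
    obtain ⟨S, hS⟩ := eventually_atBot.1 (hlim0.eventually (gt_mem_nhds hε))
    refine ⟨S, fun t ht x hx _ => ?_⟩
    have hy : 0 < |x| / Real.exp (b * t) := div_pos (abs_pos.2 hx) (Real.exp_pos _)
    rw [hrem, abs_mul, abs_of_pos (Real.exp_pos _)]
    refine (mul_le_mul_of_nonneg_left (hB _ hy) (Real.exp_nonneg _)).trans ?_
    rw [← mul_assoc]
    exact mul_le_mul_of_nonneg_right (hS t ht).le (Real.rpow_nonneg hy.le _)

end

end ThinFilm

/-! ### The main theorem. -/

theorem mainTheorem2 :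
    -- (i) lifting at time `0` for `m ∈ (0, 4)`
    (∀ m : ℝ, 0 < m → m < 4 → ∀ a : ℝ, 0 < a →
      ∃ (h : ℝ → ℝ → ℝ) (f : ℝ → ℝ),
        ThinFilm.IsWeakSolution m ((0 : ℝ) : WithBot ℝ) h ∧
        ThinFilm.HasInitialData ((0 : ℝ) : WithBot ℝ) h (fun x => a * |x|) ∧
        (∀ y : ℝ, 0 ≤ y → 0 < f y) ∧
        ∀ x t : ℝ, 0 < t →
          h x t = t ^ (1 / (4 - m)) * f (|x| / t ^ (1 / (4 - m)))) ∧
    -- (ii) lifting from time `-∞` for `m = 4`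
    (∀ a : ℝ, 0 < a →
      ∃ (b : ℝ) (h : ℝ → ℝ → ℝ) (f : ℝ → ℝ) (K z₀ : ℂ),
        0 < b ∧
        ThinFilm.IsWeakSolution 4 ⊥ h ∧
        (∀ y : ℝ, 0 ≤ y → 0 < f y) ∧
        (∀ x t : ℝ, h x t = Real.exp (b * t) * f (|x| / Real.exp (b * t))) ∧
        ThinFilm.IsLeadingRoot (b / a ^ 4) z₀ ∧ z₀.re < -1 ∧
        (fun y : ℝ => f y - a * y - (K * (y : ℂ) ^ (1 + z₀)).re)
          =o[atTop] (fun y : ℝ => y ^ (1 + z₀.re)) ∧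
        -- the expansion of `h`, uniformly as `|x| / e^{bt} → ∞`
        (∀ ε : ℝ, 0 < ε → ∃ M : ℝ, 0 < M ∧ ∀ x t : ℝ, M ≤ |x| / Real.exp (b * t) →
          |h x t - a * |x|
              - Real.exp (b * t) * (K * ((|x| / Real.exp (b * t) : ℝ) : ℂ) ^ (1 + z₀)).re|
            ≤ ε * (Real.exp (b * t) * (|x| / Real.exp (b * t)) ^ (1 + z₀.re))) ∧
        -- the remainder as `t → -∞`, uniformly for `x ∈ [-R, R]`, `x ≠ 0`
        (∀ R : ℝ, 0 < R → ∀ ε : ℝ, 0 < ε → ∃ T : ℝ, ∀ t : ℝ, t ≤ T → ∀ x : ℝ, x ≠ 0 → |x| ≤ R →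
          |h x t - a * |x|
              - Real.exp (b * t) * (K * ((|x| / Real.exp (b * t) : ℝ) : ℂ) ^ (1 + z₀)).re|
            ≤ ε * (|x| / Real.exp (b * t)) ^ (1 + z₀.re)) ∧
        (∀ R : ℝ, 0 < R →
          TendstoUniformlyOn (fun t x => h x t) (fun x => a * |x|) atBot (Icc (-R) R))) ∧
    -- non-uniqueness for `m ∈ (2, 4)`: the cone and a lifting solution share the initial data
    (∀ m : ℝ, 2 < m → m < 4 → ∀ a : ℝ, 0 < a →
      ThinFilm.IsWeakSolution m ((0 : ℝ) : WithBot ℝ) (fun x _ => a * |x|) ∧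
      ThinFilm.HasInitialData ((0 : ℝ) : WithBot ℝ) (fun x _ => a * |x|) (fun x => a * |x|) ∧
      ∃ (h : ℝ → ℝ → ℝ) (f : ℝ → ℝ),
        ThinFilm.IsWeakSolution m ((0 : ℝ) : WithBot ℝ) h ∧
        ThinFilm.HasInitialData ((0 : ℝ) : WithBot ℝ) h (fun x => a * |x|) ∧
        (∀ x t : ℝ, 0 < t →
          h x t = t ^ (1 / (4 - m)) * f (|x| / t ^ (1 / (4 - m)))) ∧
        ∀ t : ℝ, 0 < t → h 0 t ≠ a * |(0 : ℝ)|) := by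
  refine ⟨fun m hm hm4 a ha => ThinFilm.exists_coneLift hm hm4 ha,
    fun a ha => ThinFilm.exists_expLift ha,
    fun m hm hm4 a ha => ⟨ThinFilm.isWeakSolution_cone hm ha _, fun x => tendsto_const_nhds, ?_⟩⟩
  obtain ⟨h, f, hw, hi, hf, hh⟩ := ThinFilm.exists_coneLift (by linarith) hm4 ha
  refine ⟨h, f, hw, hi, hh, fun t ht => ?_⟩
  have ht' := Real.rpow_pos_of_pos ht (1 / (4 - m))
  rw [hh 0 t ht, abs_zero, mul_zero, zero_div]
  exact (mul_pos ht' (hf 0 le_rfl)).ne'
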